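/- Let $k$ be an algebraically closed field of characteristic $0$. A *rope* on $\mathbf P^1=\mathbf P^1_k$ with conormal bundle $\mathcal E$ is a $k$-scheme $\widetilde Y$ together with a closed immersion $\mathbf P^1\hookrightarrow\widetilde Y$ over $k$ that identifies $\mathbf P^1$ with $\widetilde Y_{\mathrm{red}}$ and whose ideal sheaf $\mathcal I\subset\mathcal O_{\widetilde Y}$ satisfies $\mathcal I^2=0$ and $\mathcal I\simeq\mathcal E$ as $\mathcal O_{\mathbf P^1}$-modules. **Theorem 4.2 (embedding).** Let $a\ge b$ be integers and let $\mathcal E=\mathcal O_{\mathbf P^1}(-a)\oplus\mathcal O_{\mathbf P^1}(-b)$. Put $N_0=\max\{4,a-1\}$, and let $N\ge N_0$ be an integer. Then for every rope $\widetilde Y$ on $\mathbf P^1$ with conormal bundle $\mathcal E$ (a rope of multiplicity $3$) and every embedding $i:\mathbf P^1\hookrightarrow\mathbf P^N$ of $\mathbf P^1$ as a rational normal curve (that is, $i$ is given by a basis of the space $H^0(\mathbf P^1,\mathcal O_{\mathbf P^1}(N))$ of binary forms of degree $N$) there is a closed immersion $\tilde i:\widetilde Y\hookrightarrow\mathbf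 P^N$ over $k$ whose restriction to $\mathbf P^1$ is $i$. In particular, $\widetilde Y$ can be embedded as a closed subscheme of $\mathbf P^N$ supported on a rational normal curve of degree $N$. -/

import Mathlib

open CategoryTheory CategoryTheory.Limits TopologicalSpace Opposite AlgebraicGeometry

universe u

noncomputable section

namespace RopeEmbedding

/-! ### Serre's twisting sheaves on `Proj` of a graded ring -/

section Twist

variable {A : Type u} {σ : Type*} [CommRing A] [SetLike σ A] [AddSubgroupClass σ A]
variable (𝒜 : ℕ → σ) [GradedRing 𝒜]

/-- The local ring `A_𝔭` (all elements outside of `𝔭` are inverted) at a relevant homogeneous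
prime ideal `𝔭`. -/
abbrev LocRing (x : ProjectiveSpectrum 𝒜) : Type u :=
  Localization.AtPrime x.asHomogeneousIdeal.toIdeal

/-- The complement of a homogeneous prime ideal. -/
abbrev primeComplAt (x : ProjectiveSpectrum 𝒜) : Submonoid A :=
  x.asHomogeneousIdeal.toIdeal.primeCompl

/-- `f` is given on all of `U` by a single fraction `r / s` of homogeneous elements with
`deg r = deg s + d`. -/
def IsTwistedFraction (d : ℤ) {U : Opens (ProjectiveSpectrum.top 𝒜)}
    (f : ∀ x : U, LocRing 𝒜 x.1) : Prop :=
  ∃ (i j : ℕ) (r s : A), r ∈ 𝒜 i ∧ s ∈ 𝒜 j ∧ (i : ℤ) = j + d ∧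
    ∀ x : U, ∃ hs : s ∈ primeComplAt 𝒜 x.1, f x = Localization.mk r ⟨s, hs⟩

/-- Being globally a fraction of degree `d` is stable under restriction. -/
def twistedPrelocal (d : ℤ) : TopCat.PrelocalPredicate (X := ProjectiveSpectrum.top 𝒜) (LocRing 𝒜) where
  pred f := IsTwistedFraction 𝒜 d f
  res := by
    rintro U V k f ⟨i, j, r, s, hr, hs, hd, h⟩
    exact ⟨i, j, r, s, hr, hs, hd, fun x => h (k x)⟩

/-- Being locally a fraction of degree `d`. -/
def twistedLocal (d : ℤ) : TopCat.LocalPredicate (X := ProjectiveSpectrum.top 𝒜) (LocRing 𝒜) :=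
  (twistedPrelocal 𝒜 d).sheafify

variable {𝒜}

theorem twisted_zero (d : ℤ) (U : Opens (ProjectiveSpectrum.top 𝒜)) :
    (twistedLocal 𝒜 d).pred (0 : ∀ x : U, LocRing 𝒜 x.1) := by
  intro x
  -- a homogeneous element of positive degree that does not vanish at `x`
  obtain ⟨m, hm, t, ht, htx⟩ : ∃ m : ℕ, 0 < m ∧ ∃ t ∈ 𝒜 m, t ∉ x.1.asHomogeneousIdeal.toIdeal := by
    by_contra! hcon
    refine x.1.not_irrelevant_le fun a ha => ?_
    have ha' : a ∈ HomogeneousIdeal.irrelevant 𝒜 := ha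
    rw [HomogeneousIdeal.mem_irrelevant_iff] at ha'
    classical
    rw [← DirectSum.sum_support_decompose 𝒜 a]
    refine Ideal.sum_mem _ fun c _ => ?_
    rcases Nat.eq_zero_or_pos c with rfl | hc
    · have : ((DirectSum.decompose 𝒜 a) 0 : A) = 0 := ha'
      rw [this]
      exact Ideal.zero_mem _
    · exact hcon c hc _ (SetLike.coe_mem _)
  have hpos : 0 ≤ (((d.natAbs • m : ℕ) : ℤ)) + d := by
    have h1 : (d.natAbs : ℤ) * 1 ≤ d.natAbs * m :=
      mul_le_mul_of_nonneg_left (by exact_mod_cast hm) (by positivity)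
    have h2 : -(d.natAbs : ℤ) ≤ d := by omega
    push_cast [smul_eq_mul] at h1 h2 ⊢
    linarith
  refine ⟨U ⊓ ProjectiveSpectrum.basicOpen 𝒜 t, ⟨x.2, htx⟩, Opens.infLELeft _ _,
    ((((d.natAbs • m : ℕ) : ℤ)) + d).toNat, d.natAbs • m, 0, t ^ d.natAbs, zero_mem _,
    SetLike.pow_mem_graded _ ht, Int.toNat_of_nonneg hpos, fun y => ?_⟩
  have hy : t ∈ primeComplAt 𝒜 y.1 := y.2.2
  exact ⟨pow_mem hy _, (Localization.mk_zero _).symm⟩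

theorem twisted_add (d : ℤ) (U : Opens (ProjectiveSpectrum.top 𝒜))
    (f g : ∀ x : U, LocRing 𝒜 x.1) (hf : (twistedLocal 𝒜 d).pred f)
    (hg : (twistedLocal 𝒜 d).pred g) : (twistedLocal 𝒜 d).pred (f + g) := by
  intro x
  obtain ⟨V, hxV, k, i, j, r, s, hr, hs, hd, h⟩ := hf x
  obtain ⟨V', hxV', k', i', j', r', s', hr', hs', hd', h'⟩ := hg x
  refine ⟨V ⊓ V', ⟨hxV, hxV'⟩, Opens.infLELeft _ _ ≫ k, i + j', j + j', s * r' + s' * r, s * s',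
    add_mem ?_ ?_, SetLike.mul_mem_graded hs hs', by push_cast; omega, fun y => ?_⟩
  · have : i + j' = j + i' := by omega
    exact this ▸ SetLike.mul_mem_graded hs hr'
  · exact add_comm j' i ▸ SetLike.mul_mem_graded hs' hr
  · obtain ⟨hy, e⟩ := h ⟨y.1, y.2.1⟩
    obtain ⟨hy', e'⟩ := h' ⟨y.1, y.2.2⟩
    refine ⟨mul_mem hy hy', ?_⟩
    exact (congrArg₂ (· + ·) e e').trans (Localization.add_mk _ _ _ _)

theorem twisted_neg (d : ℤ) (U : Opens (ProjectiveSpectrum.top 𝒜))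
    (f : ∀ x : U, LocRing 𝒜 x.1) (hf : (twistedLocal 𝒜 d).pred f) :
    (twistedLocal 𝒜 d).pred (-f) := by
  intro x
  obtain ⟨V, hxV, k, i, j, r, s, hr, hs, hd, h⟩ := hf x
  refine ⟨V, hxV, k, i, j, -r, s, neg_mem hr, hs, hd, fun y => ?_⟩
  obtain ⟨hy, e⟩ := h y
  exact ⟨hy, (congrArg (- ·) e).trans (Localization.neg_mk _ _)⟩

variable (𝒜)

/-- Regular functions act on the sections of the twisting sheaf pointwise. -/
def twistedSmul (U : Opens (ProjectiveSpectrum.top 𝒜))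
    (a : (ProjectiveSpectrum.Proj.structureSheaf 𝒜).1.obj (op U)) (f : ∀ x : U, LocRing 𝒜 x.1) :
    ∀ x : U, LocRing 𝒜 x.1 :=
  fun x => HomogeneousLocalization.val (a.1 x) * f x

theorem twisted_smul (d : ℤ) (U : Opens (ProjectiveSpectrum.top 𝒜))
    (a : (ProjectiveSpectrum.Proj.structureSheaf 𝒜).1.obj (op U)) (f : ∀ x : U, LocRing 𝒜 x.1)
    (hf : (twistedLocal 𝒜 d).pred f) : (twistedLocal 𝒜 d).pred (twistedSmul 𝒜 U a f) := by
  intro x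
  obtain ⟨V, hxV, k, i, j, r, s, hr, hs, hd, h⟩ := hf x
  obtain ⟨V', hxV', k', i', r', s', hs', h'⟩ := a.2 x
  refine ⟨V ⊓ V', ⟨hxV, hxV'⟩, Opens.infLELeft _ _ ≫ k, i' + i, i' + j, r' * r, s' * s,
    SetLike.mul_mem_graded r'.2 hr, SetLike.mul_mem_graded s'.2 hs, by push_cast; omega,
    fun y => ?_⟩
  obtain ⟨hy, e⟩ := h ⟨y.1, y.2.1⟩
  have e' := h' ⟨y.1, y.2.2⟩
  have hy' : s'.1 ∈ primeComplAt 𝒜 y.1 :=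
    hs' ⟨y.1, y.2.2⟩
  refine ⟨mul_mem hy' hy, ?_⟩
  exact (congrArg₂ (fun p q => HomogeneousLocalization.val p * q) e' e).trans
    (Localization.mk_mul _ _ _ _)

/-- The additive group of sections over `U` of the twisting sheaf of degree `d`. -/
def twistedSections (d : ℤ) (U : Opens (ProjectiveSpectrum.top 𝒜)) :
    AddSubgroup (∀ x : U, LocRing 𝒜 x.1) where
  carrier := {f | (twistedLocal 𝒜 d).pred f}
  zero_mem' := twisted_zero d U
  add_mem' := twisted_add d U _ _
  neg_mem' := twisted_neg d U _

/-- The twisting sheaf of degree `d`, as a presheaf of abelian groups. -/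
def twistedPresheaf (d : ℤ) : TopCat.Presheaf Ab.{u} (Proj 𝒜) where
  obj U := AddCommGrpCat.of (twistedSections 𝒜 d U.unop)
  map {U V} k := AddCommGrpCat.ofHom
    { toFun := fun f => ⟨fun x => f.1 (k.unop x), (twistedLocal 𝒜 d).res k.unop f.1 f.2⟩
      map_zero' := rfl
      map_add' := fun _ _ => rfl }

theorem twistedPresheaf_isSheaf (d : ℤ) : (twistedPresheaf 𝒜 d).IsSheaf :=
  (TopCat.Presheaf.isSheaf_iff_isSheaf_comp (forget Ab) _).mpr
    (TopCat.Presheaf.isSheaf_of_iso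
      (NatIso.ofComponents (fun _ => Iso.refl _) (by intros; rfl))
      (TopCat.subsheafToTypes (twistedLocal 𝒜 d)).property)

instance twistedModule (d : ℤ) (U : (Opens (Proj 𝒜))ᵒᵖ) :
    Module ((Proj 𝒜).ringCatSheaf.obj.obj U) ((twistedPresheaf 𝒜 d).obj U) where
  smul a f := ⟨twistedSmul 𝒜 U.unop a f.1, twisted_smul 𝒜 d U.unop a f.1 f.2⟩
  one_smul f := Subtype.ext (funext fun x =>
    (congrArg (· * f.1 x) HomogeneousLocalization.val_one).trans (one_mul (f.1 x)))
  mul_smul _ _ f := Subtype.ext (funext fun x =>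
    (congrArg (· * f.1 x) (HomogeneousLocalization.val_mul _ _)).trans (mul_assoc _ _ (f.1 x)))
  smul_zero _ := Subtype.ext (funext fun _ => mul_zero _)
  smul_add _ f g := Subtype.ext (funext fun x => mul_add _ (f.1 x) (g.1 x))
  add_smul _ _ f := Subtype.ext (funext fun x =>
    (congrArg (· * f.1 x) (HomogeneousLocalization.val_add _ _)).trans (add_mul _ _ (f.1 x)))
  zero_smul f := Subtype.ext (funext fun x =>
    (congrArg (· * f.1 x) HomogeneousLocalization.val_zero).trans (zero_mul (f.1 x)))

/-- Serre's twisting sheaf `𝒪(d)` on `Proj 𝒜`: its sections over `U` are the functions that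
assign to every `x ∈ U` an element of `A_x` and are locally of the form `r / s` with `r`, `s`
homogeneous and `deg r = deg s + d`. -/
def twist (d : ℤ) : (Proj 𝒜).Modules where
  val := PresheafOfModules.ofPresheaf (R := (Proj 𝒜).ringCatSheaf.obj) (twistedPresheaf 𝒜 d)
    (fun _ _ _ _ _ => rfl)
  isSheaf := twistedPresheaf_isSheaf 𝒜 d

end Twist

/-! ### Projective space and rational normal curves over a field -/

section ProjectiveSpace

variable (k : Type u) [Field k]

/-- The grading of `k[X₀, …, Xₙ]` by degree. -/
abbrev grading (n : ℕ) : ℕ → Submodule k (MvPolynomial (Fin (n + 1)) k) :=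
  MvPolynomial.homogeneousSubmodule (Fin (n + 1)) k

instance gradedAlgebraGrading (n : ℕ) : GradedAlgebra (grading k n) :=
  MvPolynomial.gradedAlgebra

/-- Projective space `ℙⁿ = Proj k[X₀, …, Xₙ]`. -/
abbrev PSpace (n : ℕ) : Scheme.{u} := Proj (grading k n)

/-- The structure morphism `ℙⁿ ⟶ Spec k`. -/
def PSpace.toSpec (n : ℕ) : PSpace k n ⟶ Spec (CommRingCat.of k) :=
  Proj.toSpecZero (grading k n) ≫
    Spec.map (CommRingCat.ofHom (algebraMap k (grading k n 0)))

variable {k}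

/-- The regular function `g / f` on `D₊(f) ⊆ ℙⁿ`, for forms `f`, `g` of the same degree `d`. -/
def formRatio {n d : ℕ} (f g : MvPolynomial (Fin (n + 1)) k)
    (hf : f ∈ grading k n d) (hg : g ∈ grading k n d) :
    Γ(PSpace k n, Proj.basicOpen (grading k n) f) :=
  (Proj.awayToSection (grading k n) f).hom
    (HomogeneousLocalization.mk ⟨d, ⟨g, hg⟩, ⟨f, hf⟩, Submonoid.mem_powers f⟩)

/-- The morphism `i : ℙ¹ ⟶ ℙᴺ` over `k` is an embedding of `ℙ¹` as a rational normal curve (of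
degree `N`): it is the closed immersion `(F₀ : ⋯ : F_N)` for some basis `F₀, …, F_N` of the
`N + 1`-dimensional space of binary forms of degree `N`. That is, `i` pulls back the open set
`X_l ≠ 0` to `F_l ≠ 0`, and there the function `X_m / X_l` to `F_m / F_l`. -/
structure IsRationalNormalCurve {N : ℕ} (i : PSpace k 1 ⟶ PSpace k N) : Prop where
  over_base : i ≫ PSpace.toSpec k N = PSpace.toSpec k 1
  isClosedImmersion : IsClosedImmersion i
  forms : ∃ (F : Fin (N + 1) → MvPolynomial (Fin 2) k) (hF : ∀ l, F l ∈ grading k 1 N),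
    LinearIndependent k F ∧
    ∀ l, ∃ h : Proj.basicOpen (grading k 1) (F l) =
        i ⁻¹ᵁ Proj.basicOpen (grading k N) (MvPolynomial.X l),
      ∀ m, (i.appLE (Proj.basicOpen (grading k N) (MvPolynomial.X l))
          (Proj.basicOpen (grading k 1) (F l)) h.le).hom
          (formRatio (MvPolynomial.X l) (MvPolynomial.X m)
            (MvPolynomial.isHomogeneous_X k l) (MvPolynomial.isHomogeneous_X k m)) =
        formRatio (F l) (F m) (hF l) (hF m)

end ProjectiveSpace

/-! ### Ropes -/

/-- The structure sheaf `𝒪_X` as a sheaf of modules over itself. -/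
def structureModule (X : Scheme.{u}) : X.Modules :=
  SheafOfModules.unit X.ringCatSheaf

/-- A rope on `Y` with conormal bundle `E`, everything over a field `k`: a `k`-scheme `total` with a
closed immersion `incl : Y ⟶ total` over `k` whose ideal sheaf `I` satisfies `I² = 0` and is
isomorphic to `E`. (For `Y` reduced this says that `Y` is the reduced scheme of `total`; the
multiplicity of the rope is one more than the rank of `E`.)

As `I² = 0`, the `𝒪_total`-module `I` is an `𝒪_Y`-module; an isomorphism `E ≅ I` of `𝒪_Y`-modules
is an isomorphism of `𝒪_total`-modules from the pushforward of `E` along `incl` to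
`I = ker (𝒪_total → incl_* 𝒪_Y)`. It is given here as a morphism `ι` to `𝒪_total` that on
every open set is injective with image the kernel of `𝒪_total → incl_* 𝒪_Y`. -/
structure Rope {k : Type u} [Field k] {Y : Scheme.{u}} (p : Y ⟶ Spec (CommRingCat.of k))
    (E : Y.Modules) where
  /-- the scheme -/
  total : Scheme.{u}
  /-- its structure morphism -/
  toSpec : total ⟶ Spec (CommRingCat.of k)
  /-- the inclusion of the reduced scheme -/
  incl : Y ⟶ total
  incl_toSpec : incl ≫ toSpec = p
  isClosedImmersion : IsClosedImmersion incl
  sq_zero : ∀ (U : total.Opens) (s t : Γ(total, U)),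
    (incl.app U).hom s = 0 → (incl.app U).hom t = 0 → s * t = 0
  conormal : ∃ ι : (Scheme.Modules.pushforward incl).obj E ⟶ structureModule total,
    ∀ U : total.Opens, Function.Injective (ι.app U) ∧
      ∀ s : Γ(total, U), (incl.app U).hom s = 0 ↔ ∃ t, ι.app U t = s

end RopeEmbedding

end

/-! On each standard chart of the line the coordinate lifts to the rope and the ideal sheaf has two
generators, so the rope is described by transition data on the overlap: with t the lifted
coordinate, `E' i = t ^ d i * E i` and `σ = t⁻¹ + ∑ δ i (t) * E i`, where the `δ i` are Laurent
polynomials and the `d i` are `-a`, `-b` (`Rope.nonempty_charts`).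

Extending the curve to the rope means lifting the monomials `t ^ l`, `l ≤ N`, to `t ^ l + ∑ u i l
(t) * E i` on one chart and to `σ ^ (N - l) + ∑ v i l (σ) * E' i` on the other, so that they agree
up to one unit `t ^ N * (1 + ∑ ε i * E i)`. As the ideal has square zero, it suffices to solve a
linear equation for each summand, `u l = t ^ l ε + (N - l) t ^ (l + 1) δ + t ^ (e - 1) v l (t⁻¹)`
with `e = d + N + 1` (`IsLift`, `IsLift.chart_eq`). The bound `a - 1 ≤ N` gives `0 ≤ e`, hence H¹ of
𝒪(e - 1) vanishes and solutions exist.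

The resulting morphism is a closed immersion once the conormal map is onto. Its component for one
summand is the vector of second differences `u (l + 2) - 2 t u (l + 1) + t ^ 2 u l`: `N - 1` forms
of degree `e + 1`. The two vectors must be independent at every point of the line. Changing the lift
moves a vector through a space that attains every value at every point (`exists_isLift_shift`,
`map_vecAt_shiftSpace`). Being proportional to a given nonzero vector is a condition of codimension
`N - 2 ≥ 2` on a line of dimension 1, so a general choice avoids it everywhere; this is
`exists_add_forall_notMem_span`, used twice in `exists_isLift_minorIdeal_eq_top`. Independence is
converted into surjectivity on stalks by evaluating quadrics that vanish on the curve
(`surjective_of_minorIdeal_eq_top`). An arbitrary basis of forms is reduced to the monomials by an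
invertible matrix. -/

namespace RopeEmbedding

open Polynomial

/-! ### General position for vectors of forms on the projective line. -/

section Avoidance

theorem exists_forall_not_of_subsingleton {k : Type*} [Infinite k] {ι : Type*} {s : Set ι} (hs : s.Finite)
    (bad : ι → k → Prop) (h : ∀ i ∈ s, ∀ x y, bad i x → bad i y → x = y) :
    ∃ x, ∀ i ∈ s, ¬ bad i x := by
  have hfin : (⋃ i ∈ s, {x | bad i x}).Finite :=
    hs.biUnion fun i hi => Set.Subsingleton.finite fun x hx y hy => h i hi x y hx hy
  obtain ⟨x, hx⟩ := hfin.infinite_compl.nonempty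
  exact ⟨x, fun i hi hb => hx (Set.mem_biUnion hi hb)⟩

variable {k : Type*} [Field k]

/-- Finitely many affine subspaces, given as preimages, do not cover a vector space. -/
theorem exists_forall_add_notMem [Infinite k] {ι V W : Type*} [AddCommGroup V] [Module k V]
    [AddCommGroup W] [Module k W] {s : Set ι} (hs : s.Finite) (L : ι → V →ₗ[k] W) (x : ι → W)
    (S : ι → Submodule k W) (h : ∀ i ∈ s, ∃ v, x i + L i v ∉ S i) :
    ∃ v, ∀ i ∈ s, x i + L i v ∉ S i := by
  induction s, hs using Set.Finite.induction_on with
  | empty => exact ⟨0, by simp⟩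
  | @insert j s _ hs ih =>
    obtain ⟨v, hv⟩ := ih fun i hi => h i (Set.mem_insert_of_mem _ hi)
    obtain ⟨v', hv'⟩ := h j (Set.mem_insert _ _)
    -- On the line joining `v` (at 0) to `v'` (at 1), each affine subspace is met at most once: one
    -- met twice contains the line, hence both `v` and `v'`, but it misses one of them.
    obtain ⟨c, hc⟩ := exists_forall_not_of_subsingleton (hs.insert j)
      (fun i (c : k) => x i + L i (v + c • (v' - v)) ∈ S i) (by
        intro i hi c c' hc hc'
        by_contra hne
        have hd : L i (v' - v) ∈ S i := by
          have h1 := (S i).sub_mem hc hc'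
          have h2 : x i + L i (v + c • (v' - v)) - (x i + L i (v + c' • (v' - v))) =
              (c - c') • L i (v' - v) := by
            simp only [map_add, map_smul, sub_smul]; abel
          rw [h2] at h1
          exact ((S i).smul_mem_iff (sub_ne_zero.mpr hne)).mp h1
        have h0 : x i + L i v ∈ S i := by
          have h1 := (S i).sub_mem hc ((S i).smul_mem c hd)
          simpa only [map_add, map_smul, ← add_assoc, add_sub_cancel_right] using h1
        rcases Set.mem_insert_iff.mp hi with rfl | hi
        · refine hv' ?_
          have h1 := (S i).add_mem h0 hd
          simpa only [map_sub, add_assoc, add_sub_cancel] using h1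
        · exact hv i hi h0)
    exact ⟨_, hc⟩

/-- The value of a polynomial of degree at most `m` at a point of the projective line, where `none`
is the point at infinity. -/
noncomputable def evalAt (m : ℕ) : Option k → k[X] →ₗ[k] k
  | none => lcoeff k m
  | some q => leval q

/-- The value of a vector of polynomials at a point of the projective line. -/
noncomputable def vecAt (n m : ℕ) (P : Option k) : (Fin n → k[X]) →ₗ[k] (Fin n → k) :=
  (evalAt m P).compLeft (Fin n)

@[simp]
theorem vecAt_apply (n m : ℕ) (P : Option k) (w : Fin n → k[X]) (l : Fin n) :
    vecAt n m P w l = evalAt m P (w l) := rfl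

/-- Linear independence of vectors of polynomials at one point implies linear independence at all
but finitely many points. -/
theorem exists_finite_linearIndependent {r n m : ℕ} (z : Fin r → Fin n → k[X]) (q₀ : k)
    (h : LinearIndependent k fun i => vecAt n m (some q₀) (z i)) :
    ∃ F : Set k, F.Finite ∧ ∀ q ∉ F, LinearIndependent k fun i => vecAt n m (some q) (z i) := by
  obtain ⟨g, hg⟩ := LinearMap.exists_leftInverse_of_injective
    (Fintype.linearCombination k fun i => vecAt n m (some q₀) (z i))
    (LinearMap.ker_eq_bot.mpr (linearIndependent_iff_injective_fintypeLinearCombination.mp h))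
  -- `B` is the identity at `q₀`, so its determinant is a nonzero polynomial, and independence can
  -- fail only at its roots.
  let B : Matrix (Fin r) (Fin r) k[X] := Matrix.of fun i j =>
    ∑ l, z i l * C (g (Pi.single l 1) j)
  have hB : ∀ q, B.map (eval q) = Matrix.of fun i j => g (vecAt n m (some q) (z i)) j := by
    intro q
    ext i j
    have : vecAt n m (some q) (z i) = ∑ l, eval q (z i l) • Pi.single l (1 : k) := by
      ext l
      simp [evalAt, Pi.single_apply, Finset.sum_apply]
    rw [Matrix.of_apply, this]
    simp [B, eval_finsetSum]
  have hdet : ∀ q, eval q B.det = (B.map (eval q)).det := fun q =>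
    (evalRingHom q).map_det B
  have h0 : B.det ≠ 0 := by
    intro h0
    have h1 := hdet q₀
    have h2 : B.map (eval q₀) = 1 := by
      rw [hB]
      ext i j
      have := congrArg (fun f => f (Pi.single i 1) j) hg
      simpa [Matrix.one_apply, Pi.single_apply, eq_comm] using this
    rw [h0, h2] at h1
    simp at h1
  refine ⟨{q | B.det.IsRoot q}, finite_setOfPred_isRoot h0, fun q hq => ?_⟩
  have h1 : (Matrix.of fun i j => g (vecAt n m (some q) (z i)) j).det ≠ 0 := by
    rw [← hB, ← hdet]; exact hq
  have h2 : LinearIndependent k fun i => g (vecAt n m (some q) (z i)) :=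
    Matrix.linearIndependent_rows_of_det_ne_zero h1
  exact LinearIndependent.of_comp g h2

theorem exists_notMem_of_finrank_lt {n r : ℕ} (v : Fin r → Fin n → k) (h : r < n) :
    ∃ x, x ∉ Submodule.span k (Set.range v) := by
  by_contra! hx
  have h1 : Submodule.span k (Set.range v) = ⊤ := by ext x; simp [hx x]
  have h2 := finrank_range_le_card (R := k) v
  rw [Set.finrank, h1, finrank_top, Module.finrank_fin_fun, Fintype.card_fin] at h2
  omega

/-- In a space `𝓦` of vectors of forms of degree `m` on the projective line that generates the
trivial bundle of rank `n ≥ 3` twisted by `m` at every point, every translate has an element that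
is nowhere proportional to a given nowhere vanishing vector `c` of forms. -/
theorem exists_add_forall_notMem_span [Infinite k] {n m r : ℕ} (hn : 3 ≤ n)
    (𝓦 : Submodule k (Fin n → k[X])) (h𝓦 : ∀ P, 𝓦.map (vecAt n m P) = ⊤)
    (c : Fin n → k[X]) (hc : ∀ P, vecAt n r P c ≠ 0) (w₀ : Fin n → k[X]) :
    ∃ w ∈ 𝓦, ∀ P, vecAt n m P (w₀ + w) ∉ Submodule.span k {vecAt n r P c} := by
  have hsurj : ∀ P x, ∃ w ∈ 𝓦, vecAt n m P w = x := fun P x => by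
    have : x ∈ 𝓦.map (vecAt n m P) := h𝓦 P ▸ Submodule.mem_top
    simpa using this
  obtain ⟨x, hx⟩ := exists_notMem_of_finrank_lt ![vecAt n r (some 0) c] (by omega : 1 < n)
  -- The solution will be `w₁ + b • d`. The direction `d` is independent of `c` at 0, hence at all
  -- finite points outside a finite set `F₁`.
  obtain ⟨d, hd, rfl⟩ := hsurj (some 0) x
  have hsome : ∀ q (w : Fin n → k[X]), vecAt n m (some q) w = vecAt n r (some q) w :=
    fun _ _ => rfl
  have hli : ∀ P (y : Fin n → k), y ∉ Submodule.span k {vecAt n r P c} ↔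
      LinearIndependent k ![y, vecAt n r P c] := by
    intro P y
    rw [linearIndependent_fin2, Submodule.mem_span_singleton]
    simpa using fun _ => hc P
  have hx' : vecAt n m (some 0) d ∉ Submodule.span k {vecAt n r (some 0) c} := by
    simpa using hx
  obtain ⟨F₁, hF₁, hF₁'⟩ := exists_finite_linearIndependent (m := m) ![d, c] 0 (by
    convert! (hli _ _).mp hx' using 2 with i
    fin_cases i <;> rfl)
  classical
  -- At 0 more is asked, namely to avoid the plane of `d` and `c`, which is proper because `3 ≤ n`.
  -- This makes `w₀ + w₁`, `d`, `c` independent at 0.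
  let S : Option k → Submodule k (Fin n → k) := fun P => if P = some 0 then
    Submodule.span k (Set.range ![vecAt n m P d, vecAt n r P c]) else
    Submodule.span k {vecAt n r P c}
  have hSle : ∀ P, Submodule.span k {vecAt n r P c} ≤ S P := by
    intro P
    by_cases hP : P = some 0
    · simp only [S, if_pos hP]
      exact Submodule.span_mono (by simp)
    · simp only [S, if_neg hP, le_refl]
  have hfin₁ : (insert (some 0) (insert none (some '' F₁)) : Set (Option k)).Finite :=
    ((hF₁.image _).insert _).insert _
  obtain ⟨⟨w₁, hw₁⟩, hw₁'⟩ := exists_forall_add_notMem hfin₁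
    (fun P => (vecAt n m P).comp 𝓦.subtype) (fun P => vecAt n m P w₀) S (by
      intro P _
      have : ∃ y, y ∉ S P := by
        by_cases hP : P = some 0
        · simp only [S, if_pos hP]
          exact exists_notMem_of_finrank_lt _ (by omega)
        · simp only [S, if_neg hP]
          have := exists_notMem_of_finrank_lt ![vecAt n r P c] (by omega : 1 < n)
          simpa using this
      obtain ⟨y, hy⟩ := this
      obtain ⟨w, hw, hwy⟩ := hsurj P (y - vecAt n m P w₀)
      exact ⟨⟨w, hw⟩, by simpa [hwy] using hy⟩)
  -- At finite points outside `F₂` the three vectors are independent, so every `b` works there. Only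
  -- `F₂` and infinity constrain `b`.
  obtain ⟨F₂, hF₂, hF₂'⟩ := exists_finite_linearIndependent (m := m) ![w₀ + w₁, d, c] 0 (by
    have h1 := hw₁' (some 0) (by simp)
    have h2 : LinearIndependent k (Fin.cons (vecAt n m (some 0) (w₀ + w₁))
        ![vecAt n m (some 0) d, vecAt n r (some 0) c] : Fin 3 → Fin n → k) := by
      rw [linearIndependent_finCons]
      exact ⟨(hli _ _).mp hx', by simpa [S] using h1⟩
    convert! h2 using 2 with i
    fin_cases i <;> rfl)
  have hfin₂ : (insert none (some '' F₂) : Set (Option k)).Finite := (hF₂.image _).insert _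
  -- If two values of `b` failed at `P`, both `d` and `w₀ + w₁` would be multiples of `c` there. The
  -- first puts `P` in `F₁` or at infinity, where `w₁` was chosen to exclude the second.
  obtain ⟨b, hb⟩ := exists_forall_not_of_subsingleton hfin₂
    (fun P (b : k) => vecAt n m P (w₀ + w₁ + b • d) ∈ Submodule.span k {vecAt n r P c}) (by
      intro P _ b b' hb hb'
      by_contra hne
      simp only [map_add, map_smul] at hb hb'
      have hd' : vecAt n m P d ∈ Submodule.span k {vecAt n r P c} := by
        have h1 := Submodule.sub_mem _ hb hb'
        rw [add_sub_add_left_eq_sub, ← sub_smul] at h1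
        exact (Submodule.smul_mem_iff _ (sub_ne_zero.mpr hne)).mp h1
      have hw' := Submodule.sub_mem _ hb (Submodule.smul_mem _ b hd')
      rw [add_sub_cancel_right] at hw'
      have hP : P ∈ insert none (some '' F₁) := by
        by_contra hP
        cases P with
        | none => simp at hP
        | some q =>
          have h1 := hF₁' q (by simpa using hP)
          refine (hli (some q) (vecAt n m (some q) d)).mpr ?_ hd'
          convert! h1 using 2 with i
          fin_cases i <;> rfl
      exact hw₁' P (Set.mem_insert_of_mem _ hP) (hSle P hw'))
  refine ⟨w₁ + b • d, 𝓦.add_mem hw₁ (𝓦.smul_mem _ hd), fun P hP => ?_⟩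
  rw [← add_assoc] at hP
  by_cases hPF : P ∈ insert none (some '' F₂)
  · exact hb P hPF hP
  · cases P with
    | none => simp at hPF
    | some q =>
      have h1 := hF₂' q (by simpa using hPF)
      have h2 : LinearIndependent k (Fin.cons (vecAt n m (some q) (w₀ + w₁))
          ![vecAt n m (some q) d, vecAt n r (some q) c] : Fin 3 → Fin n → k) := by
        convert! h1 using 2 with i
        fin_cases i <;> rfl
      rw [linearIndependent_finCons] at h2
      refine h2.2 ?_
      rw [map_add, map_smul] at hP
      have h3 := Submodule.span_mono (R := k) (t := Set.range
        ![vecAt n m (some q) d, vecAt n r (some q) c]) (by simp) hP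
      have h4 : vecAt n m (some q) d ∈ Submodule.span k (Set.range
          ![vecAt n m (some q) d, vecAt n r (some q) c]) := Submodule.subset_span (by simp)
      simpa using Submodule.sub_mem _ h3 (Submodule.smul_mem _ b h4)

end Avoidance

end RopeEmbedding

namespace RopeEmbedding

open Polynomial

/-! ### Lifting the monomials: Laurent polynomial equations and second differences. -/

section Coefficients

open scoped LaurentPolynomial
open LaurentPolynomial (T invert)

variable {k : Type*} [Field k]

/-- This is the vanishing of H¹ of 𝒪(M) on the line for `M ≥ -1`: a monomial `T n` belongs to the
first part if `0 ≤ n`, and otherwise `n ≤ M` and it belongs to the second. -/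
theorem exists_toLaurent_add (M : ℤ) (hM : -1 ≤ M) (z : k[T;T⁻¹]) :
    ∃ f g : k[X], z = toLaurent f + T M * invert (toLaurent g) := by
  induction z using LaurentPolynomial.induction_on' with
  | add p q hp hq =>
    obtain ⟨f, g, rfl⟩ := hp
    obtain ⟨f', g', rfl⟩ := hq
    exact ⟨f + f', g + g', by simp only [map_add]; ring⟩
  | C_mul_T n c =>
    rcases le_or_gt 0 n with hn | hn
    · refine ⟨C c * X ^ n.toNat, 0, ?_⟩
      rw [toLaurent_C_mul_X_pow, Int.toNat_of_nonneg hn]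
      simp
    · refine ⟨0, C c * X ^ (M - n).toNat, ?_⟩
      rw [toLaurent_C_mul_X_pow, Int.toNat_of_nonneg (by omega), map_mul,
        LaurentPolynomial.invert_C, LaurentPolynomial.invert_T, mul_left_comm,
        ← LaurentPolynomial.T_add]
      simp

/-- The witness reverses the coefficients: it is the same form of degree `e` written on the other
chart. -/
theorem exists_T_mul_invert (e : ℕ) (p : k[X]) (hp : p.natDegree ≤ e) :
    ∃ p' : k[X], T (e : ℤ) * invert (toLaurent p') = toLaurent p := by
  refine ⟨∑ i ∈ Finset.range (e + 1), C (p.coeff i) * X ^ (e - i), ?_⟩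
  conv_rhs => rw [p.as_sum_range_C_mul_X_pow' (Nat.lt_succ_of_le hp)]
  simp only [map_sum, Finset.mul_sum, toLaurent_C_mul_X_pow]
  refine Finset.sum_congr rfl fun i hi => ?_
  rw [map_mul, LaurentPolynomial.invert_C, LaurentPolynomial.invert_T, mul_left_comm,
    ← LaurentPolynomial.T_add]
  congr 2
  have := Finset.mem_range.mp hi
  omega

/-- The second difference operator that annihilates `l ↦ X ^ l` and `l ↦ l * X ^ l`. -/
noncomputable def secondDiff (f : ℕ → k[X]) (l : ℕ) : k[X] :=
  f (l + 2) - 2 * X * f (l + 1) + X ^ 2 * f l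

/-- The vectors `(p (l + 2) - X * p (l + 1))ₗ`. -/
noncomputable def shiftMap (k : Type*) [Field k] (n : ℕ) : (ℕ → k[X]) →ₗ[k] (Fin n → k[X]) where
  toFun p l := p (l + 2) - X * p (l + 1)
  map_add' p q := by ext1 l; simp only [Pi.add_apply]; ring
  map_smul' c p := by
    ext1 l
    simp only [Pi.smul_apply, RingHom.id_apply, smul_sub, mul_smul_comm]

/-- The vectors `(p (l + 2) - X * p (l + 1))ₗ` with all `p l` of degree at most `e`. -/
noncomputable def shiftSpace (k : Type*) [Field k] (n e : ℕ) : Submodule k (Fin n → k[X]) :=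
  (Submodule.pi Set.univ fun _ => degreeLE k e).map (shiftMap k n)

/-- At a finite point, constants `p j` already suffice: prescribing the values is a recursion for
`p`. At infinity the coefficient of `X ^ (e + 1)` is minus the top coefficient of `p (l + 1)`, which
is free. -/
theorem map_vecAt_shiftSpace (n e : ℕ) (P : Option k) :
    (shiftSpace k n e).map (vecAt n (e + 1) P) = ⊤ := by
  rw [eq_top_iff]
  rintro x -
  have hC : ∀ c : k, (C c).degree ≤ (e : WithBot ℕ) := fun c =>
    degree_C_le.trans (by exact_mod_cast Nat.zero_le e)
  cases P with
  | none =>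
    refine ⟨_, ⟨fun j => C (if h : j - 1 < n then - x ⟨j - 1, h⟩ else 0) * X ^ e, ?_, rfl⟩, ?_⟩
    · simp only [SetLike.mem_coe, Submodule.mem_pi, mem_degreeLE]
      exact fun _ _ => degree_C_mul_X_pow_le _ _
    · ext l
      have h1 : ∀ c : k, (C c * X ^ e).coeff (e + 1) = 0 := fun c => by
        rw [coeff_C_mul_X_pow, if_neg (by omega)]
      simp only [vecAt_apply, evalAt, shiftMap, LinearMap.coe_mk, AddHom.coe_mk, lcoeff_apply,
        coeff_sub, coeff_X_mul, h1]
      simp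
  | some q =>
    -- The shift by one makes the step to `a (l + 2)` use `x l`; the value of `a 1` plays no role.
    let a : ℕ → k := Nat.rec 0 fun j a => q * a + if h : j - 1 < n then x ⟨j - 1, h⟩ else 0
    refine ⟨_, ⟨fun j => C (a j), ?_, rfl⟩, ?_⟩
    · simp only [SetLike.mem_coe, Submodule.mem_pi, mem_degreeLE]
      exact fun _ _ => hC _
    · ext l
      have : a (l + 2) = q * a (l + 1) + x l := by
        change q * a (l + 1) + (if h : _ then _ else _) = _
        simp
      simp only [vecAt_apply, evalAt, shiftMap, leval, LinearMap.coe_mk, AddHom.coe_mk, eval_sub,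
        eval_mul, eval_X, eval_C, this]
      ring

variable (N e : ℕ) (δ : k[T;T⁻¹])

/-- The condition that `u` and `v` are the coefficients on two charts of liftings of the
`N + 1` monomials to a thickened line. -/
def IsLift (ε : k[T;T⁻¹]) (u v : ℕ → k[X]) : Prop :=
  ∀ l ≤ N, toLaurent (u l) = T (l : ℤ) * ε + LaurentPolynomial.C ((N : k) - l) * T (l + 1 : ℤ) * δ +
    T (e - 1 : ℤ) * invert (toLaurent (v l))

/-- The `δ` term splits between the two charts because `e - 1 ≥ -1`. -/
theorem exists_isLift_zero : ∃ u v : ℕ → k[X], IsLift N e δ 0 u v := by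
  have h := fun l : ℕ => exists_toLaurent_add (e - 1 : ℤ) (by omega)
    (LaurentPolynomial.C ((N : k) - l) * T (l + 1 : ℤ) * δ)
  choose f g h using h
  refine ⟨f, fun l => - g l, fun l _ => ?_⟩
  simp only [map_neg]
  rw [h l]
  ring

/-- Take `ε = ∑ T (-j) p j` over `0 < j ≤ N`. In `T l * ε` the terms with `j ≤ l` form a polynomial
`S l`, and those with `j > l` are `T (e - 1)` times polynomials in `T⁻¹`, as `p j` has degree at
most `e`. From `S (l + 1) = X * S l + p (l + 1)` the second differences can be read off. -/
theorem exists_isLift_shift (p : ℕ → k[X]) (hp : ∀ j, (p j).natDegree ≤ e) :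
    ∃ (ε : k[T;T⁻¹]) (u v : ℕ → k[X]), IsLift N e 0 ε u v ∧
      ∀ l, secondDiff u l = p (l + 2) - X * p (l + 1) := by
  choose p' hp' using fun j => exists_T_mul_invert e (p j) (hp j)
  let S : ℕ → k[X] := Nat.rec 0 fun l s => X * s + p (l + 1)
  have hS : ∀ l, S (l + 1) = X * S l + p (l + 1) := fun _ => rfl
  have hSsum : ∀ l, toLaurent (S l) =
      ∑ j ∈ Finset.Ioc 0 l, T (l - j : ℤ) * toLaurent (p j) := by
    intro l
    induction l with
    | zero => simp [S]
    | succ l ih =>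
      rw [hS, map_add, map_mul, ih, Finset.sum_Ioc_succ_top (Nat.zero_le _), Finset.mul_sum]
      congr 1
      · refine Finset.sum_congr rfl fun j _ => ?_
        rw [toLaurent_X, ← mul_assoc, ← LaurentPolynomial.T_add]
        congr 2
        push_cast; ring
      · simp
  refine ⟨∑ j ∈ Finset.Ioc 0 N, T (-j : ℤ) * toLaurent (p j), S,
    fun l => - ∑ j ∈ Finset.Ioc l N, X ^ (j - l - 1) * p' j, fun l hl => ?_, fun l => ?_⟩
  · have h1 : T (e - 1 : ℤ) * invert (toLaurent
        (∑ j ∈ Finset.Ioc l N, X ^ (j - l - 1) * p' j)) =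
        ∑ j ∈ Finset.Ioc l N, T (l - j : ℤ) * toLaurent (p j) := by
      rw [map_sum, map_sum, Finset.mul_sum]
      refine Finset.sum_congr rfl fun j hj => ?_
      rw [← hp' j, map_mul, map_mul, toLaurent_X_pow, LaurentPolynomial.invert_T, ← mul_assoc,
        ← mul_assoc, ← LaurentPolynomial.T_add, ← LaurentPolynomial.T_add]
      congr 2
      have := Finset.mem_Ioc.mp hj
      omega
    have h2 : T (l : ℤ) * ∑ j ∈ Finset.Ioc 0 N, T (-j : ℤ) * toLaurent (p j) =
        ∑ j ∈ Finset.Ioc 0 N, T (l - j : ℤ) * toLaurent (p j) := by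
      rw [Finset.mul_sum]
      refine Finset.sum_congr rfl fun j _ => ?_
      rw [← mul_assoc, ← LaurentPolynomial.T_add]
      rfl
    rw [map_neg, map_neg, mul_neg, h1, h2, hSsum, mul_zero, add_zero,
      ← Finset.sum_Ioc_consecutive _ (Nat.zero_le l) hl]
    ring
  · rw [secondDiff, hS (l + 1), hS]
    ring

variable {N e δ}

theorem IsLift.add {δ' ε ε' : k[T;T⁻¹]} {u v u' v' : ℕ → k[X]} (h : IsLift N e δ ε u v)
    (h' : IsLift N e δ' ε' u' v') : IsLift N e (δ + δ') (ε + ε') (u + u') (v + v') := by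
  intro l hl
  simp only [Pi.add_apply, map_add, h l hl, h' l hl]
  ring

/-- On the second chart the second differences are the reversed polynomials. -/
theorem IsLift.secondDiff {ε : k[T;T⁻¹]} {u v : ℕ → k[X]} (h : IsLift N e δ ε u v) {l : ℕ}
    (hl : l + 2 ≤ N) :
    toLaurent (secondDiff u l) = T ((e + 1 : ℕ) : ℤ) *
      invert (toLaurent (v l - 2 * X * v (l + 1) + X ^ 2 * v (l + 2))) := by
  have e1 : ∀ n : ℤ, T (R := k) (n + 1) = T n * T 1 := fun n => LaurentPolynomial.T_add n 1
  have e2 : ((l + 2 : ℕ) : ℤ) = (l : ℤ) + 1 + 1 := by push_cast; ring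
  have e3 : ((l + 1 : ℕ) : ℤ) = (l : ℤ) + 1 := by push_cast; ring
  have e4 : ((e + 1 : ℕ) : ℤ) = (e - 1 : ℤ) + 1 + 1 := by push_cast; ring
  have e5 : T (R := k) 1 * T (-1) = 1 := by rw [← LaurentPolynomial.T_add]; simp
  have h0 := h l (by omega)
  have h1 := h (l + 1) (by omega)
  have h2 := h (l + 2) hl
  simp only [e2, e3, e1, Nat.cast_add, Nat.cast_ofNat, Nat.cast_one, map_sub, map_add,
    map_one, map_ofNat] at h0 h1 h2
  simp only [RopeEmbedding.secondDiff, e4, e1, map_sub, map_add, map_mul, map_pow, map_ofNat,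
    toLaurent_X, LaurentPolynomial.invert_T, h0, h1, h2]
  set t := T (R := k) 1
  set s := T (R := k) (-1)
  set a := T (R := k) (e - 1 : ℤ)
  linear_combination (2 * a * t * invert (toLaurent (v (l + 1))) -
    a * invert (toLaurent (v (l + 2))) * (t * s + 1)) * e5

/-- `w` and `w'` are one form of degree `m` on the two charts. This carries independence from the
first chart, including infinity, to the second. -/
theorem evalAt_none_eq {m : ℕ} {w w' : k[X]}
    (h : toLaurent w = T (m : ℤ) * invert (toLaurent w')) :
    evalAt m none w = w'.eval 0 ∧
      ∀ q : k, q ≠ 0 → w'.eval q = q ^ m * evalAt m (some q⁻¹) w := by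
  have h' : toLaurent w' = T (m : ℤ) * invert (toLaurent w) := by
    rw [h, map_mul, LaurentPolynomial.invert_T, ← mul_assoc, ← LaurentPolynomial.T_add,
      add_neg_cancel, LaurentPolynomial.T_zero, one_mul]
    exact (LaurentPolynomial.involutive_invert _).symm
  constructor
  · have h1 := congrArg (fun z : k[T;T⁻¹] => z.coeff m) h
    have h2 : ∀ f : k[X], (T (m : ℤ) * invert (toLaurent f)).coeff m = f.eval 0 := by
      intro f
      induction f using Polynomial.induction_on' with
      | add f g hf hg =>
        rw [map_add, map_add, mul_add, eval_add, ← hf, ← hg]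
        rfl
      | monomial n c =>
        rw [← C_mul_X_pow_eq_monomial, toLaurent_C_mul_X_pow, map_mul,
          LaurentPolynomial.invert_C, LaurentPolynomial.invert_T, mul_left_comm,
          ← LaurentPolynomial.T_add, ← LaurentPolynomial.single_eq_C_mul_T]
        rw [AddMonoidAlgebra.coeff_single, Finsupp.single_apply]
        rcases eq_or_ne n 0 with rfl | hn
        · simp
        · rw [if_neg (by omega)]
          simp [hn]
    have h3 : (toLaurent w).coeff m = w.coeff m := by
      rw [LaurentPolynomial.coeff_toLaurent]
      exact Finsupp.mapDomain_apply Nat.castEmbedding.injective _ _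
    simp only [h2, h3] at h1
    exact h1
  · intro q hq
    have h1 := congrArg (LaurentPolynomial.eval₂ (RingHom.id k) (Units.mk0 q hq)) h'
    have h2 : ∀ f : k[X], LaurentPolynomial.eval₂ (RingHom.id k) (Units.mk0 q hq)
        (invert (toLaurent f)) = eval q⁻¹ f := by
      intro f
      induction f using Polynomial.induction_on' with
      | add f g hf hg => simp [hf, hg]
      | monomial n c => 
        rw [← C_mul_X_pow_eq_monomial, toLaurent_C_mul_X_pow, map_mul,
          LaurentPolynomial.invert_C, LaurentPolynomial.invert_T]
        simp
    rw [LaurentPolynomial.eval₂_toLaurent, map_mul, h2] at h1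
    simpa [evalAt, leval, ← eval₂_eq_eval_map] using h1

/-- The ideal generated by the `2 × 2` minors of the second differences of two sequences. -/
noncomputable def minorIdeal (N : ℕ) (f : Fin 2 → ℕ → k[X]) : Ideal k[X] :=
  Ideal.span {g | ∃ l m, l + 2 ≤ N ∧ m + 2 ≤ N ∧
    g = secondDiff (f 0) l * secondDiff (f 1) m - secondDiff (f 0) m * secondDiff (f 1) l}

/-- The ideal is principal, and its generator has no root, hence is a constant. -/
theorem minorIdeal_eq_top [IsAlgClosed k] (N : ℕ) (f : Fin 2 → ℕ → k[X])
    (h : ∀ q, ∃ l m, l + 2 ≤ N ∧ m + 2 ≤ N ∧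
      eval q (secondDiff (f 0) l) * eval q (secondDiff (f 1) m) ≠
        eval q (secondDiff (f 0) m) * eval q (secondDiff (f 1) l)) : minorIdeal N f = ⊤ := by
  obtain ⟨g, hg⟩ : ∃ g, minorIdeal N f = Ideal.span {g} :=
    (IsPrincipalIdealRing.principal (minorIdeal N f)).principal
  have hroot : ∀ q, eval q g ≠ 0 := by
    intro q hq
    obtain ⟨l, m, hl, hm, hne⟩ := h q
    have h1 : secondDiff (f 0) l * secondDiff (f 1) m - secondDiff (f 0) m * secondDiff (f 1) l ∈
        Ideal.span {g} := hg ▸ Ideal.subset_span ⟨l, m, hl, hm, rfl⟩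
    obtain ⟨r, hr⟩ := Ideal.mem_span_singleton.mp h1
    have h2 := congrArg (eval q) hr
    rw [eval_mul, hq, zero_mul, eval_sub, eval_mul, eval_mul, sub_eq_zero] at h2
    exact hne h2
  rw [hg, Ideal.span_singleton_eq_top, isUnit_iff_degree_eq_zero]
  by_contra hdeg
  obtain ⟨q, hq⟩ := IsAlgClosed.exists_root g hdeg
  exact hroot q hq

theorem exists_minor_ne_zero {n : ℕ} {x y : Fin n → k} (hy : y ≠ 0)
    (hx : x ∉ Submodule.span k {y}) : ∃ l m, y l * x m ≠ y m * x l := by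
  by_contra! h
  obtain ⟨m, hm⟩ := Function.ne_iff.mp hy
  refine hx (Submodule.mem_span_singleton.mpr ⟨x m / y m, ?_⟩)
  ext l
  have hm' : y m ≠ 0 := hm
  have := h l m
  simp only [Pi.smul_apply, smul_eq_mul]
  field_simp
  linear_combination this

/-- Liftings of the monomials of degree `N` on the two charts of the line, for two summands of the
conormal bundle, such that the conormal map is surjective. -/
theorem exists_isLift_minorIdeal_eq_top [IsAlgClosed k] (N : ℕ) (hN : 4 ≤ N) (e : Fin 2 → ℕ)
    (δ : Fin 2 → k[T;T⁻¹]) :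
    ∃ (ε : Fin 2 → k[T;T⁻¹]) (u v : Fin 2 → ℕ → k[X]),
      (∀ i, IsLift N (e i) (δ i) (ε i) (u i) (v i)) ∧
      minorIdeal N u = ⊤ ∧ minorIdeal N (fun i l => v i (N - l)) = ⊤ := by
  have : Infinite k := IsAlgClosed.instInfinite
  -- A particular lift plus the solutions with `δ = 0`: the attainable vectors of second differences
  -- contain a translate of `shiftSpace`.
  have key : ∀ i, ∃ w₀ : Fin (N - 1) → k[X], ∀ w ∈ shiftSpace k (N - 1) (e i),
      ∃ ε u v, IsLift N (e i) (δ i) ε u v ∧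
        ∀ l : Fin (N - 1), secondDiff u l = (w₀ + w) l := by
    intro i
    obtain ⟨u, v, huv⟩ := exists_isLift_zero N (e i) (δ i)
    refine ⟨fun l => secondDiff u l, ?_⟩
    rintro _ ⟨p, hp, rfl⟩
    have hp' : ∀ j, (p j).natDegree ≤ e i := fun j =>
      natDegree_le_iff_degree_le.mpr (mem_degreeLE.mp (hp j trivial))
    obtain ⟨ε, u', v', huv', h⟩ := exists_isLift_shift N (e i) p hp'
    refine ⟨0 + ε, u + u', v + v', by simpa using huv.add huv', fun l => ?_⟩
    have h1 : secondDiff (u + u') l = secondDiff u l + secondDiff u' l := by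
      simp only [secondDiff, Pi.add_apply]; ring
    rw [h1, h]
    rfl
  choose w₀ hw₀ using key
  -- For the first summand only nonvanishing matters; avoiding the multiples of the constant vector
  -- 1 ensures it. The result then serves as the vector to avoid for the second summand.
  obtain ⟨w₁, hw₁, hw₁'⟩ := exists_add_forall_notMem_span (r := 0) (by omega : 3 ≤ N - 1)
    (shiftSpace k (N - 1) (e 0)) (map_vecAt_shiftSpace _ _) (fun _ => 1) (by
      intro P h
      have := congrFun h ⟨0, by omega⟩
      cases P <;> simp [evalAt, leval] at this) (w₀ 0)
  have hne : ∀ P, vecAt (N - 1) (e 0 + 1) P (w₀ 0 + w₁) ≠ 0 := fun P h =>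
    hw₁' P (h ▸ Submodule.zero_mem _)
  obtain ⟨w₂, hw₂, hw₂'⟩ := exists_add_forall_notMem_span (by omega : 3 ≤ N - 1)
    (shiftSpace k (N - 1) (e 1)) (map_vecAt_shiftSpace _ _) (w₀ 0 + w₁) hne (w₀ 1)
  obtain ⟨ε₁, u₁, v₁, h₁, hu₁⟩ := hw₀ 0 w₁ hw₁
  obtain ⟨ε₂, u₂, v₂, h₂, hu₂⟩ := hw₀ 1 w₂ hw₂
  have hmin : ∀ P, ∃ l m : Fin (N - 1),
      evalAt (e 0 + 1) P (secondDiff u₁ l) * evalAt (e 1 + 1) P (secondDiff u₂ m) ≠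
        evalAt (e 0 + 1) P (secondDiff u₁ m) * evalAt (e 1 + 1) P (secondDiff u₂ l) := by
    intro P
    obtain ⟨l, m, h⟩ := exists_minor_ne_zero (hne P) (hw₂' P)
    simp only [vecAt_apply, ← hu₁, ← hu₂] at h
    exact ⟨l, m, h⟩
  refine ⟨![ε₁, ε₂], ![u₁, u₂], ![v₁, v₂], by simp [Fin.forall_fin_two, h₁, h₂],
    minorIdeal_eq_top _ _ fun q => ?_, minorIdeal_eq_top _ _ fun q => ?_⟩
  · obtain ⟨l, m, h⟩ := hmin (some q)
    exact ⟨l, m, by omega, by omega, h⟩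
  · have hrev : ∀ (v : ℕ → k[X]) (l : ℕ), l + 2 ≤ N → secondDiff (fun l => v (N - l)) (N - 2 - l) =
        v l - 2 * X * v (l + 1) + X ^ 2 * v (l + 2) := by
      intro v l hl
      simp only [secondDiff, (by omega : N - (N - 2 - l + 2) = l),
        (by omega : N - (N - 2 - l + 1) = l + 1), (by omega : N - (N - 2 - l) = l + 2)]
    -- The point with coordinate `q` on the second chart is `q⁻¹`, or infinity, on the first. The
    -- values there differ by nonzero factors that depend only on the summand, so a nonzero minor
    -- stays nonzero. The second chart lists the monomials backwards, whence the index `N - 2 - l`.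
    have hval : ∃ (P : Option k) (μ₁ μ₂ : k), μ₁ ≠ 0 ∧ μ₂ ≠ 0 ∧ ∀ l, l + 2 ≤ N →
        eval q (secondDiff (fun l => v₁ (N - l)) (N - 2 - l)) =
          μ₁ * evalAt (e 0 + 1) P (secondDiff u₁ l) ∧
        eval q (secondDiff (fun l => v₂ (N - l)) (N - 2 - l)) =
          μ₂ * evalAt (e 1 + 1) P (secondDiff u₂ l) := by
      rcases eq_or_ne q 0 with rfl | hq
      · refine ⟨none, 1, 1, one_ne_zero, one_ne_zero, fun l hl => ?_⟩
        rw [hrev v₁ l hl, hrev v₂ l hl, one_mul, one_mul]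
        exact ⟨(evalAt_none_eq (h₁.secondDiff hl)).1.symm,
          (evalAt_none_eq (h₂.secondDiff hl)).1.symm⟩
      · refine ⟨some q⁻¹, q ^ (e 0 + 1), q ^ (e 1 + 1), pow_ne_zero _ hq, pow_ne_zero _ hq,
          fun l hl => ?_⟩
        rw [hrev v₁ l hl, hrev v₂ l hl]
        exact ⟨(evalAt_none_eq (h₁.secondDiff hl)).2 q hq,
          (evalAt_none_eq (h₂.secondDiff hl)).2 q hq⟩
    obtain ⟨P, μ₁, μ₂, hμ₁, hμ₂, hP⟩ := hval
    obtain ⟨l, m, h⟩ := hmin P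
    refine ⟨N - 2 - l, N - 2 - m, by omega, by omega, ?_⟩
    have hl := hP l (by omega)
    have hm := hP m (by omega)
    change eval q (secondDiff (fun l => v₁ (N - l)) _) * eval q (secondDiff (fun l => v₂ (N - l)) _)
      ≠ eval q (secondDiff (fun l => v₁ (N - l)) _) * eval q (secondDiff (fun l => v₂ (N - l)) _)
    rw [hl.1, hl.2, hm.1, hm.2]
    intro heq
    refine h (mul_left_cancel₀ (mul_ne_zero hμ₁ hμ₂) ?_)
    linear_combination heq

end Coefficients

end RopeEmbedding

namespace RopeEmbedding

open Polynomial

/-! ### Algebra of square-zero thickenings: surjectivity and agreement on the overlap. -/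

section SquareZero

open scoped LaurentPolynomial
open LaurentPolynomial (T invert)

variable {k R : Type*} [Field k] [CommRing R] (φ : k →+* R)

/-- A ring homomorphism into a square-zero thickening is surjective if its composition with the
reduction is, and if its image contains the values, up to a common factor, of a lifting of the
rational normal curve for which the minors of second differences generate the unit ideal. -/
theorem surjective_of_minorIdeal_eq_top {S T : Type*} [CommRing S] [CommRing T] (ψ : S →+* R)
    (π : R →+* T) (hπψ : Function.Surjective (π.comp ψ)) (τ : R) (e : Fin 2 → R)
    (he : ∀ r i, π r = 0 → r * e i = 0) (hπe : ∀ i, π (e i) = 0)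
    (hker : ∀ r, π r = 0 → ∃ a : Fin 2 → R, r = ∑ i, a i * e i)
    (N : ℕ) (f : Fin 2 → ℕ → k[X]) (hf : minorIdeal N f = ⊤) (y : ℕ → R)
    (hy : ∀ l ≤ N, y l = τ ^ l + ∑ i, (f i l).eval₂ φ τ * e i)
    (Λ : R) (hΛ : IsUnit Λ) (hmem : ∀ l ≤ N, Λ * y l ∈ ψ.range) : Function.Surjective ψ := by
  have hsq : ∀ r x, π r = 0 → π x = 0 → r * x = 0 := by
    intro r x hr hx
    obtain ⟨a, rfl⟩ := hker x hx
    rw [Finset.mul_sum]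
    refine Finset.sum_eq_zero fun i _ => ?_
    rw [mul_left_comm, he r i hr, mul_zero]
  have hsurj : ∀ r, ∃ s, π (ψ s) = π r := fun r => hπψ (π r)
  -- On the kernel of `π` the element `r` acts through `π r`, which lifts to the source of `ψ`. So
  -- the part of the image in the kernel is a module over all of `R`.
  have hcl : ∀ r x, π x = 0 → x ∈ ψ.range → r * x ∈ ψ.range := by
    intro r x hx hxA
    obtain ⟨s, hs⟩ := hsurj r
    have : r * x = ψ s * x := by
      rw [← sub_eq_zero, ← sub_mul]
      exact hsq _ _ (by rw [map_sub, hs, sub_self]) hx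
    rw [this]
    exact mul_mem ⟨s, rfl⟩ hxA
  let z : ℕ → R := fun m => ∑ i, (f i (m + 1) - X * f i m).eval₂ φ τ * e i
  have hzy : ∀ m, m + 1 ≤ N → y (m + 1) = τ * y m + z m := by
    intro m hm
    rw [hy m (by omega), hy (m + 1) hm]
    simp only [z, Fin.sum_univ_two, eval₂_sub, eval₂_mul, eval₂_X]
    ring
  have hπz : ∀ m, π (z m) = 0 := fun m => by simp [z, hπe]
  have hπy : ∀ m ≤ N, π (y m - τ ^ m) = 0 := fun m hm => by simp [hy m hm, hπe]
  have hq : ∀ m, m + 2 ≤ N → z (m + 1) - τ ^ (m + 1) * z 0 ∈ ψ.range := by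
    intro m hm
    -- The quadric `y 0 * y (m + 2) - y 1 * y (m + 1)` vanishes on the rational normal curve, so on
    -- the thickening its value lies in the ideal, where it is linear in the nilpotent parts `z`.
    have h1 : (Λ * y 0) * (Λ * y (m + 2)) - (Λ * y 1) * (Λ * y (m + 1)) ∈ ψ.range :=
      sub_mem (mul_mem (hmem _ (by omega)) (hmem _ hm))
        (mul_mem (hmem _ (by omega)) (hmem _ (by omega)))
    have h2 : (Λ * y 0) * (Λ * y (m + 2)) - (Λ * y 1) * (Λ * y (m + 1)) =
        Λ ^ 2 * (z (m + 1) - τ ^ (m + 1) * z 0) := by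
      have e0 := hsq _ _ (hπy 0 (by omega)) (hπz (m + 1))
      have e1 := hsq _ _ (hπy (m + 1) (by omega)) (hπz 0)
      have e2 := hzy (m + 1) (by omega)
      have e3 := hzy 0 (by omega)
      simp only [zero_add] at e3
      rw [show m + 2 = m + 1 + 1 from rfl, e2, e3]
      linear_combination Λ ^ 2 * e0 - Λ ^ 2 * e1
    rw [h2] at h1
    obtain ⟨Λ', hΛ'⟩ := hΛ.exists_left_inv
    have h3 := hcl (Λ' ^ 2) _ (by simp [hπz]) h1
    rwa [← mul_assoc, ← mul_pow, hΛ', one_pow, one_mul] at h3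
  have hω : ∀ m, m + 2 ≤ N → z (m + 1) - τ * z m ∈ ψ.range := by
    intro m hm
    cases m with
    | zero => simpa using hq 0 hm
    | succ m =>
      have h1 := sub_mem (hq (m + 1) hm) (hcl τ _ (by simp [hπz]) (hq m (by omega)))
      convert h1 using 1
      ring
  have hωe : ∀ m, z (m + 1) - τ * z m = ∑ i, (secondDiff (f i) m).eval₂ φ τ * e i := by
    intro m
    simp only [z, secondDiff, Fin.sum_univ_two, eval₂_sub, eval₂_add, eval₂_mul, eval₂_X,
      eval₂_pow, eval₂_ofNat]
    ring
  have hemem : ∀ i, e i ∈ ψ.range := by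
    intro i
    -- The polynomials whose product with `e i` lies in the image form an ideal. By Cramer's rule,
    -- eliminating the other generator from two second differences, it contains the minors, hence 1.
    let J : Ideal k[X] :=
      { carrier := {g | g.eval₂ φ τ * e i ∈ ψ.range}
        add_mem' := fun {g g'} hg hg' => by
          simp only [Set.mem_ofPred_eq, eval₂_add, add_mul] at *
          exact add_mem hg hg'
        zero_mem' := by
          rw [Set.mem_ofPred_eq, eval₂_zero, zero_mul]
          exact zero_mem _
        smul_mem' := fun c g hg => by
          simp only [Set.mem_ofPred_eq, smul_eq_mul, eval₂_mul, mul_assoc] at *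
          exact hcl _ _ (by simp [hπe]) hg }
    have hJ : minorIdeal N f ≤ J := by
      rw [minorIdeal, Ideal.span_le]
      rintro _ ⟨l, m, hl, hm, rfl⟩
      have hl' := hω l hl
      have hm' := hω m hm
      have hl0 : π (z (l + 1) - τ * z l) = 0 := by simp [hπz]
      have hm0 : π (z (m + 1) - τ * z m) = 0 := by simp [hπz]
      have h0 := sub_mem (hcl ((secondDiff (f 1) m).eval₂ φ τ) _ hl0 hl')
        (hcl ((secondDiff (f 1) l).eval₂ φ τ) _ hm0 hm')
      have h1 := sub_mem (hcl ((secondDiff (f 0) l).eval₂ φ τ) _ hm0 hm')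
        (hcl ((secondDiff (f 0) m).eval₂ φ τ) _ hl0 hl')
      rw [hωe, hωe] at h0 h1
      simp only [Fin.sum_univ_two] at h0 h1
      change eval₂ φ τ _ * e i ∈ ψ.range
      rw [eval₂_sub, eval₂_mul, eval₂_mul]
      fin_cases i
      · convert h0 using 1
        simp only [Fin.zero_eta]
        ring
      · convert h1 using 1
        simp only [Fin.mk_one]
        ring
    have h1 : (1 : k[X]) ∈ J := hJ (hf ▸ Submodule.mem_top)
    have h2 : eval₂ φ τ 1 * e i ∈ ψ.range := h1
    simpa using h2
  intro r
  obtain ⟨s, hs⟩ := hsurj r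
  obtain ⟨a, ha⟩ := hker (r - ψ s) (by rw [map_sub, hs, sub_self])
  have h1 : r - ψ s ∈ ψ.range := by
    rw [ha]
    exact sum_mem fun i _ => hcl _ _ (hπe i) (hemem i)
  have h2 := add_mem h1 (⟨s, rfl⟩ : ψ s ∈ ψ.range)
  rwa [sub_add_cancel] at h2

/-- The extra factor `x` avoids the exponent `m - 1` of the derivative. -/
theorem add_pow_of_sq_eq_zero (x d : R) (hd : d * d = 0) (m : ℕ) :
    (x + d) ^ m * x = x ^ (m + 1) + m * x ^ m * d := by
  induction m with
  | zero => simp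
  | succ m ih =>
    rw [pow_succ', mul_assoc, ih]
    push_cast
    linear_combination (m * x ^ m) * hd

theorem eval₂_add_mul (f : k[X]) (x d e : R) (h : d * e = 0) :
    f.eval₂ φ (x + d) * e = f.eval₂ φ x * e := by
  have h1 := sub_dvd_eval_sub (x + d) x (f.map φ)
  rw [add_sub_cancel_left, Polynomial.eval_map, Polynomial.eval_map] at h1
  obtain ⟨c, hc⟩ := h1
  rw [← sub_eq_zero, ← sub_mul, hc]
  linear_combination c * h

theorem eval₂_invert_toLaurent (f : k[X]) (x : Rˣ) :
    LaurentPolynomial.eval₂ φ x (invert (toLaurent f)) = f.eval₂ φ ((x⁻¹ : Rˣ) : R) := by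
  induction f using Polynomial.induction_on' with
  | add f g hf hg => simp [hf, hg]
  | monomial n c =>
    rw [← C_mul_X_pow_eq_monomial, toLaurent_C_mul_X_pow, map_mul,
      LaurentPolynomial.invert_C, LaurentPolynomial.invert_T]
    simp

/-- The liftings on the two charts agree up to a unit. -/
theorem IsLift.chart_eq {N : ℕ} {e : Fin 2 → ℕ} {δ ε : Fin 2 → k[T;T⁻¹]} {u v : Fin 2 → ℕ → k[X]}
    (h : ∀ i, IsLift N (e i) (δ i) (ε i) (u i) (v i)) (t : Rˣ) (σ : R) (E E' : Fin 2 → R)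
    (hE : ∀ i j, E i * E j = 0)
    (hE' : ∀ i, E' i = ((t ^ (e i - N - 1 : ℤ) : Rˣ) : R) * E i)
    (hσ : σ = ((t⁻¹ : Rˣ) : R) + ∑ i, LaurentPolynomial.eval₂ φ t (δ i) * E i)
    (l : ℕ) (hl : l ≤ N) :
    (t : R) ^ l + ∑ i, (u i l).eval₂ φ (t : R) * E i =
      ((t : R) ^ N * (1 + ∑ i, LaurentPolynomial.eval₂ φ t (ε i) * E i)) *
        (σ ^ (N - l) + ∑ i, (v i l).eval₂ φ σ * E' i) := by
  set s : R := ((t⁻¹ : Rˣ) : R) with hs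
  have hts : (t : R) * s = 1 := t.mul_inv
  set d : R := ∑ i, LaurentPolynomial.eval₂ φ t (δ i) * E i with hd
  have hdE : ∀ i, d * E i = 0 := fun i => by
    rw [hd, Finset.sum_mul]
    exact Finset.sum_eq_zero fun j _ => by rw [mul_assoc, hE, mul_zero]
  have hdd : d * d = 0 := by
    conv_lhs => rw [hd, Finset.mul_sum]
    exact Finset.sum_eq_zero fun j _ => by rw [mul_left_comm, ← hd, hdE, mul_zero]
  have hv : ∀ i, (v i l).eval₂ φ σ * E' i = (v i l).eval₂ φ s * E' i := fun i => by
    rw [hσ]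
    exact eval₂_add_mul _ _ _ _ _ (by rw [hE', mul_left_comm, hdE, mul_zero])
  -- First-order expansion of `σ ^ (N - l)` at `t⁻¹`; the derivative yields the `δ` term of
  -- `IsLift`.
  have hσp : (t : R) ^ N * σ ^ (N - l) = (t : R) ^ l + ((N : R) - l) * (t : R) ^ (l + 1) * d := by
    have h1 := add_pow_of_sq_eq_zero s d hdd (N - l)
    rw [← hσ] at h1
    have h2 : (t : R) ^ N = (t : R) ^ l * (t : R) ^ (N - l) := by
      rw [← pow_add, Nat.add_sub_cancel' hl]
    have h3 : (t : R) ^ (N - l) * s ^ (N - l) = 1 := by rw [← mul_pow, hts, one_pow]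
    have h4 : ((N - l : ℕ) : R) = (N : R) - l := Nat.cast_sub hl
    rw [h2, ← h4]
    calc _ = (t : R) ^ l * (t : R) ^ (N - l) * (σ ^ (N - l) * s) * t := by
          linear_combination - (t : R) ^ l * (t : R) ^ (N - l) * σ ^ (N - l) * hts
      _ = _ := by
          rw [h1]
          linear_combination ((t : R) ^ l * (t * s) + ((N - l : ℕ) : R) * t ^ (l + 1) * d) * h3 +
            (t : R) ^ l * hts
  have hu : ∀ i, (u i l).eval₂ φ (t : R) * E i =
      (t : R) ^ l * (LaurentPolynomial.eval₂ φ t (ε i) * E i) +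
      ((N : R) - l) * (t : R) ^ (l + 1) * (LaurentPolynomial.eval₂ φ t (δ i) * E i) +
      (t : R) ^ N * ((v i l).eval₂ φ s * E' i) := by
    intro i
    have h1 := congrArg (LaurentPolynomial.eval₂ φ t) (h i l hl)
    rw [LaurentPolynomial.eval₂_toLaurent, map_add, map_add, map_mul, map_mul, map_mul, map_mul,
      eval₂_invert_toLaurent, LaurentPolynomial.eval₂_T, LaurentPolynomial.eval₂_T,
      LaurentPolynomial.eval₂_T, LaurentPolynomial.eval₂_C] at h1
    have h2 : ((t ^ (e i - 1 : ℤ) : Rˣ) : R) = (t : R) ^ N * ((t ^ (e i - N - 1 : ℤ) : Rˣ) : R) := by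
      rw [← Units.val_pow_eq_pow_val, ← Units.val_mul, ← zpow_natCast, ← zpow_add]
      congr 2
      ring
    have h3 : ((t ^ (l : ℤ) : Rˣ) : R) = (t : R) ^ l := by simp
    have h4 : ((t ^ (l + 1 : ℤ) : Rˣ) : R) = (t : R) ^ (l + 1) := by
      rw [← Units.val_pow_eq_pow_val, ← zpow_natCast]
      simp
    rw [h1, h2, h3, h4, hE']
    simp only [map_sub, map_natCast]
    ring
  have hεσ : ∀ i, LaurentPolynomial.eval₂ φ t (ε i) * E i * ((t : R) ^ N * σ ^ (N - l)) =
      LaurentPolynomial.eval₂ φ t (ε i) * E i * (t : R) ^ l := fun i => by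
    rw [hσp]
    linear_combination (LaurentPolynomial.eval₂ φ t (ε i) * ((N : R) - l) * (t : R) ^ (l + 1)) *
      hdE i
  have hEE' : ∀ i j, E i * E' j = 0 := fun i j => by rw [hE', mul_left_comm, hE, mul_zero]
  simp only [hv, hu]
  simp only [Fin.sum_univ_two] at *
  linear_combination -hσp - hεσ 0 - hεσ 1  - ((N : R) - l) * (t : R) ^ (l + 1) * hd
    - (t : R) ^ N * (v 0 l).eval₂ φ s * LaurentPolynomial.eval₂ φ t (ε 0) * hEE' 0 0
    - (t : R) ^ N * (v 0 l).eval₂ φ s * LaurentPolynomial.eval₂ φ t (ε 1) * hEE' 1 0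
    - (t : R) ^ N * (v 1 l).eval₂ φ s * LaurentPolynomial.eval₂ φ t (ε 0) * hEE' 0 1
    - (t : R) ^ N * (v 1 l).eval₂ φ s * LaurentPolynomial.eval₂ φ t (ε 1) * hEE' 1 1

end SquareZero

end RopeEmbedding

noncomputable section

namespace RopeEmbedding

/-! ### Regular functions on `Proj` as homogeneous fractions. -/

section ProjSections

variable {A : Type u} {σ : Type*} [CommRing A] [SetLike σ A] [AddSubgroupClass σ A]
variable (𝒜 : ℕ → σ) [GradedRing 𝒜]

/-- The homogeneous prime ideal of a point of `Proj 𝒜`. -/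
def toSpectrum (x : Proj 𝒜) : ProjectiveSpectrum 𝒜 := x

variable {𝒜} in
theorem mem_primeComplAt {f : A} {x : Proj 𝒜} (h : x ∈ Proj.basicOpen 𝒜 f) :
    f ∈ primeComplAt 𝒜 (toSpectrum 𝒜 x) := h

/-- The value of a regular function at a point of `Proj 𝒜`, in the local ring of the cone. -/
def secVal {V : (Proj 𝒜).Opens} (x : Proj 𝒜) (hx : x ∈ V) :
    Γ(Proj 𝒜, V) →+* LocRing 𝒜 (toSpectrum 𝒜 x) where
  toFun a := HomogeneousLocalization.val (a.1 ⟨x, hx⟩)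
  map_one' := HomogeneousLocalization.val_one
  map_mul' _ _ := HomogeneousLocalization.val_mul _ _
  map_zero' := HomogeneousLocalization.val_zero
  map_add' _ _ := HomogeneousLocalization.val_add _ _

variable {𝒜}

/-- Reduces identities between regular functions to identities of fractions in the localizations at
points. -/
theorem sec_ext {V : (Proj 𝒜).Opens} {a b : Γ(Proj 𝒜, V)}
    (h : ∀ x hx, secVal 𝒜 x hx a = secVal 𝒜 x hx b) : a = b :=
  Subtype.ext (funext fun x => HomogeneousLocalization.val_injective _ (h x.1 x.2))

theorem secVal_awayToSection {f : A} (a : HomogeneousLocalization.Away 𝒜 f)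
    (x : Proj 𝒜) (hx : x ∈ Proj.basicOpen 𝒜 f) :
    secVal 𝒜 x hx ((Proj.awayToSection 𝒜 f).hom a) =
      IsLocalization.map (M := Submonoid.powers f) (T := primeComplAt 𝒜 (toSpectrum 𝒜 x)) _
        (RingHom.id _) (Submonoid.powers_le.mpr (mem_primeComplAt hx)) a.val :=
  ProjectiveSpectrum.Proj.awayToSection_apply 𝒜 f a ⟨x, hx⟩

/-- The regular function `g / s` on an open set where `s` does not vanish, for homogeneous `g`, `s`
of the same degree. -/
def frac {V : (Proj 𝒜).Opens} {d : ℕ} (g s : A) (hg : g ∈ 𝒜 d) (hs : s ∈ 𝒜 d)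
    (hV : V ≤ Proj.basicOpen 𝒜 s) : Γ(Proj 𝒜, V) :=
  ((Proj 𝒜).presheaf.map (homOfLE hV).op).hom ((Proj.awayToSection 𝒜 s).hom
    (HomogeneousLocalization.mk ⟨d, ⟨g, hg⟩, ⟨s, hs⟩, Submonoid.mem_powers s⟩))

theorem secVal_frac {V : (Proj 𝒜).Opens} {d : ℕ} (g s : A) (hg : g ∈ 𝒜 d) (hs : s ∈ 𝒜 d)
    (hV : V ≤ Proj.basicOpen 𝒜 s) (x : Proj 𝒜)
    (hx : x ∈ V) : secVal 𝒜 x hx (frac g s hg hs hV) = Localization.mk g ⟨s, mem_primeComplAt (hV hx)⟩ := rfl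

theorem frac_self {V : (Proj 𝒜).Opens} {d : ℕ} (s : A) (hs : s ∈ 𝒜 d)
    (hV : V ≤ Proj.basicOpen 𝒜 s) : frac s s hs hs hV = 1 :=
  sec_ext fun x hx => by
    rw [secVal_frac, map_one]
    exact Localization.mk_self (⟨s, mem_primeComplAt (hV hx)⟩ : primeComplAt 𝒜 _)

theorem frac_eq_one {V : (Proj 𝒜).Opens} {d : ℕ} {g s : A} (hg : g ∈ 𝒜 d) (hs : s ∈ 𝒜 d)
    (hV : V ≤ Proj.basicOpen 𝒜 s) (h : g = s) : frac g s hg hs hV = 1 := by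
  subst h
  exact frac_self g hg hV

theorem frac_mul_frac_self {V : (Proj 𝒜).Opens} {d : ℕ} (g s t : A) (hg : g ∈ 𝒜 d)
    (hs : s ∈ 𝒜 d) (ht : t ∈ 𝒜 d) (hV : V ≤ Proj.basicOpen 𝒜 s) (hV' : V ≤ Proj.basicOpen 𝒜 t) :
    frac g s hg hs hV * frac s t hs ht hV' = frac g t hg ht hV' :=
  sec_ext fun x hx => by
    rw [map_mul, secVal_frac, secVal_frac, secVal_frac, Localization.mk_mul,
      Localization.mk_eq_mk_iff, Localization.r_iff_exists]
    exact ⟨1, by simp; ring⟩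

theorem basicOpen_le_basicOpen_pow (f : A) (n : ℕ) :
    Proj.basicOpen 𝒜 f ≤ Proj.basicOpen 𝒜 (f ^ n) :=
  fun x hx h => hx ((toSpectrum 𝒜 x).isPrime.mem_of_pow_mem n h)

theorem exists_eq_frac {f : A} {d : ℕ} (hf : f ∈ 𝒜 d) (hd : 0 < d)
    (a : Γ(Proj 𝒜, Proj.basicOpen 𝒜 f)) :
    ∃ (n : ℕ) (g : A) (hg : g ∈ 𝒜 (n • d)),
      a = frac g (f ^ n) hg (SetLike.pow_mem_graded n hf) (basicOpen_le_basicOpen_pow f n) := by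
  obtain ⟨a, rfl⟩ := (ConcreteCategory.bijective_of_isIso
    (Proj.basicOpenIsoAway 𝒜 f hf hd).hom).2 a
  obtain ⟨n, g, hg, rfl⟩ := HomogeneousLocalization.Away.mk_surjective 𝒜 hf a
  refine ⟨n, g, hg, sec_ext fun x hx => ?_⟩
  rw [secVal_frac]
  refine (secVal_awayToSection _ x hx).trans ?_
  rw [HomogeneousLocalization.Away.val_mk, Localization.mk_eq_mk', Localization.mk_eq_mk',
    IsLocalization.map_mk']
  rfl

theorem ι_comp_toSpecZero {f : A} {d : ℕ} (hf : f ∈ 𝒜 d) (hd : 0 < d) :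
    (Proj.basicOpen 𝒜 f).ι ≫ Proj.toSpecZero 𝒜 = (Proj.basicOpen 𝒜 f).toSpecΓ ≫
      Spec.map (CommRingCat.ofHom (HomogeneousLocalization.fromZeroRingHom 𝒜 _) ≫
        Proj.awayToSection 𝒜 f) := by
  have := Proj.awayι_toSpecZero 𝒜 f hf hd
  rw [← Proj.basicOpenIsoSpec_inv_ι, Category.assoc, Iso.inv_comp_eq,
    Proj.basicOpenIsoSpec_hom, Proj.basicOpenToSpec] at this
  rw [this, Spec.map_comp, Category.assoc]

end ProjSections

/-! ### Scalars on schemes over a field, and generators of the rings of functions on basic open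
sets. -/

section Scalars

variable {k : Type u} [Field k]

theorem le_preimage_top {X S : Scheme.{u}} (q : X ⟶ S) (U : X.Opens) : U ≤ q ⁻¹ᵁ ⊤ := le_top

/-- The scalars in the ring of sections of a scheme over a field. -/
def scal {X : Scheme.{u}} (q : X ⟶ Spec (CommRingCat.of k)) (U : X.Opens) : k →+* Γ(X, U) :=
  ((Scheme.ΓSpecIso (CommRingCat.of k)).inv ≫ q.appLE ⊤ U (le_preimage_top q U)).hom

theorem appLE_scal {X Z : Scheme.{u}} (q : X ⟶ Spec (CommRingCat.of k)) (f : Z ⟶ X) (U : X.Opens)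
    (V : Z.Opens) (h : V ≤ f ⁻¹ᵁ U) (c : k) : (f.appLE U V h).hom (scal q U c) = scal (f ≫ q) V c := by
  change (((Scheme.ΓSpecIso (CommRingCat.of k)).inv ≫ q.appLE ⊤ U (le_preimage_top q U)) ≫ f.appLE U V h).hom c = _
  rw [Category.assoc, Scheme.Hom.appLE_comp_appLE]
  rfl

theorem map_scal {X : Scheme.{u}} (q : X ⟶ Spec (CommRingCat.of k)) {U V : X.Opens} (h : V ≤ U)
    (c : k) : (X.presheaf.map (homOfLE h).op).hom (scal q U c) = scal q V c := by
  change (((Scheme.ΓSpecIso (CommRingCat.of k)).inv ≫ q.appLE ⊤ U (le_preimage_top q U)) ≫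
    X.presheaf.map (homOfLE h).op).hom c = _
  rw [Category.assoc, Scheme.Hom.appLE_map]
  rfl

theorem toSpecΓ_comp_scal {X : Scheme.{u}} (q : X ⟶ Spec (CommRingCat.of k)) (U : X.Opens) :
    U.toSpecΓ ≫ Spec.map (CommRingCat.ofHom (scal q U)) = U.ι ≫ q := by
  rw [scal, CommRingCat.ofHom_hom, Spec.map_comp, Scheme.Opens.toSpecΓ_SpecMap_appLE_assoc,
    Scheme.Opens.toSpecΓ_top, Category.assoc, toSpecΓ_SpecMap_ΓSpecIso_inv, Category.comp_id,
    Scheme.Hom.resLE_comp_ι]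

theorem scal_eq_of_ι_comp {X : Scheme.{u}} (q : X ⟶ Spec (CommRingCat.of k)) (U : X.Opens)
    (φ : k →+* Γ(X, U)) (h : U.ι ≫ q = U.toSpecΓ ≫ Spec.map (CommRingCat.ofHom φ)) :
    scal q U = φ := by
  have h1 := congrArg Scheme.Hom.appTop ((toSpecΓ_comp_scal q U).trans h)
  rw [Scheme.Hom.comp_appTop, Scheme.Hom.comp_appTop, Scheme.Opens.toSpecΓ_appTop,
    Scheme.ΓSpecIso_naturality_assoc, Scheme.ΓSpecIso_naturality_assoc, cancel_epi, cancel_mono] at h1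
  exact congrArg CommRingCat.Hom.hom h1

theorem iSup_basicOpen_X {n : ℕ} :
    (⨆ l, Proj.basicOpen (grading k n) (MvPolynomial.X l)) = ⊤ := by
  refine Proj.iSup_basicOpen_eq_top' _ _ (fun i => ⟨1, MvPolynomial.isHomogeneous_X k i⟩) ?_
  refine top_unique fun p _ => ?_
  induction p using MvPolynomial.induction_on with
  | C c =>
    have h : (MvPolynomial.C c : MvPolynomial _ k) ∈ grading k n 0 :=
      MvPolynomial.isHomogeneous_C _ c
    exact Subalgebra.algebraMap_mem _ (⟨_, h⟩ : grading k n 0)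
  | add p q hp hq => exact add_mem (hp trivial) (hq trivial)
  | mul_X p i hp => exact mul_mem (hp trivial) (Algebra.subset_adjoin ⟨i, rfl⟩)

/-- The value of a scalar on projective space. -/
theorem secVal_scal {n : ℕ} {V : (PSpace k n).Opens} (c : k) (x : PSpace k n) (hx : x ∈ V) :
    secVal (grading k n) x hx (scal (PSpace.toSpec k n) V c) =
      algebraMap (MvPolynomial (Fin (n + 1)) k) _ (MvPolynomial.C c) := by
  obtain ⟨l, hl⟩ := Opens.mem_iSup.mp ((iSup_basicOpen_X (k := k) (n := n)).symm ▸ Opens.mem_top x)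
  have h1 := map_scal (PSpace.toSpec k n) (inf_le_left : V ⊓
    Proj.basicOpen (grading k n) (MvPolynomial.X l) ≤ V) c
  have h2 := map_scal (PSpace.toSpec k n) (inf_le_right : V ⊓
    Proj.basicOpen (grading k n) (MvPolynomial.X l) ≤ _) c
  have h3 := scal_eq_of_ι_comp (PSpace.toSpec k n)
    (Proj.basicOpen (grading k n) (MvPolynomial.X l))
    (CommRingCat.ofHom (algebraMap k (grading k n 0)) ≫
      CommRingCat.ofHom (HomogeneousLocalization.fromZeroRingHom (grading k n) _) ≫
        Proj.awayToSection (grading k n) (MvPolynomial.X l)).hom (by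
    rw [PSpace.toSpec, ← Category.assoc, ι_comp_toSpecZero (MvPolynomial.isHomogeneous_X k l)
      one_pos, Category.assoc, ← Spec.map_comp]
    rfl)
  have h4 : secVal (grading k n) x hx (scal (PSpace.toSpec k n) V c) =
      secVal (grading k n) x hl (scal (PSpace.toSpec k n) _ c) := by
    have hx' : x ∈ V ⊓ Proj.basicOpen (grading k n) (MvPolynomial.X l) := ⟨hx, hl⟩
    have h5 := (congrArg (secVal (grading k n) x hx') (h1.trans h2.symm))
    exact h5
  rw [h4, h3]
  refine (secVal_awayToSection _ x hl).trans ?_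
  change IsLocalization.map _ _ _ (Localization.mk (MvPolynomial.C c) 1) = _
  rw [Localization.mk_one_eq_algebraMap, IsLocalization.map_eq, RingHom.id_apply]

/-- A form over a power of a form `f` lies in every subring that contains the scalars and the
monomials of the same degree over that power of `f`. -/
theorem frac_mem {n d : ℕ} {V : (PSpace k n).Opens} (R : Subring Γ(PSpace k n, V))
    (f : MvPolynomial (Fin (n + 1)) k) (hf : f ∈ grading k n d) (hV : V ≤ Proj.basicOpen _ f)
    (hR : ∀ c, scal (PSpace.toSpec k n) V c ∈ R)
    (hmon : ∀ (s : Fin (n + 1) →₀ ℕ) (hs : MvPolynomial.monomial s 1 ∈ grading k n d),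
      frac (MvPolynomial.monomial s 1) f hs hf hV ∈ R)
    (g : MvPolynomial (Fin (n + 1)) k) (hg : g ∈ grading k n d) : frac g f hg hf hV ∈ R := by
  have hmem : ∀ s ∈ g.support, MvPolynomial.monomial s (1 : k) ∈ grading k n d := fun s hs => by
    have hg' : g.IsHomogeneous d := hg
    refine MvPolynomial.isHomogeneous_monomial _ ?_
    rw [← hg' (MvPolynomial.mem_support_iff.mp hs), Finsupp.degree_eq_weight_one]
    rfl
  have h : frac g f hg hf hV = ∑ s ∈ g.support.attach,
      scal (PSpace.toSpec k n) V (g.coeff s.1) * frac (MvPolynomial.monomial s.1 1) f (hmem s.1 s.2) hf hV := sec_ext fun x hx => by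
    rw [map_sum, secVal_frac]
    have : ∀ s ∈ g.support.attach, secVal (grading k n) x hx (scal (PSpace.toSpec k n) V (g.coeff s.1) *
        frac (MvPolynomial.monomial s.1 1) f (hmem s.1 s.2) hf hV) =
        algebraMap _ _ (MvPolynomial.monomial s.1 (g.coeff s.1)) *
          Localization.mk 1 ⟨f, mem_primeComplAt (hV hx)⟩ := fun s _ => by
      rw [map_mul, secVal_scal, secVal_frac, ← Localization.mk_one_eq_algebraMap,
        ← Localization.mk_one_eq_algebraMap, Localization.mk_mul, Localization.mk_mul,
        MvPolynomial.C_mul_monomial, mul_one, mul_one]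
    rw [Finset.sum_congr rfl this, ← Finset.sum_mul, ← map_sum, Finset.sum_attach g.support
      (fun s => MvPolynomial.monomial s (g.coeff s)), ← MvPolynomial.as_sum,
      ← Localization.mk_one_eq_algebraMap, Localization.mk_mul, mul_one, one_mul]
  rw [h]
  exact sum_mem fun s _ => mul_mem (hR _) (hmon _ (hmem s.1 s.2))

theorem monomial_mem_grading_iff {n m : ℕ} {s : Fin (n + 1) →₀ ℕ} :
    MvPolynomial.monomial s (1 : k) ∈ grading k n m ↔ s.degree = m := by
  refine ⟨fun h => ?_, fun h => MvPolynomial.isHomogeneous_monomial _ h⟩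
  have h' : (MvPolynomial.monomial s (1 : k)).IsHomogeneous m := h
  have := h' (d := s) (by rw [MvPolynomial.coeff_monomial, if_pos rfl]; exact one_ne_zero)
  rwa [Finsupp.degree_eq_weight_one]

theorem frac_monomial_pow_mem {n d : ℕ} {V : (PSpace k n).Opens} (R : Subring Γ(PSpace k n, V))
    (f : MvPolynomial (Fin (n + 1)) k) (hf : f ∈ grading k n d) (hV : V ≤ Proj.basicOpen _ f)
    (hmon : ∀ (s : Fin (n + 1) →₀ ℕ) (hs : MvPolynomial.monomial s 1 ∈ grading k n d),
      frac (MvPolynomial.monomial s 1) f hs hf hV ∈ R)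
    (e : ℕ) (s : Fin (n + 1) →₀ ℕ) (hs : MvPolynomial.monomial s 1 ∈ grading k n (e • d)) :
    frac (MvPolynomial.monomial s 1) (f ^ e) hs (SetLike.pow_mem_graded e hf)
      (hV.trans (basicOpen_le_basicOpen_pow f e)) ∈ R := by
  induction e generalizing s with
  | zero =>
    have h0 : s = 0 := by
      have := monomial_mem_grading_iff.mp hs
      rwa [zero_smul, Finsupp.degree_eq_zero_iff] at this
    subst h0
    have : frac (MvPolynomial.monomial 0 1) (f ^ 0) hs (SetLike.pow_mem_graded 0 hf)
        (hV.trans (basicOpen_le_basicOpen_pow f 0)) = 1 := frac_eq_one _ _ _ (pow_zero f).symm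
    rw [this]
    exact one_mem R
  | succ e ih =>
    have h := monomial_mem_grading_iff.mp hs
    rw [succ_nsmul] at h
    -- A monomial of degree `(e + 1) * d` has a factor of degree exactly `d`.
    obtain ⟨t, ht, htd⟩ := Finsupp.exists_le_degree_eq s d (by omega)
    obtain ⟨r, rfl⟩ := exists_add_of_le ht
    rw [map_add, htd, add_comm, add_left_inj] at h
    have hr := (monomial_mem_grading_iff (k := k)).mpr h
    have ht' := (monomial_mem_grading_iff (k := k)).mpr htd
    have : frac (MvPolynomial.monomial (t + r) 1) (f ^ (e + 1)) hs (SetLike.pow_mem_graded _ hf)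
        (hV.trans (basicOpen_le_basicOpen_pow f _)) =
        frac (MvPolynomial.monomial r 1) (f ^ e) hr (SetLike.pow_mem_graded _ hf)
          (hV.trans (basicOpen_le_basicOpen_pow f _)) *
        frac (MvPolynomial.monomial t 1) f ht' hf hV := sec_ext fun x hx => by
      rw [map_mul, secVal_frac, secVal_frac, secVal_frac, Localization.mk_mul,
        MvPolynomial.monomial_mul, one_mul, add_comm r t]
      rfl
    rw [this]
    exact mul_mem (ih r hr) (hmon t ht')

/-- The ring of functions on the locus where a form `f` of positive degree `d` does not vanish is
generated by the scalars and the monomials of degree `d` over `f`. -/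
theorem subring_eq_top {n d : ℕ} (hd : 0 < d) (f : MvPolynomial (Fin (n + 1)) k)
    (hf : f ∈ grading k n d) (R : Subring Γ(PSpace k n, Proj.basicOpen (grading k n) f))
    (hR : ∀ c, scal (PSpace.toSpec k n) _ c ∈ R)
    (hmon : ∀ (s : Fin (n + 1) →₀ ℕ) (hs : MvPolynomial.monomial s 1 ∈ grading k n d),
      frac (MvPolynomial.monomial s 1) f hs hf le_rfl ∈ R) : R = ⊤ := by
  refine top_unique fun a _ => ?_
  obtain ⟨e, g, hg, rfl⟩ := exists_eq_frac hf hd a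
  exact frac_mem R _ (SetLike.pow_mem_graded e hf) _ hR
    (frac_monomial_pow_mem R f hf le_rfl hmon e) g hg

end Scalars

end RopeEmbedding

end

noncomputable section

namespace RopeEmbedding

/-! ### Restriction and pullback of sections; morphisms from an open set to an affine scheme. -/

section Restriction

variable {X Y Z : Scheme.{u}}

/-- Restriction of sections of the structure sheaf. -/
def resSec {U V : X.Opens} (h : V ≤ U) : Γ(X, U) →+* Γ(X, V) := (X.presheaf.map (homOfLE h).op).hom

@[simp]
theorem resSec_resSec {U V W : X.Opens} (h : V ≤ U) (h' : W ≤ V) (s : Γ(X, U)) :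
    resSec h' (resSec h s) = resSec (h'.trans h) s := by
  change (X.presheaf.map (homOfLE h).op ≫ X.presheaf.map (homOfLE h').op).hom s = _
  rw [← Functor.map_comp]
  rfl

@[simp]
theorem resSec_self {U : X.Opens} (h : U ≤ U) (s : Γ(X, U)) : resSec h s = s := by
  change (X.presheaf.map (𝟙 (op U))).hom s = _
  rw [X.presheaf.map_id]
  rfl

theorem resSec_appLE (f : X ⟶ Y) {U : Y.Opens} {V W : X.Opens} (h : V ≤ f ⁻¹ᵁ U) (h' : W ≤ V)
    (s : Γ(Y, U)) : resSec h' ((f.appLE U V h).hom s) = (f.appLE U W (h'.trans h)).hom s := by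
  change (f.appLE U V h ≫ X.presheaf.map (homOfLE h').op).hom s = _
  rw [Scheme.Hom.appLE_map]

theorem appLE_resSec (f : X ⟶ Y) {U U' : Y.Opens} {V : X.Opens} (h : V ≤ f ⁻¹ᵁ U) (h' : U ≤ U')
    (s : Γ(Y, U')) : (f.appLE U V h).hom (resSec h' s) =
      (f.appLE U' V (h.trans (f.preimage_mono h'))).hom s := by
  change (Y.presheaf.map (homOfLE h').op ≫ f.appLE U V h).hom s = _
  rw [Scheme.Hom.map_appLE]

theorem appLE_appLE (f : X ⟶ Y) (g : Y ⟶ Z) {U : Z.Opens} {V : Y.Opens} {W : X.Opens}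
    (h : V ≤ g ⁻¹ᵁ U) (h' : W ≤ f ⁻¹ᵁ V) (s : Γ(Z, U)) :
    (f.appLE V W h').hom ((g.appLE U V h).hom s) =
      ((f ≫ g).appLE U W (h'.trans (f.preimage_mono h))).hom s := by
  change (g.appLE U V h ≫ f.appLE V W h').hom s = _
  rw [Scheme.Hom.appLE_comp_appLE]

theorem resSec_mem_basicOpen {U V : X.Opens} (h : V ≤ U) (s : Γ(X, U)) :
    X.basicOpen (resSec h s) = V ⊓ X.basicOpen s := Scheme.basicOpen_res X s (homOfLE h).op

theorem exists_eq_toSpecΓ_comp {U : X.Opens} {S : CommRingCat.{u}} (f : U.toScheme ⟶ Spec S) :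
    ∃ ψ : S ⟶ Γ(X, U), f = U.toSpecΓ ≫ Spec.map ψ := by
  refine ⟨(Scheme.ΓSpecIso S).inv ≫ f.appTop ≫ U.topIso.hom, ?_⟩
  rw [Scheme.Opens.toSpecΓ, Category.assoc, ← Spec.map_comp, Category.assoc, Category.assoc,
    U.topIso.hom_inv_id, Category.comp_id, Spec.map_comp, ← Scheme.toSpecΓ_naturality_assoc,
    toSpecΓ_SpecMap_ΓSpecIso_inv, Category.comp_id]

theorem toSpecΓ_comp_injective {U : X.Opens} {S : CommRingCat.{u}} {φ ψ : S ⟶ Γ(X, U)}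
    (h : U.toSpecΓ ≫ Spec.map φ = U.toSpecΓ ≫ Spec.map ψ) : φ = ψ := by
  have h1 := congrArg Scheme.Hom.appTop h
  rwa [Scheme.Hom.comp_appTop, Scheme.Hom.comp_appTop, Scheme.Opens.toSpecΓ_appTop,
    Scheme.ΓSpecIso_naturality_assoc, Scheme.ΓSpecIso_naturality_assoc, cancel_epi,
    cancel_mono] at h1

theorem resLE_comp_toSpecΓ (f : X ⟶ Y) (U : Y.Opens) (V : X.Opens) (h : V ≤ f ⁻¹ᵁ U) :
    f.resLE U V h ≫ U.toSpecΓ = V.toSpecΓ ≫ Spec.map (f.appLE U V h) :=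
  (Scheme.Opens.toSpecΓ_SpecMap_appLE f U V h).symm

end Restriction

section FromProj

theorem awayMap_mk_mul {R S : Type*} [CommRing R] [CommRing S] (f : R →+* S) (r g : R)
    (h : Submonoid.powers r ≤ (Submonoid.powers (f r)).comap f) :
    IsLocalization.map (M := Submonoid.powers r) (T := Submonoid.powers (f r))
      (Localization.Away (f r)) f h
        (Localization.mk g ⟨r, Submonoid.mem_powers r⟩ : Localization.Away r) *
        algebraMap S _ (f r) = algebraMap S _ (f g) := by
  rw [Localization.mk_eq_mk', IsLocalization.map_mk']
  exact IsLocalization.mk'_spec _ _ _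

variable {A : Type u} {σ : Type*} [CommRing A] [SetLike σ A] [AddSubgroupClass σ A]
variable (𝒜 : ℕ → σ) [GradedRing 𝒜] {X : Scheme.{u}}

/-- The pullback of `g / r` is `f g / f r`, in a form without division. -/
theorem fromOfGlobalSections_appLE (f : A →+* Γ(X, ⊤))
    (hf : (HomogeneousIdeal.irrelevant 𝒜).toIdeal.map f = ⊤) {r g : A} {n : ℕ} (hn : 0 < n)
    (hr : r ∈ 𝒜 n) (hg : g ∈ 𝒜 n)
    (h : X.basicOpen (f r) ≤ Proj.fromOfGlobalSections 𝒜 f hf ⁻¹ᵁ Proj.basicOpen 𝒜 r) :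
    ((Proj.fromOfGlobalSections 𝒜 f hf).appLE (Proj.basicOpen 𝒜 r) _ h).hom
      ((Proj.awayToSection 𝒜 r).hom
        (HomogeneousLocalization.mk ⟨n, ⟨g, hg⟩, ⟨r, hr⟩, Submonoid.mem_powers r⟩)) *
      resSec le_top (f r) = resSec le_top (f g) := by
  obtain ⟨ψ, hψ⟩ := exists_eq_toSpecΓ_comp ((X.isoOfEq (X.toSpecΓ_preimage_basicOpen (f r))).inv ≫
    X.toSpecΓ ∣_ _ ≫ (basicOpenIsoSpecAway (f r)).hom)
  have h0 : CommRingCat.ofHom (algebraMap Γ(X, ⊤) (Localization.Away (f r))) ≫ ψ =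
      X.presheaf.map (homOfLE le_top).op := by
    refine toSpecΓ_comp_injective ?_
    rw [Spec.map_comp, ← Category.assoc, ← hψ, Scheme.Opens.toSpecΓ_SpecMap_presheaf_map_top]
    rw [Category.assoc, Category.assoc, basicOpenIsoSpecAway_hom_SpecMap]
    refine (congrArg (_ ≫ ·) (morphismRestrict_ι _ _)).trans ?_
    exact Scheme.isoOfEq_inv_ι_assoc _ _ _
  have h1 := Proj.fromOfGlobalSections_resLE 𝒜 f hf hn hr
  rw [Proj.toBasicOpenOfGlobalSections] at h1
  have h2 : _ = _ := congrArg (· ≫ (Proj.basicOpenIsoSpec 𝒜 r hr hn).hom) h1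
  simp only [Category.assoc, Iso.inv_hom_id, Category.comp_id] at h2
  rw [Proj.basicOpenIsoSpec_hom, Proj.basicOpenToSpec, ← Category.assoc, resLE_comp_toSpecΓ,
    Category.assoc, ← Spec.map_comp, reassoc_of% hψ, ← Spec.map_comp] at h2
  have h3 := congrArg (fun φ => φ.hom (HomogeneousLocalization.mk
    ⟨n, ⟨g, hg⟩, ⟨r, hr⟩, Submonoid.mem_powers r⟩)) (toSpecΓ_comp_injective h2)
  have h4 : ∀ a, ψ.hom (algebraMap _ _ a) = resSec le_top a := fun a => congrArg (fun φ => φ.hom a) h0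
  refine (congrArg (· * resSec le_top (f r)) h3).trans ?_
  rw [← h4, ← h4]
  refine (map_mul ψ.hom _ _).symm.trans (congrArg ψ.hom ?_)
  exact awayMap_mk_mul f r g (by
    rw [← Submonoid.map_le_iff_le_comap, Submonoid.map_powers])

end FromProj

end RopeEmbedding

end

noncomputable section

namespace RopeEmbedding

/-! ### Morphisms to projective space in homogeneous coordinates. -/

variable {k : Type u} [Field k] {N : ℕ}

/-- The standard open subset `X_l ≠ 0` of projective space. -/
abbrev stdOpen (k : Type u) [Field k] (N : ℕ) (l : Fin (N + 1)) : (PSpace k N).Opens :=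
  Proj.basicOpen (grading k N) (MvPolynomial.X l)

/-- The coordinate function `X_m / X_l` on `stdOpen k N l`. -/
def coord (k : Type u) [Field k] (N : ℕ) (l m : Fin (N + 1)) : Γ(PSpace k N, stdOpen k N l) :=
  formRatio (MvPolynomial.X l) (MvPolynomial.X m)
    (MvPolynomial.isHomogeneous_X k l) (MvPolynomial.isHomogeneous_X k m)

theorem X_mem_grading (l : Fin (N + 1)) : (MvPolynomial.X l : MvPolynomial _ k) ∈ grading k N 1 :=
  MvPolynomial.isHomogeneous_X k l

/-- The morphism `j` to projective space is given on `U` by the homogeneous coordinates `y`. -/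
structure IsGivenBy {X : Scheme.{u}} (j : X ⟶ PSpace k N) (U : X.Opens)
    (y : Fin (N + 1) → Γ(X, U)) : Prop where
  basicOpen_eq (l) : X.basicOpen (y l) = U ⊓ j ⁻¹ᵁ stdOpen k N l
  mul_eq (l m) (V : X.Opens) (hV : V ≤ j ⁻¹ᵁ stdOpen k N l) (hU : V ≤ U) :
    (j.appLE _ V hV).hom (coord k N l m) * resSec hU (y l) = resSec hU (y m)

namespace IsGivenBy

variable {X Z : Scheme.{u}} {j : X ⟶ PSpace k N} {U V : X.Opens} {y : Fin (N + 1) → Γ(X, U)}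

theorem comp (h : IsGivenBy j U y) (f : Z ⟶ X) {W : Z.Opens} (hW : W ≤ f ⁻¹ᵁ U) :
    IsGivenBy (f ≫ j) W (fun l => (f.appLE U W hW).hom (y l)) where
  basicOpen_eq l := by
    rw [Scheme.basicOpen_appLE, h.basicOpen_eq, Scheme.Hom.preimage_inf, ← inf_assoc,
      inf_eq_left.mpr hW]
    rfl
  mul_eq l m V hV hVW := by
    have h1 : V ≤ f ⁻¹ᵁ (U ⊓ j ⁻¹ᵁ stdOpen k N l) := le_inf (hVW.trans hW) hV
    have h2 := congrArg (f.appLE _ V h1).hom (h.mul_eq l m _ inf_le_right inf_le_left)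
    rw [map_mul, appLE_appLE, appLE_resSec, appLE_resSec] at h2
    rw [resSec_appLE, resSec_appLE]
    exact h2

theorem smul (h : IsGivenBy j U y) (u : Γ(X, U)ˣ) : IsGivenBy j U (fun l => u * y l) where
  basicOpen_eq l := by
    rw [Scheme.basicOpen_mul, h.basicOpen_eq, Scheme.basicOpen_of_isUnit _ u.isUnit,
      ← inf_assoc, inf_idem]
  mul_eq l m W hW hWU := by
    rw [map_mul, map_mul, mul_left_comm, h.mul_eq l m W hW hWU]

/-- The functions with equal pullbacks form a subring containing the scalars and the coordinates
`X_m / X_l`, hence everything. -/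
theorem resLE_eq {j' : X ⟶ PSpace k N} (h : IsGivenBy j U y) (h' : IsGivenBy j' U y)
    (hj : j ≫ PSpace.toSpec k N = j' ≫ PSpace.toSpec k N) (l : Fin (N + 1))
    (h1 : X.basicOpen (y l) ≤ j ⁻¹ᵁ stdOpen k N l) (h2 : X.basicOpen (y l) ≤ j' ⁻¹ᵁ stdOpen k N l) :
    j.appLE _ _ h1 = j'.appLE _ _ h2 := by
  let R : Subring Γ(PSpace k N, stdOpen k N l) := (j.appLE _ _ h1).hom.eqLocus (j'.appLE _ _ h2).hom
  have hu : IsUnit (resSec (X.basicOpen_le (y l)) (y l)) := by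
    exact RingedSpace.isUnit_res_basicOpen _ _
  have hc : ∀ m, coord k N l m ∈ R := fun m =>
    hu.mul_right_cancel ((h.mul_eq l m _ h1 _).trans (h'.mul_eq l m _ h2 _).symm)
  have hs : ∀ c, scal (PSpace.toSpec k N) _ c ∈ R := fun c => by
    change (j.appLE _ _ h1).hom _ = (j'.appLE _ _ h2).hom _
    rw [appLE_scal, appLE_scal, hj]
  have htop := subring_eq_top one_pos (MvPolynomial.X l) (X_mem_grading l) R hs fun s hs => by
    obtain ⟨m, rfl⟩ := (Finsupp.sum_eq_one_iff s).mp (monomial_mem_grading_iff.mp hs)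
    exact hc m
  ext a
  exact htop.ge (Subring.mem_top a)

theorem unique {j' : X ⟶ PSpace k N} (h : IsGivenBy j U y) (h' : IsGivenBy j' U y)
    (hj : j ≫ PSpace.toSpec k N = j' ≫ PSpace.toSpec k N) : U.ι ≫ j = U.ι ≫ j' := by
  refine Scheme.hom_ext_of_forall _ _ fun x => ?_
  obtain ⟨l, hl⟩ := Opens.mem_iSup.mp
    ((iSup_basicOpen_X (k := k) (n := N)).symm ▸ Opens.mem_top (j x.1))
  refine ⟨U.ι ⁻¹ᵁ X.basicOpen (y l), (h.basicOpen_eq l).ge ⟨x.2, hl⟩, ?_⟩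
  have h1 : X.basicOpen (y l) ≤ j ⁻¹ᵁ stdOpen k N l := (h.basicOpen_eq l).le.trans inf_le_right
  have h2 : X.basicOpen (y l) ≤ j' ⁻¹ᵁ stdOpen k N l := (h'.basicOpen_eq l).le.trans inf_le_right
  have haff : IsAffine (stdOpen k N l) := Proj.isAffineOpen_basicOpen _ _ (X_mem_grading l) one_pos
  have : IsIso (stdOpen k N l).toSpecΓ := by
    rw [Scheme.Opens.toSpecΓ]
    infer_instance
  have h3 : j.resLE _ _ h1 = j'.resLE _ _ h2 := by
    rw [← cancel_mono (stdOpen k N l).toSpecΓ, resLE_comp_toSpecΓ, resLE_comp_toSpecΓ,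
      h.resLE_eq h' hj]
  rw [← Scheme.Hom.resLE_comp_ι_assoc U.ι le_rfl, ← Scheme.Hom.resLE_comp_ι_assoc U.ι le_rfl,
    ← Scheme.Hom.resLE_comp_ι j h1, ← Scheme.Hom.resLE_comp_ι j' h2, h3]

theorem of_ι (h : IsGivenBy (U.ι ≫ j) ⊤ (fun l => (U.ι.appLE U ⊤ (by simp)).hom (y l))) :
    IsGivenBy j U y where
  basicOpen_eq l := by
    have h1 := congrArg (U.ι ''ᵁ ·) (h.basicOpen_eq l)
    rw [Scheme.basicOpen_appLE, Scheme.Hom.comp_preimage, top_inf_eq, top_inf_eq] at h1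
    simp only [Scheme.Hom.image_preimage_eq_opensRange_inf, Scheme.Opens.opensRange_ι] at h1
    rwa [inf_eq_right.mpr (X.basicOpen_le (y l))] at h1
  mul_eq l m V hV hVU := by
    have h1 := h.mul_eq l m (U.ι ⁻¹ᵁ V) (U.ι.preimage_mono hV) le_top
    have : IsIso (U.ι.app V) := U.ι.isIso_app V (by simpa using hVU)
    refine (ConcreteCategory.bijective_of_isIso (U.ι.app V)).1 ?_
    rw [resSec_appLE, resSec_appLE, ← appLE_appLE (U := stdOpen k N l) (V := V) U.ι j hV le_rfl,
      ← appLE_resSec U.ι le_rfl hVU, ← appLE_resSec U.ι le_rfl hVU, ← map_mul,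
      Scheme.Hom.appLE_eq_app] at h1
    exact h1

end IsGivenBy

variable {X : Scheme.{u}} (q : X ⟶ Spec (CommRingCat.of k))

theorem toSpecΓ_comp_scal_top : X.toSpecΓ ≫ Spec.map (CommRingCat.ofHom (scal q ⊤)) = q := by
  have : scal q ⊤ = ((Scheme.ΓSpecIso (CommRingCat.of k)).inv ≫ q.appTop).hom := by
    rw [scal, Scheme.Hom.appTop, ← Scheme.Hom.appLE_eq_app]
    rfl
  rw [this, CommRingCat.ofHom_hom, Spec.map_comp, ← Scheme.toSpecΓ_naturality_assoc,
    toSpecΓ_SpecMap_ΓSpecIso_inv, Category.comp_id]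

theorem exists_isGivenBy_top (y : Fin (N + 1) → Γ(X, ⊤)) (hy : Ideal.span (Set.range y) = ⊤) :
    ∃ j : X ⟶ PSpace k N, j ≫ PSpace.toSpec k N = q ∧ IsGivenBy j ⊤ y := by
  let f : MvPolynomial (Fin (N + 1)) k →+* Γ(X, ⊤) := MvPolynomial.eval₂Hom (scal q ⊤) y
  have hfX : ∀ l, f (MvPolynomial.X l) = y l := fun l => MvPolynomial.eval₂Hom_X' _ _ _
  have hf : (HomogeneousIdeal.irrelevant (grading k N)).toIdeal.map f = ⊤ := by
    refine top_unique (hy.ge.trans (Ideal.span_le.mpr ?_))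
    rintro _ ⟨l, rfl⟩
    rw [← hfX]
    refine Ideal.mem_map_of_mem f ?_
    change _ ∈ HomogeneousIdeal.irrelevant (grading k N)
    rw [HomogeneousIdeal.mem_irrelevant_iff]
    exact DirectSum.decompose_of_mem_ne (grading k N) (X_mem_grading l) one_ne_zero
  refine ⟨Proj.fromOfGlobalSections (grading k N) f hf, ?_, fun l => ?_, fun l m V hV hU => ?_⟩
  · rw [PSpace.toSpec, Proj.fromOfGlobalSections_toSpecZero_assoc, ← Spec.map_comp]
    refine Eq.trans ?_ (toSpecΓ_comp_scal_top q)
    congr 2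
    ext c
    exact MvPolynomial.eval₂Hom_C _ _ _
  · rw [Proj.fromOfGlobalSections_preimage_basicOpen _ _ _ one_pos (X_mem_grading l), hfX,
      top_inf_eq]
  · have h1 := Proj.fromOfGlobalSections_preimage_basicOpen _ f hf one_pos (X_mem_grading (k := k) l)
    have h2 := fromOfGlobalSections_appLE (grading k N) f hf one_pos (X_mem_grading l)
      (X_mem_grading m) h1.ge
    have h3 := congrArg (resSec (hV.trans h1.le)) h2
    rw [map_mul, resSec_resSec, resSec_resSec, resSec_appLE] at h3
    rw [← hfX, ← hfX]
    exact h3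

/-- Multiplying homogeneous coordinates by a unit does not change the morphism, so the local
morphisms agree on overlaps by `IsGivenBy.unique` and glue. -/
theorem exists_isGivenBy {ι : Type*} (W : ι → X.Opens) (hW : ⨆ i, W i = ⊤)
    (y : ∀ i, Fin (N + 1) → Γ(X, W i)) (hy : ∀ i, Ideal.span (Set.range (y i)) = ⊤)
    (hu : ∀ i i', ∃ u : Γ(X, W i ⊓ W i')ˣ, ∀ l,
      resSec (inf_le_left : W i ⊓ W i' ≤ W i) (y i l) =
        u * resSec (inf_le_right : W i ⊓ W i' ≤ W i') (y i' l)) :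
    ∃ j : X ⟶ PSpace k N, j ≫ PSpace.toSpec k N = q ∧ ∀ i, IsGivenBy j (W i) (y i) := by
  have hle : ∀ i, (⊤ : (W i).toScheme.Opens) ≤ (W i).ι ⁻¹ᵁ W i := fun i => by simp
  have h1 : ∀ i, ∃ j : (W i).toScheme ⟶ PSpace k N, j ≫ PSpace.toSpec k N = (W i).ι ≫ q ∧
      IsGivenBy j ⊤ (fun l => ((W i).ι.appLE (W i) ⊤ (hle i)).hom (y i l)) := fun i => by
    refine exists_isGivenBy_top _ _ ?_
    rw [Set.range_comp', ← Ideal.map_span, hy, Ideal.map_top]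
  choose j hjq hj using h1
  have hglue : ∀ (P : Scheme.{u}) (i i') (a : P ⟶ (W i).toScheme) (b : P ⟶ (W i').toScheme),
      a ≫ (W i).ι = b ≫ (W i').ι → a ≫ j i = b ≫ j i' := fun P i i' a b hc => by
    obtain ⟨u, hu⟩ := hu i i'
    have ha := (congrArg (IsGivenBy (a ≫ j i) ⊤) (funext fun l =>
      appLE_appLE a (W i).ι (hle i) le_rfl (y i l))).mp ((hj i).comp a (W := ⊤) le_rfl)
    have hb := (congrArg (IsGivenBy (b ≫ j i') ⊤) (funext fun l =>
      appLE_appLE b (W i').ι (hle i') le_rfl (y i' l))).mp ((hj i').comp b (W := ⊤) le_rfl)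
    have hle' : (⊤ : P.Opens) ≤ (a ≫ (W i).ι) ⁻¹ᵁ (W i ⊓ W i') := by
      rw [Scheme.Hom.preimage_inf]
      refine le_inf ?_ ?_
      · exact a.preimage_mono (hle i)
      · rw [hc]
        exact b.preimage_mono (hle i')
    have hb' := hb.smul (Units.map ((a ≫ (W i).ι).appLE _ ⊤ hle').hom.toMonoidHom u)
    have hab : ∀ l, ((a ≫ (W i).ι).appLE (W i) ⊤ (a.preimage_mono (hle i))).hom (y i l) =
        (Units.map ((a ≫ (W i).ι).appLE _ ⊤ hle').hom.toMonoidHom u) *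
          ((b ≫ (W i').ι).appLE (W i') ⊤ (b.preimage_mono (hle i'))).hom (y i' l) := fun l => by
      have h2 := congrArg ((a ≫ (W i).ι).appLE _ ⊤ hle').hom (hu l)
      rw [map_mul, appLE_resSec, appLE_resSec] at h2
      refine h2.trans (congrArg (_ * ·) ?_)
      congr 3
    have ha' := (congrArg (IsGivenBy (a ≫ j i) ⊤) (funext hab)).mp ha
    have h3 := ha'.unique hb' (by
      rw [Category.assoc, Category.assoc, hjq, hjq, reassoc_of% hc])
    have h4 := congrArg ((Scheme.topIso P).inv ≫ ·) h3
    rwa [← Scheme.topIso_hom, Iso.inv_hom_id_assoc, Iso.inv_hom_id_assoc] at h4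
  let 𝒰 := X.openCoverOfIsOpenCover W hW
  let J : X ⟶ PSpace k N := 𝒰.glueMorphisms j fun i i' => hglue _ i i' _ _ pullback.condition
  have hJ : ∀ i, (W i).ι ≫ J = j i := fun i => 𝒰.ι_glueMorphisms _ _ i
  have hJq : ∀ i, (W i).ι ≫ J ≫ PSpace.toSpec k N = (W i).ι ≫ q := fun i => by
    rw [← Category.assoc, hJ, hjq]
  refine ⟨J, 𝒰.hom_ext _ _ hJq, fun i => IsGivenBy.of_ι ?_⟩
  · rw [hJ]
    exact hj i

end RopeEmbedding

end

noncomputable section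

namespace RopeEmbedding

/-! ### Twisting sheaves are free of rank one where a linear form does not vanish. -/

section TwistGenerator

variable {A : Type u} {σ : Type*} [CommRing A] [SetLike σ A] [AddSubgroupClass σ A]
variable {𝒜 : ℕ → σ} [GradedRing 𝒜]

/-- The value of a section of a twisting sheaf at a point. -/
def twistVal {d : ℤ} {V : (Proj 𝒜).Opens} (x : Proj 𝒜) (hx : x ∈ V) (s : Γ(twist 𝒜 d, V)) :
    LocRing 𝒜 (toSpectrum 𝒜 x) :=
  (show twistedSections 𝒜 d V from s).1 ⟨x, hx⟩

theorem twist_ext {d : ℤ} {V : (Proj 𝒜).Opens} {s t : Γ(twist 𝒜 d, V)}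
    (h : ∀ x hx, twistVal x hx s = twistVal x hx t) : s = t :=
  Subtype.ext (funext fun x => h x.1 x.2)

theorem twistVal_smul {d : ℤ} {V : (Proj 𝒜).Opens} (x : Proj 𝒜) (hx : x ∈ V)
    (r : Γ(Proj 𝒜, V)) (s : Γ(twist 𝒜 d, V)) :
    twistVal x hx (r • s) = secVal 𝒜 x hx r * twistVal x hx s := rfl

/-- The value `f ^ d` at a point where `f` does not vanish. -/
def zpowAt (f : A) (d : ℤ) (x : Proj 𝒜) (hx : x ∈ Proj.basicOpen 𝒜 f) :
    LocRing 𝒜 (toSpectrum 𝒜 x) :=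
  Localization.mk (f ^ d.toNat) ⟨f ^ (-d).toNat, pow_mem (mem_primeComplAt hx) _⟩

theorem zpowAt_mul_zpowAt_neg (f : A) (d : ℤ) (x : Proj 𝒜) (hx : x ∈ Proj.basicOpen 𝒜 f) :
    zpowAt f d x hx * zpowAt f (-d) x hx = 1 := by
  rw [zpowAt, zpowAt, Localization.mk_mul]
  simp only [neg_neg]
  refine (congrArg (Localization.mk _) (Subtype.ext ?_)).trans
    (Localization.mk_self (⟨f ^ d.toNat * f ^ (-d).toNat,
      mul_mem (pow_mem (mem_primeComplAt hx) _) (pow_mem (mem_primeComplAt hx) _)⟩ :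
      primeComplAt 𝒜 (toSpectrum 𝒜 x)))
  exact mul_comm _ _

/-- The section `f ^ d` of the twisting sheaf of degree `d`, where `f` is a linear form that does
not vanish on `V`. -/
def twistGen (f : A) (hf : f ∈ 𝒜 1) (d : ℤ) (V : (Proj 𝒜).Opens) (hV : V ≤ Proj.basicOpen 𝒜 f) :
    Γ(twist 𝒜 d, V) :=
  show twistedSections 𝒜 d V from ⟨fun x => zpowAt f d x.1 (hV x.2), fun x =>
    ⟨V, x.2, 𝟙 _, d.toNat, (-d).toNat, f ^ d.toNat, f ^ (-d).toNat,
      by simpa using SetLike.pow_mem_graded d.toNat hf,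
      by simpa using SetLike.pow_mem_graded (-d).toNat hf, by omega,
      fun y => ⟨pow_mem (mem_primeComplAt (hV y.2)) _, rfl⟩⟩⟩

theorem twistVal_twistGen (f : A) (hf : f ∈ 𝒜 1) (d : ℤ) (V : (Proj 𝒜).Opens)
    (hV : V ≤ Proj.basicOpen 𝒜 f) (x : Proj 𝒜) (hx : x ∈ V) :
    twistVal x hx (twistGen f hf d V hV) = zpowAt f d x (hV hx) := rfl

/-- The product of `s` with `f ^ (-d)` is locally a fraction of degree 0, hence a regular function.
-/
theorem exists_smul_twistGen (f : A) (hf : f ∈ 𝒜 1) (d : ℤ) (V : (Proj 𝒜).Opens)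
    (hV : V ≤ Proj.basicOpen 𝒜 f) (s : Γ(twist 𝒜 d, V)) :
    ∃ r : Γ(Proj 𝒜, V), s = r • twistGen f hf d V hV := by
  have hs : (twistedLocal 𝒜 d).pred (show twistedSections 𝒜 d V from s).1 :=
    (show twistedSections 𝒜 d V from s).2
  have hloc : ∀ x : V, ∃ (W : (Proj 𝒜).Opens) (_ : x.1 ∈ W) (hW : W ≤ V) (n : ℕ) (a b : A)
      (_ : a ∈ 𝒜 n) (_ : b ∈ 𝒜 n), ∀ (y : Proj 𝒜) (hy : y ∈ W),
        ∃ hy' : b ∈ primeComplAt 𝒜 (toSpectrum 𝒜 y),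
        twistVal (V := V) y (hW hy) s * zpowAt f (-d) y (hV (hW hy)) =
          Localization.mk a ⟨b, hy'⟩ := by
    intro x
    obtain ⟨W, hxW, h, i, j, r, t, hr, ht, hij, h'⟩ := hs x
    refine ⟨W, hxW, h.le, i + (-d).toNat, r * f ^ (-d).toNat, t * f ^ d.toNat,
      SetLike.mul_mem_graded hr (by simpa using SetLike.pow_mem_graded (-d).toNat hf), ?_,
      fun y hy => ?_⟩
    · rw [show i + (-d).toNat = j + d.toNat by omega]
      exact SetLike.mul_mem_graded ht (by simpa using SetLike.pow_mem_graded d.toNat hf)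
    · obtain ⟨hty, e⟩ := h' ⟨y, hy⟩
      have e' : twistVal (V := V) y (h.le hy) s = Localization.mk r ⟨t, hty⟩ := e
      refine ⟨mul_mem hty (pow_mem (mem_primeComplAt (hV (h.le hy))) _), ?_⟩
      rw [e', zpowAt]
      refine (Localization.mk_mul _ _ _ _).trans (congrArg (Localization.mk _) (Subtype.ext ?_))
      change t * f ^ (- -d).toNat = t * f ^ d.toNat
      rw [neg_neg]
  have hval : ∀ x : V, ∃ z : HomogeneousLocalization.AtPrime 𝒜
      (toSpectrum 𝒜 x.1).asHomogeneousIdeal.toIdeal,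
      z.val = twistVal (V := V) x.1 x.2 s * zpowAt f (-d) x.1 (hV x.2) := fun x => by
    obtain ⟨W, hxW, hW, n, a, b, ha, hb, h⟩ := hloc x
    obtain ⟨hb', h'⟩ := h x.1 hxW
    exact ⟨HomogeneousLocalization.mk ⟨n, ⟨a, ha⟩, ⟨b, hb⟩, hb'⟩, h'.symm⟩
  choose z hz using hval
  let r : Γ(Proj 𝒜, V) := ⟨z, fun x => by
    obtain ⟨W, hxW, hW, n, a, b, ha, hb, h⟩ := hloc x
    refine ⟨W, hxW, homOfLE hW, n, ⟨a, ha⟩, ⟨b, hb⟩, fun y => (h y.1 y.2).choose, fun y => ?_⟩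
    exact HomogeneousLocalization.val_injective _
      ((hz ⟨y.1, hW y.2⟩).trans (h y.1 y.2).choose_spec)⟩
  refine ⟨r, twist_ext fun x hx => ?_⟩
  have hr : secVal 𝒜 x hx r = twistVal (V := V) x hx s * zpowAt f (-d) x (hV hx) := hz ⟨x, hx⟩
  rw [twistVal_smul, twistVal_twistGen, hr, mul_assoc, mul_comm (zpowAt f (-d) x _),
    zpowAt_mul_zpowAt_neg, mul_one]

theorem twistGen_eq_smul {f g : A} (hf : f ∈ 𝒜 1) (hg : g ∈ 𝒜 1) (d : ℤ) (V : (Proj 𝒜).Opens)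
    (hV : V ≤ Proj.basicOpen 𝒜 f) (hV' : V ≤ Proj.basicOpen 𝒜 g) :
    twistGen g hg d V hV' =
      (frac g f hg hf hV ^ d.toNat * frac f g hf hg hV' ^ (-d).toNat) • twistGen f hf d V hV := by
  refine twist_ext fun x hx => ?_
  rw [twistVal_smul, twistVal_twistGen, twistVal_twistGen, map_mul, map_pow, map_pow, secVal_frac,
    secVal_frac, zpowAt, zpowAt, Localization.mk_pow, Localization.mk_pow, Localization.mk_mul,
    Localization.mk_mul, Localization.mk_eq_mk_iff, Localization.r_iff_exists]
  refine ⟨1, ?_⟩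
  simp
  ring

end TwistGenerator

end RopeEmbedding

end

noncomputable section

namespace RopeEmbedding

/-! ### Gluing sections, and lifting functions through a closed immersion. -/

section Gluing

variable {X : Scheme.{u}}

theorem section_ext_of_le_sup {U U₁ U₂ : X.Opens} (h₁ : U₁ ≤ U) (h₂ : U₂ ≤ U) (hU : U ≤ U₁ ⊔ U₂)
    {s t : Γ(X, U)} (e₁ : resSec h₁ s = resSec h₁ t) (e₂ : resSec h₂ s = resSec h₂ t) : s = t :=
  X.sheaf.eq_of_locally_eq₂ (homOfLE h₁) (homOfLE h₂) hU s t e₁ e₂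

theorem exists_glue {U U₁ U₂ : X.Opens} (hU : U ≤ U₁ ⊔ U₂) (h₁ : U₁ ≤ U) (h₂ : U₂ ≤ U)
    (s₁ : Γ(X, U₁)) (s₂ : Γ(X, U₂))
    (h : resSec (inf_le_left : U₁ ⊓ U₂ ≤ U₁) s₁ = resSec (inf_le_right : U₁ ⊓ U₂ ≤ U₂) s₂) :
    ∃ s : Γ(X, U), resSec h₁ s = s₁ ∧ resSec h₂ s = s₂ := by
  obtain rfl : U = U₁ ⊔ U₂ := le_antisymm hU (sup_le h₁ h₂)
  refine ⟨(X.sheaf.objSupIsoProdEqLocus U₁ U₂).inv ⟨(s₁, s₂), h⟩, ?_, ?_⟩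
  · exact X.sheaf.objSupIsoProdEqLocus_inv_fst U₁ U₂ _
  · exact X.sheaf.objSupIsoProdEqLocus_inv_snd U₁ U₂ _

/-- The vanishing of the first Čech cohomology of the structure sheaf for a covering of an affine
open set by two basic open sets. -/
theorem exists_eq_res_sub_res {V V₁ V₂ V₁₂ : X.Opens} (hV : IsAffineOpen V) (a b : Γ(X, V))
    (hab : IsCoprime a b) (h₁ : V₁ = X.basicOpen a) (h₂ : V₂ = X.basicOpen b)
    (h₁₂ : V₁₂ = V₁ ⊓ V₂) (hl : V₁₂ ≤ V₁) (hr : V₁₂ ≤ V₂) (z : Γ(X, V₁₂)) :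
    ∃ (z₁ : Γ(X, V₁)) (z₂ : Γ(X, V₂)), z = resSec hl z₁ - resSec hr z₂ := by
  obtain rfl : V₁₂ = X.basicOpen (a * b) := by rw [h₁₂, h₁, h₂, Scheme.basicOpen_mul]
  subst h₁ h₂
  obtain ⟨n, w, hw⟩ := exists_eq_pow_mul_of_isAffineOpen X V hV (a * b) z
  have hw' : resSec (X.basicOpen_le _) w = resSec (X.basicOpen_le _) (a * b) ^ n * z := hw
  -- With `w = (a * b) ^ n * z` and `p * a ^ n + q * b ^ n = 1`, one has `z = q * w / a ^ n + p * w
  -- / b ^ n`.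
  obtain ⟨p, q, hpq⟩ := hab.pow (m := n) (n := n)
  have ha : IsUnit (resSec (X.basicOpen_le a) a) := RingedSpace.isUnit_res_basicOpen _ _
  have hb : IsUnit (resSec (X.basicOpen_le b) b) := RingedSpace.isUnit_res_basicOpen _ _
  have hz : IsUnit (resSec (X.basicOpen_le (a * b)) (a * b)) := RingedSpace.isUnit_res_basicOpen _ _
  obtain ⟨a', ha'⟩ := (ha.pow n).exists_left_inv
  obtain ⟨b', hb'⟩ := (hb.pow n).exists_left_inv
  refine ⟨resSec (X.basicOpen_le a) (q * w) * a', - (resSec (X.basicOpen_le b) (p * w) * b'),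
    (hz.pow n).mul_left_cancel ?_⟩
  have ha'' := congrArg (resSec hl) ha'
  have hb'' := congrArg (resSec hr) hb'
  have hpq' := congrArg (resSec (X.basicOpen_le (a * b))) hpq
  rw [← hw']
  simp only [map_mul, map_pow, map_add, map_one, resSec_resSec, map_neg] at ha'' hb'' hpq' ⊢
  linear_combination (-(resSec (X.basicOpen_le (a * b)) w)) * hpq' -
    resSec (X.basicOpen_le (a * b)) q * resSec (X.basicOpen_le (a * b)) w * resSec (X.basicOpen_le (a * b)) b ^ n * ha'' -
    resSec (X.basicOpen_le (a * b)) p * resSec (X.basicOpen_le (a * b)) w * resSec (X.basicOpen_le (a * b)) a ^ n * hb''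

end Gluing

section Lifting

variable {P X : Scheme.{u}}

/-- A frame over `W` of the kernel of `𝒪_X → f_* 𝒪_P`, as a module over `f_* 𝒪_P`: two generators,
given by the maps `r ↦ r • e_i`. -/
structure KernelFrame (f : P ⟶ X) (W : X.Opens) where
  gen (i : Fin 2) (U : X.Opens) (hU : U ≤ W) : Γ(P, f ⁻¹ᵁ U) →+ Γ(X, U)
  mul_gen (i U hU s r) : s * gen i U hU r = gen i U hU ((f.app U).hom s * r)
  res_gen (i U hU U') (h : U' ≤ U) (r) :
    resSec h (gen i U hU r) = gen i U' (h.trans hU) (resSec (f.preimage_mono h) r)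
  app_eq_zero_iff (U) (hU : U ≤ W) (s : Γ(X, U)) :
    (f.app U).hom s = 0 ↔ ∃ r : Fin 2 → Γ(P, f ⁻¹ᵁ U), s = ∑ i, gen i U hU (r i)

theorem resSec_app (f : P ⟶ X) {U U' : X.Opens} (h : U' ≤ U) (s : Γ(X, U)) :
    (f.app U').hom (resSec h s) = resSec (f.preimage_mono h) ((f.app U).hom s) := by
  simp only [← Scheme.Hom.appLE_eq_app]
  rw [appLE_resSec, resSec_appLE]

namespace KernelFrame

variable {f : P ⟶ X} {W : X.Opens}

/-- Two local lifts differ on the overlap by a combination of the generators, whose coefficients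
live on an affine part of `P`. Splitting the coefficients by `exists_eq_res_sub_res` corrects the
lifts so that they glue. -/
theorem exists_lift_of_sup (F : KernelFrame f W) {U U₁ U₂ : X.Opens} (hU : U ≤ W) (h₁ : U₁ ≤ U)
    (h₂ : U₂ ≤ U) (hsup : U ≤ U₁ ⊔ U₂) (haff : IsAffineOpen (f ⁻¹ᵁ U)) (a b : Γ(P, f ⁻¹ᵁ U))
    (hab : IsCoprime a b) (ha : f ⁻¹ᵁ U₁ = P.basicOpen a) (hb : f ⁻¹ᵁ U₂ = P.basicOpen b)
    (r : Γ(P, f ⁻¹ᵁ U))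
    (hr₁ : ∃ s, (f.app U₁).hom s = resSec (f.preimage_mono h₁) r)
    (hr₂ : ∃ s, (f.app U₂).hom s = resSec (f.preimage_mono h₂) r) :
    ∃ s, (f.app U).hom s = r := by
  obtain ⟨s₁, hs₁⟩ := hr₁
  obtain ⟨s₂, hs₂⟩ := hr₂
  have hz : (f.app (U₁ ⊓ U₂)).hom (resSec inf_le_left s₁ - resSec inf_le_right s₂) = 0 := by
    rw [map_sub, resSec_app, resSec_app, hs₁, hs₂, resSec_resSec, resSec_resSec, sub_self]
  obtain ⟨z, hz⟩ := (F.app_eq_zero_iff _ (inf_le_left.trans (h₁.trans hU)) _).mp hz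
  have hsplit := fun i => exists_eq_res_sub_res haff a b hab ha hb f.preimage_inf
    (f.preimage_mono inf_le_left) (f.preimage_mono inf_le_right) (z i)
  choose z₁ z₂ hz₁₂ using hsplit
  obtain ⟨s, e₁, e₂⟩ := exists_glue hsup h₁ h₂ (s₁ - ∑ i, F.gen i U₁ (h₁.trans hU) (z₁ i))
    (s₂ - ∑ i, F.gen i U₂ (h₂.trans hU) (z₂ i)) (by
      simp only [map_sub, map_sum, F.res_gen]
      simp only [hz₁₂, map_sub, Finset.sum_sub_distrib] at hz
      linear_combination hz)
  refine ⟨s, section_ext_of_le_sup (f.preimage_mono h₁) (f.preimage_mono h₂)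
    (f.preimage_mono hsup) ?_ ?_⟩
  · rw [← resSec_app f h₁, e₁, map_sub, hs₁, (F.app_eq_zero_iff _ (h₁.trans hU) _).mpr ⟨z₁, rfl⟩, sub_zero]
  · rw [← resSec_app f h₂, e₂, map_sub, hs₂, (F.app_eq_zero_iff _ (h₂.trans hU) _).mpr ⟨z₂, rfl⟩, sub_zero]

/-- The functions `a` such that `r` lifts over every open set inside `D(a)` form an ideal: `a` and
`b` are coprime on `D(a + b)`, so `exists_lift_of_sup` applies. Surjectivity on stalks shows that
this ideal has no common zero. Only the preimage of `U`, not `U` itself, is assumed affine. -/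
theorem app_surjective (F : KernelFrame f W) [IsClosedImmersion f] (hf : Function.Surjective f)
    {U : X.Opens} (hU : U ≤ W) (haff : IsAffineOpen (f ⁻¹ᵁ U)) :
    Function.Surjective (f.app U).hom := by
  have hex : ∀ V : P.Opens, ∃ U' : X.Opens, f ⁻¹ᵁ U' = V := fun V => by
    obtain ⟨T, hT, hTV⟩ := f.isClosedEmbedding.isInducing.isOpen_iff.mp V.2
    exact ⟨⟨T, hT⟩, Opens.ext hTV⟩
  have hmono : ∀ {U₁ U₂ : X.Opens}, f ⁻¹ᵁ U₁ ≤ f ⁻¹ᵁ U₂ → U₁ ≤ U₂ := fun {U₁ U₂} h x hx => by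
    obtain ⟨y, rfl⟩ := hf x
    exact h hx
  intro r
  let J : Ideal Γ(P, f ⁻¹ᵁ U) :=
    { carrier := {a | ∀ (U' : X.Opens) (h : U' ≤ U), f ⁻¹ᵁ U' ≤ P.basicOpen a →
        ∃ s, (f.app U').hom s = resSec (f.preimage_mono h) r}
      zero_mem' := fun U' h hle => by
        rw [Scheme.basicOpen_zero, le_bot_iff] at hle
        have : Subsingleton Γ(P, f ⁻¹ᵁ U') := by
          rw [hle]
          infer_instance
        exact ⟨0, Subsingleton.elim _ _⟩
      smul_mem' := fun c a ha U' h hle => ha U' h (hle.trans (by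
        rw [smul_eq_mul, Scheme.basicOpen_mul]
        exact inf_le_right))
      add_mem' := fun {a b} ha hb U' h hle => by
        obtain ⟨U'', hU''⟩ := hex (P.basicOpen (a + b))
        have hUU : U'' ≤ U := hmono (hU''.le.trans (P.basicOpen_le _))
        have hU'U'' : U' ≤ U'' := hmono (hle.trans hU''.ge)
        obtain ⟨U₁, hU₁⟩ := hex (P.basicOpen (resSec (f.preimage_mono hUU) a))
        obtain ⟨U₂, hU₂⟩ := hex (P.basicOpen (resSec (f.preimage_mono hUU) b))
        have h₁ : U₁ ≤ U'' := hmono (hU₁.le.trans (P.basicOpen_le _))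
        have h₂ : U₂ ≤ U'' := hmono (hU₂.le.trans (P.basicOpen_le _))
        have hunit : IsUnit (resSec (f.preimage_mono hUU) (a + b)) := by
          rw [← resSec_resSec (P.basicOpen_le (a + b)) hU''.le]
          exact IsUnit.map _ (RingedSpace.isUnit_res_basicOpen _ _)
        have hcop : IsCoprime (resSec (f.preimage_mono hUU) a) (resSec (f.preimage_mono hUU) b) := by
          obtain ⟨c, hc⟩ := hunit.exists_left_inv
          exact ⟨c, c, by rw [← mul_add, ← map_add, hc]⟩
        have hsup : U'' ≤ U₁ ⊔ U₂ := by
          refine hmono ?_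
          rw [Scheme.Hom.preimage_sup, hU₁, hU₂]
          refine le_trans ?_ (Scheme.basicOpen_add_le _ _ _)
          rw [← map_add, Scheme.basicOpen_of_isUnit _ hunit]
        obtain ⟨s, hs⟩ := F.exists_lift_of_sup (hUU.trans hU) h₁ h₂ hsup (hU'' ▸ haff.basicOpen _)
          _ _ hcop hU₁ hU₂ (resSec (f.preimage_mono hUU) r)
          (by
            rw [resSec_resSec]
            refine ha U₁ (h₁.trans hUU) (hU₁.le.trans ?_)
            rw [resSec_mem_basicOpen]
            exact inf_le_right)
          (by
            rw [resSec_resSec]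
            refine hb U₂ (h₂.trans hUU) (hU₂.le.trans ?_)
            rw [resSec_mem_basicOpen]
            exact inf_le_right)
        exact ⟨resSec hU'U'' s, by rw [resSec_app, hs, resSec_resSec]⟩ }
  have hJ : J = ⊤ := by
    rw [← Ideal.span_eq J, ← haff.self_le_iSup_basicOpen_iff]
    intro x hx
    obtain ⟨σ, hσ⟩ := f.stalkMap_surjective x (P.presheaf.germ _ x hx r)
    obtain ⟨U₀, hxU₀, s₀, rfl⟩ := X.presheaf.exists_germ_eq σ
    rw [Scheme.Hom.germ_stalkMap_apply] at hσ
    obtain ⟨V, hxV, i₁, i₂, hV⟩ := P.presheaf.germ_eq x _ _ _ _ hσ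
    obtain ⟨a, haV, hxa⟩ := haff.exists_basicOpen_le ⟨x, hxV⟩ hx
    refine Opens.mem_iSup.mpr ⟨⟨a, fun U' h hle => ?_⟩, hxa⟩
    have hV' : resSec i₁.le ((f.app U₀).hom s₀) = resSec i₂.le r := hV
    have h' := congrArg (resSec (hle.trans haV)) hV'
    rw [resSec_resSec, resSec_resSec] at h'
    exact ⟨resSec (hmono (hle.trans (haV.trans i₁.le))) s₀, (resSec_app _ _ _).trans h'⟩
  obtain ⟨s, hs⟩ := hJ.ge (Submodule.mem_top (x := (1 : Γ(P, f ⁻¹ᵁ U)))) U le_rfl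
    (by rw [Scheme.basicOpen_of_isUnit _ isUnit_one])
  exact ⟨s, by rw [hs, resSec_self]⟩

end KernelFrame

end Lifting

end RopeEmbedding

end

noncomputable section

namespace RopeEmbedding

/-! ### Topology of a rope and generators of its ideal sheaf. -/

namespace Rope

section

variable {k : Type u} [Field k] {P : Scheme.{u}} {p : P ⟶ Spec (CommRingCat.of k)} {E : P.Modules}
  (Y : Rope p E)

/-- On the complement of the image the section 1 pulls back to 0, so `1 * 1 = 0` there and the
complement is empty. -/
theorem incl_surjective : Function.Surjective Y.incl := by
  have := Y.isClosedImmersion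
  intro y
  by_contra hy
  let U : Y.total.Opens := ⟨(Set.range Y.incl)ᶜ, Y.incl.isClosedEmbedding.isClosed_range.isOpen_compl⟩
  have hU : Y.incl ⁻¹ᵁ U = ⊥ := Opens.ext (Set.eq_empty_of_forall_notMem fun x hx => hx ⟨x, rfl⟩)
  have hs : Subsingleton Γ(P, Y.incl ⁻¹ᵁ U) := by
    rw [hU]
    infer_instance
  have h1 := Y.sq_zero U 1 1 (Subsingleton.elim _ _) (Subsingleton.elim _ _)
  rw [mul_one] at h1
  have h2 : y ∈ Y.total.basicOpen (1 : Γ(Y.total, U)) := by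
    rw [Scheme.basicOpen_of_isUnit _ isUnit_one]
    exact hy
  rw [h1, Scheme.basicOpen_zero] at h2
  exact h2

theorem exists_preimage_eq (V : P.Opens) : ∃ U : Y.total.Opens, Y.incl ⁻¹ᵁ U = V := by
  have := Y.isClosedImmersion
  obtain ⟨T, hT, hTV⟩ := Y.incl.isClosedEmbedding.isInducing.isOpen_iff.mp V.2
  exact ⟨⟨T, hT⟩, Opens.ext hTV⟩

/-- The embedding of the conormal bundle into the structure sheaf, on sections. -/
def conormalMap (U : Y.total.Opens) : Γ(E, Y.incl ⁻¹ᵁ U) →+ Γ(Y.total, U) :=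
  (Y.conormal.choose.app U).hom

theorem conormalMap_smul (U : Y.total.Opens) (s : Γ(Y.total, U)) (m : Γ(E, Y.incl ⁻¹ᵁ U)) :
    Y.conormalMap U ((Y.incl.app U).hom s • m) = s * Y.conormalMap U m :=
  Y.conormal.choose.app_smul s (show Γ((Scheme.Modules.pushforward Y.incl).obj E, U) from m)

theorem resSec_conormalMap {U U' : Y.total.Opens} (h : U' ≤ U) (m : Γ(E, Y.incl ⁻¹ᵁ U)) :
    resSec h (Y.conormalMap U m) = Y.conormalMap U'
      ((E.presheaf.map (homOfLE (Y.incl.preimage_mono h)).op).hom m) :=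
  (ConcreteCategory.congr_hom (Y.conormal.choose.mapPresheaf.naturality (homOfLE h).op) m).symm

theorem app_eq_zero_iff (U : Y.total.Opens) (s : Γ(Y.total, U)) :
    (Y.incl.app U).hom s = 0 ↔ ∃ m, s = Y.conormalMap U m :=
  ((Y.conormal.choose_spec U).2 s).trans (exists_congr fun _ => eq_comm)

end

section Frame

variable {k : Type u} [Field k] {A : Type u} {σ : Type*} [CommRing A] [SetLike σ A]
  [AddSubgroupClass σ A] {𝒜 : ℕ → σ} [GradedRing 𝒜] {p : Proj 𝒜 ⟶ Spec (CommRingCat.of k)}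
  {E : (Proj 𝒜).Modules} (Y : Rope p E) {d : Fin 2 → ℤ} (inj : ∀ i, twist 𝒜 (d i) ⟶ E)
  (hinj : ∀ (V : (Proj 𝒜).Opens) (m : Γ(E, V)), ∃ t : ∀ i, Γ(twist 𝒜 (d i), V),
    m = ∑ i, (inj i).app V (t i))

/-- The frame of the ideal sheaf of a rope whose conormal bundle is a sum of two twisting sheaves,
given by a linear form that does not vanish on the open set. -/
def frame (f : A) (hf : f ∈ 𝒜 1) (W : Y.total.Opens) (hW : Y.incl ⁻¹ᵁ W ≤ Proj.basicOpen 𝒜 f) :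
    KernelFrame Y.incl W where
  gen i U hU :=
    { toFun := fun r => Y.conormalMap U (((inj i).app _).hom
        (r • twistGen f hf (d i) (Y.incl ⁻¹ᵁ U) ((Y.incl.preimage_mono hU).trans hW)))
      map_zero' := by rw [zero_smul, map_zero, map_zero]
      map_add' := fun r s => by rw [add_smul, map_add, map_add] }
  mul_gen i U hU s r := by
    refine (Y.conormalMap_smul U s _).symm.trans (congrArg (Y.conormalMap U) ?_)
    refine ((inj i).app_smul ((Y.incl.app U).hom s) _).symm.trans ?_
    exact congrArg ((inj i).app _).hom (mul_smul _ _ _).symm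
  res_gen i U hU U' h r := by
    refine (Y.resSec_conormalMap h _).trans (congrArg (Y.conormalMap U') ?_)
    refine (ConcreteCategory.congr_hom ((inj i).mapPresheaf.naturality
      (homOfLE (Y.incl.preimage_mono h)).op) _).symm.trans ?_
    refine congrArg ((inj i).app _).hom ?_
    exact Scheme.Modules.map_smul _ (homOfLE (Y.incl.preimage_mono h)) r _
  app_eq_zero_iff U hU s := by
    rw [Y.app_eq_zero_iff U s]
    constructor
    · rintro ⟨m, rfl⟩
      obtain ⟨t, rfl⟩ := hinj _ m
      choose r hr using fun i => exists_smul_twistGen f hf (d i) (Y.incl ⁻¹ᵁ U)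
        ((Y.incl.preimage_mono hU).trans hW) (t i)
      refine ⟨r, ?_⟩
      rw [map_sum]
      exact Finset.sum_congr rfl fun i _ => by rw [hr i]; rfl
    · rintro ⟨r, rfl⟩
      exact ⟨∑ i, ((inj i).app _).hom (r i • twistGen f hf (d i) (Y.incl ⁻¹ᵁ U)
        ((Y.incl.preimage_mono hU).trans hW)), by rw [map_sum]; rfl⟩

theorem frame_gen_eq {f g : A} (hf : f ∈ 𝒜 1) (hg : g ∈ 𝒜 1) (W W' : Y.total.Opens)
    (hW : Y.incl ⁻¹ᵁ W ≤ Proj.basicOpen 𝒜 f) (hW' : Y.incl ⁻¹ᵁ W' ≤ Proj.basicOpen 𝒜 g)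
    (i : Fin 2) (U : Y.total.Opens) (hU : U ≤ W) (hU' : U ≤ W') (r : Γ(Proj 𝒜, Y.incl ⁻¹ᵁ U)) :
    (Y.frame inj hinj g hg W' hW').gen i U hU' r = (Y.frame inj hinj f hf W hW).gen i U hU
      (r * (frac g f hg hf ((Y.incl.preimage_mono hU).trans hW) ^ (d i).toNat *
        frac f g hf hg ((Y.incl.preimage_mono hU').trans hW') ^ (-(d i)).toNat)) := by
  change Y.conormalMap U (((inj i).app _).hom (r • _)) = Y.conormalMap U (((inj i).app _).hom (_ • _))
  rw [twistGen_eq_smul hf hg (d i) _ ((Y.incl.preimage_mono hU).trans hW)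
    ((Y.incl.preimage_mono hU').trans hW'), ← mul_smul]

end Frame

end Rope

/-- Of the direct sum only its generation by the two summands is used later. -/
theorem exists_inj_biprod {X : Scheme.{u}} (T : Fin 2 → X.Modules) :
    ∃ inj : ∀ i, T i ⟶ T 0 ⊞ T 1, ∀ (V : X.Opens) (m : Γ(T 0 ⊞ T 1, V)),
      ∃ t : ∀ i, Γ(T i, V), m = ∑ i, (inj i).app V (t i) := by
  refine ⟨fun i => match i with
    | 0 => biprod.inl
    | 1 => biprod.inr, fun V m => ⟨fun i => match i with
    | 0 => (biprod.fst : T 0 ⊞ T 1 ⟶ T 0).app V m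
    | 1 => (biprod.snd : T 0 ⊞ T 1 ⟶ T 1).app V m, ?_⟩⟩
  rw [Fin.sum_univ_two]
  have h := congrArg (fun φ => Scheme.Modules.Hom.app φ V) (biprod.total (X := T 0) (Y := T 1))
  exact (ConcreteCategory.congr_hom h m).symm

end RopeEmbedding

end

noncomputable section

namespace RopeEmbedding

section BasicOpen

variable {A : Type u} {σ : Type*} [CommRing A] [SetLike σ A] [AddSubgroupClass σ A]
variable {𝒜 : ℕ → σ} [GradedRing 𝒜]

theorem basicOpen_frac {V : (Proj 𝒜).Opens} {d : ℕ} (g s : A) (hg : g ∈ 𝒜 d) (hs : s ∈ 𝒜 d)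
    (hV : V ≤ Proj.basicOpen 𝒜 s) :
    (Proj 𝒜).basicOpen (frac g s hg hs hV) = V ⊓ Proj.basicOpen 𝒜 g := by
  apply le_antisymm
  · refine le_inf ((Proj 𝒜).basicOpen_le _) fun x hx hgx => ?_
    have hu : IsUnit (resSec ((Proj 𝒜).basicOpen_le _) (frac g s hg hs hV)) :=
      RingedSpace.isUnit_res_basicOpen _ _
    have h1 := hu.map (secVal 𝒜 x hx)
    have hxV : x ∈ V := (Proj 𝒜).basicOpen_le _ hx
    have h2 : secVal 𝒜 x hx (resSec ((Proj 𝒜).basicOpen_le _) (frac g s hg hs hV)) =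
      Localization.mk g ⟨s, mem_primeComplAt (hV hxV)⟩ := rfl
    rw [h2, Localization.mk_eq_mk'] at h1
    exact (IsLocalization.AtPrime.isUnit_mk'_iff _ (toSpectrum 𝒜 x).asHomogeneousIdeal.toIdeal
      g ⟨s, mem_primeComplAt (hV hxV)⟩).mp h1 hgx
  · have h : frac (V := V ⊓ Proj.basicOpen 𝒜 g) g s hg hs (inf_le_left.trans hV) *
        frac s g hs hg inf_le_right = 1 := by
      rw [frac_mul_frac_self, frac_self]
    have h2 : resSec inf_le_left (frac g s hg hs hV) =
      frac (V := V ⊓ Proj.basicOpen 𝒜 g) g s hg hs (inf_le_left.trans hV) := rfl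
    have h3 := Scheme.basicOpen_of_isUnit (Proj 𝒜) (IsUnit.of_mul_eq_one _ h)
    rw [← h2, resSec_mem_basicOpen] at h3
    exact h3.ge.trans inf_le_right

end BasicOpen

/-! ### Binary forms, their coefficients, and rational normal curves. -/

section BinaryForms

open MvPolynomial

variable {k : Type u} [Field k] {N : ℕ}

/-- The coefficients of a binary form of degree `N`. -/
def formCoeff (N : ℕ) (m : ℕ) : MvPolynomial (Fin (1 + 1)) k →ₗ[k] k :=
  lcoeff k (Finsupp.single 0 (N - m) + Finsupp.single 1 m)

/-- The monomial `X₀ ^ (N - m) * X₁ ^ m`. -/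
def binMonomial (k : Type u) [Field k] (N : ℕ) (m : ℕ) : MvPolynomial (Fin (1 + 1)) k :=
  X 0 ^ (N - m) * X 1 ^ m

theorem binMonomial_mem {m : ℕ} (hm : m ≤ N) : binMonomial k N m ∈ grading k 1 N := by
  have := ((isHomogeneous_X k (0 : Fin (1 + 1))).pow (N - m)).mul
    ((isHomogeneous_X k (1 : Fin (1 + 1))).pow m)
  rwa [one_mul, one_mul, Nat.sub_add_cancel hm] at this

theorem binMonomial_eq (m : ℕ) : binMonomial k N m =
    monomial (Finsupp.single 0 (N - m) + Finsupp.single 1 m) 1 := by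
  rw [binMonomial, X_pow_eq_monomial, X_pow_eq_monomial, monomial_mul, one_mul]

theorem exists_eq_single_add_single {s : Fin (1 + 1) →₀ ℕ} (hs : s.degree = N) :
    ∃ m ≤ N, s = Finsupp.single 0 (N - m) + Finsupp.single 1 m := by
  have h : s 0 + s 1 = N := by
    rw [← hs, Finsupp.degree_eq_sum, Fin.sum_univ_two]
  refine ⟨s 1, by omega, Finsupp.ext fun j => ?_⟩
  fin_cases j
  · simp [← h]
  · simp

theorem form_eq_sum {F : MvPolynomial (Fin (1 + 1)) k} (hF : F ∈ grading k 1 N) :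
    F = ∑ m ∈ Finset.range (N + 1), C (formCoeff N m F) * binMonomial k N m := by
  ext s
  rw [coeff_sum]
  simp only [binMonomial_eq, C_mul_monomial, mul_one, coeff_monomial]
  by_cases hs : s.degree = N
  · obtain ⟨m, hm, rfl⟩ := exists_eq_single_add_single hs
    rw [Finset.sum_eq_single m]
    · rw [if_pos rfl]
      rfl
    · intro m' hm' hne
      rw [if_neg]
      intro h
      exact hne (by simpa using congrArg (fun f => f 1) h)
    · intro h
      exact absurd (Finset.mem_range.mpr (by omega)) h
  · have hF' : F.IsHomogeneous N := hF
    rw [hF'.coeff_eq_zero hs, Finset.sum_eq_zero]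
    intro m hm
    rw [if_neg]
    rintro rfl
    have := Finset.mem_range.mp hm
    refine hs ?_
    rw [map_add, Finsupp.degree_single, Finsupp.degree_single]
    omega

theorem X_pow_mem (c : Fin (1 + 1)) : (X c ^ N : MvPolynomial _ k) ∈ grading k 1 N := by
  have := (isHomogeneous_X k c).pow N
  rwa [one_mul] at this

/-- The exponent of the local coordinate in the monomial `X₀ ^ (N - m) * X₁ ^ m` on the `c`-th
chart of the projective line. -/
def chartExp (N : ℕ) (c : Fin (1 + 1)) (m : ℕ) : ℕ := if c = 0 then m else N - m

/-- The local coordinate on the `c`-th chart of the projective line. -/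
def chartCoord (k : Type u) [Field k] (c : Fin (1 + 1)) (V : (PSpace k 1).Opens)
    (hV : V ≤ stdOpen k 1 c) : Γ(PSpace k 1, V) :=
  frac (X (Fin.rev c)) (X c) (X_mem_grading _) (X_mem_grading c) hV

theorem binMonomial_eq_pow_mul (c : Fin (1 + 1)) {m : ℕ} (hm : m ≤ N) :
    binMonomial k N m = X (Fin.rev c) ^ chartExp N c m * X c ^ (N - chartExp N c m) := by
  fin_cases c
  · exact mul_comm _ _
  · change X 0 ^ (N - m) * X 1 ^ m = X 0 ^ (N - m) * X 1 ^ (N - (N - m))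
    rw [Nat.sub_sub_self hm]

theorem chartExp_le (c : Fin (1 + 1)) {m : ℕ} (hm : m ≤ N) : chartExp N c m ≤ N := by
  unfold chartExp
  split <;> omega

theorem frac_form_eq_sum (c : Fin (1 + 1)) (V : (PSpace k 1).Opens) (hV : V ≤ stdOpen k 1 c)
    {F : MvPolynomial (Fin (1 + 1)) k} (hF : F ∈ grading k 1 N) :
    frac F (X c ^ N) hF (X_pow_mem c) (hV.trans (basicOpen_le_basicOpen_pow _ _)) =
      ∑ m ∈ Finset.range (N + 1), scal (PSpace.toSpec k 1) V (formCoeff N m F) *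
        chartCoord k c V hV ^ chartExp N c m := by
  refine sec_ext fun x hx => ?_
  have hval : ∀ m ∈ Finset.range (N + 1), secVal (grading k 1) x hx
      (scal (PSpace.toSpec k 1) V (formCoeff N m F) * chartCoord k c V hV ^ chartExp N c m) =
        algebraMap _ _ (C (formCoeff N m F) * binMonomial k N m) *
          Localization.mk 1 ⟨X c ^ N, pow_mem (mem_primeComplAt (hV hx)) N⟩ := fun m hm => by
    have hm' : m ≤ N := by
      have := Finset.mem_range.mp hm
      omega
    rw [map_mul, map_pow, secVal_scal, chartCoord, secVal_frac, Localization.mk_pow,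
      map_mul (algebraMap _ _), mul_assoc, ← Localization.mk_one_eq_algebraMap (binMonomial k N m),
      Localization.mk_mul, mul_one, one_mul, binMonomial_eq_pow_mul c hm']
    congr 1
    rw [Localization.mk_eq_mk_iff, Localization.r_iff_exists]
    refine ⟨1, ?_⟩
    have h : (X c ^ N : MvPolynomial (Fin (1 + 1)) k) =
        X c ^ chartExp N c m * X c ^ (N - chartExp N c m) := by
      rw [← pow_add, Nat.add_sub_cancel' (chartExp_le c hm')]
    simp only [OneMemClass.coe_one, one_mul, SubmonoidClass.coe_pow]
    rw [h]
    ring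
  rw [map_sum, Finset.sum_congr rfl hval, ← Finset.sum_mul, ← map_sum, ← form_eq_sum hF,
    secVal_frac, ← Localization.mk_one_eq_algebraMap, Localization.mk_mul, mul_one, one_mul]

end BinaryForms

end RopeEmbedding

end

noncomputable section

namespace RopeEmbedding

open MvPolynomial

variable {k : Type u} [Field k] {N : ℕ}

theorem frac_congr {A : Type u} {σ : Type*} [CommRing A] [SetLike σ A] [AddSubgroupClass σ A]
    {𝒜 : ℕ → σ} [GradedRing 𝒜] {V : (Proj 𝒜).Opens} {d : ℕ} {g g' : A} (h : g = g') (s : A)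
    (hg : g ∈ 𝒜 d) (hs : s ∈ 𝒜 d) (hV : V ≤ Proj.basicOpen 𝒜 s) :
    frac g s hg hs hV = frac g' s (h ▸ hg) hs hV := by
  subst h
  rfl

/-- `N + 1` independent binary forms of degree `N` have an invertible coefficient matrix. Its
inverse recovers the monomials from an arbitrary rational normal curve. -/
theorem exists_formCoeff_inverse {F : Fin (N + 1) → MvPolynomial (Fin (1 + 1)) k}
    (hF : ∀ l, F l ∈ grading k 1 N) (hli : LinearIndependent k F) :
    ∃ B : Matrix (Fin (N + 1)) (Fin (N + 1)) k, ∀ m m' : Fin (N + 1),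
      ∑ l, B m l * formCoeff N m' (F l) = if m = m' then 1 else 0 := by
  let M : Matrix (Fin (N + 1)) (Fin (N + 1)) k := fun l m => formCoeff N m (F l)
  let L : (Fin (N + 1) → k) →ₗ[k] MvPolynomial (Fin (1 + 1)) k :=
    Fintype.linearCombination k (fun m : Fin (N + 1) => binMonomial k N m)
  have hL : F = L ∘ M.row := funext fun l => by
    have h := form_eq_sum (hF l)
    rw [Finset.sum_range (fun m => C (formCoeff N m (F l)) * binMonomial k N m)] at h
    refine h.trans ?_
    simp only [L, Function.comp, Fintype.linearCombination_apply, C_mul']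
    rfl
  have hM : IsUnit M := by
    rw [← Matrix.linearIndependent_rows_iff_isUnit]
    exact LinearIndependent.of_comp L (hL ▸ hli)
  obtain ⟨B, hB⟩ := hM.exists_left_inv
  refine ⟨B, fun m m' => ?_⟩
  have := congrFun (congrFun hB m) m'
  rwa [Matrix.mul_apply, Matrix.one_apply] at this

theorem IsRationalNormalCurve.exists_isGivenBy {i : PSpace k 1 ⟶ PSpace k N}
    (hi : IsRationalNormalCurve i) :
    ∃ (F : Fin (N + 1) → MvPolynomial (Fin (1 + 1)) k) (hF : ∀ l, F l ∈ grading k 1 N),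
      LinearIndependent k F ∧ ∀ (c : Fin (1 + 1)) (V : (PSpace k 1).Opens)
        (hV : V ≤ stdOpen k 1 c), IsGivenBy i V (fun l => frac (F l) (X c ^ N) (hF l) (X_pow_mem c)
          (hV.trans (basicOpen_le_basicOpen_pow _ _))) := by
  obtain ⟨F, hF, hli, h⟩ := hi.forms
  refine ⟨F, hF, hli, fun c V hV => ⟨fun l => ?_, fun l m V' hV' hVV' => ?_⟩⟩
  · rw [basicOpen_frac, (h l).choose]
  · obtain ⟨h1, h2⟩ := h l
    have h3 := congrArg (resSec (hV'.trans h1.ge)) (h2 m)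
    rw [resSec_appLE] at h3
    refine (congrArg (· * _) h3).trans ?_
    exact frac_mul_frac_self (V := V') (F m) (F l) (X c ^ N) (hF m) (hF l) (X_pow_mem c)
      (hV'.trans h1.ge) ((hVV'.trans hV).trans (basicOpen_le_basicOpen_pow _ _))

theorem sup_stdOpen : (⊤ : (PSpace k 1).Opens) ≤ stdOpen k 1 0 ⊔ stdOpen k 1 1 := by
  rw [← iSup_basicOpen_X]
  refine iSup_le fun c => ?_
  fin_cases c
  · exact le_sup_left
  · exact le_sup_right

/-- A morphism that is given by a family of binary forms on both charts of the projective line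
satisfies the description of a rational normal curve by these forms. -/
theorem IsGivenBy.forms {i : PSpace k 1 ⟶ PSpace k N}
    {F : Fin (N + 1) → MvPolynomial (Fin (1 + 1)) k} (hF : ∀ l, F l ∈ grading k 1 N)
    (h : ∀ c, IsGivenBy i (stdOpen k 1 c) (fun l => frac (F l) (X c ^ N) (hF l) (X_pow_mem c)
      (basicOpen_le_basicOpen_pow _ _))) (l : Fin (N + 1)) :
    ∃ h : Proj.basicOpen (grading k 1) (F l) = i ⁻¹ᵁ stdOpen k N l, ∀ m,
      (i.appLE (stdOpen k N l) (Proj.basicOpen (grading k 1) (F l)) h.le).hom (coord k N l m) =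
        formRatio (F l) (F m) (hF l) (hF m) := by
  have h0 : ∀ c, stdOpen k 1 c ⊓ Proj.basicOpen (grading k 1) (F l) =
      stdOpen k 1 c ⊓ i ⁻¹ᵁ stdOpen k N l := fun c => by
    rw [← (h c).basicOpen_eq l, basicOpen_frac]
  have h1 : Proj.basicOpen (grading k 1) (F l) = i ⁻¹ᵁ stdOpen k N l := by
    rw [← top_inf_eq (Proj.basicOpen _ _), ← top_inf_eq (i ⁻¹ᵁ _), ← top_unique sup_stdOpen,
      inf_sup_right, inf_sup_right, h0, h0]
  refine ⟨h1, fun m => ?_⟩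
  have key : ∀ c, resSec (inf_le_right : stdOpen k 1 c ⊓ Proj.basicOpen (grading k 1) (F l) ≤ _)
      ((i.appLE (stdOpen k N l) (Proj.basicOpen (grading k 1) (F l)) h1.le).hom (coord k N l m)) =
      resSec inf_le_right (formRatio (F l) (F m) (hF l) (hF m)) := fun c => by
    have h2 := (h c).mul_eq l m (stdOpen k 1 c ⊓ Proj.basicOpen (grading k 1) (F l))
      (inf_le_right.trans h1.le) inf_le_left
    have h3 : resSec (inf_le_left : stdOpen k 1 c ⊓ Proj.basicOpen (grading k 1) (F l) ≤ _)
        (frac (F l) (X c ^ N) (hF l) (X_pow_mem c) (basicOpen_le_basicOpen_pow _ _)) *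
        frac (X c ^ N) (F l) (X_pow_mem c) (hF l) inf_le_right = 1 :=
      (frac_mul_frac_self (F l) (X c ^ N) (F l) (hF l) (X_pow_mem c) (hF l)
        (inf_le_left.trans (basicOpen_le_basicOpen_pow _ _)) inf_le_right).trans (frac_self _ _ _)
    refine (IsUnit.of_mul_eq_one _ h3).mul_right_cancel ?_
    rw [resSec_appLE]
    refine h2.trans ?_
    exact (frac_mul_frac_self (F m) (F l) (X c ^ N) (hF m) (hF l) (X_pow_mem c) inf_le_right
      (inf_le_left.trans (basicOpen_le_basicOpen_pow _ _))).symm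
  refine section_ext_of_le_sup inf_le_right inf_le_right ?_ (key 0) (key 1)
  rw [← inf_sup_right]
  exact le_inf (le_top.trans sup_stdOpen) le_rfl

theorem chartCoord_mul_chartCoord_rev {c : Fin (1 + 1)} {V : (PSpace k 1).Opens}
    (hV : V ≤ stdOpen k 1 c) (hV' : V ≤ stdOpen k 1 (Fin.rev c)) :
    chartCoord k c V hV * chartCoord k (Fin.rev c) V hV' = 1 := by
  have := frac_mul_frac_self (𝒜 := grading k 1) (X (Fin.rev c)) (X c) (X (Fin.rev c))
    (X_mem_grading _) (X_mem_grading c) (X_mem_grading _) hV hV'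
  rw [frac_self] at this
  refine Eq.trans ?_ this
  rw [chartCoord, chartCoord]
  simp only [Fin.rev_rev]

/-- The standard rational normal curve. -/
theorem exists_isRationalNormalCurve (hN : 0 < N) :
    ∃ i : PSpace k 1 ⟶ PSpace k N, IsRationalNormalCurve i := by
  have hF : ∀ l : Fin (N + 1), binMonomial k N l ∈ grading k 1 N := fun l =>
    binMonomial_mem (by omega)
  have hcov : ⨆ c, stdOpen k 1 c = ⊤ := iSup_basicOpen_X
  obtain ⟨i, hi, hgiven⟩ := exists_isGivenBy (PSpace.toSpec k 1) (fun c => stdOpen k 1 c) hcov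
    (fun c l => frac (binMonomial k N l) (X c ^ N) (hF l) (X_pow_mem c)
      (basicOpen_le_basicOpen_pow _ _)) (fun c => by
      obtain ⟨l, hl⟩ : ∃ l : Fin (N + 1), binMonomial k N l = X c ^ N := by
        fin_cases c
        · exact ⟨0, by simp [binMonomial]⟩
        · exact ⟨Fin.last N, by simp [binMonomial]⟩
      rw [Ideal.eq_top_iff_one]
      exact Ideal.subset_span ⟨l, frac_eq_one _ _ _ hl⟩) (fun c c' => by
      have h1 : ∀ c c' : Fin (1 + 1), frac (V := stdOpen k 1 c ⊓ stdOpen k 1 c') (X c' ^ N) (X c ^ N) (X_pow_mem c') (X_pow_mem c)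
        (inf_le_left.trans (basicOpen_le_basicOpen_pow _ _)) *
        frac (X c ^ N) (X c' ^ N) (X_pow_mem c) (X_pow_mem c')
        (inf_le_right.trans (basicOpen_le_basicOpen_pow _ _)) = 1 := fun c c' => by
        rw [frac_mul_frac_self, frac_self]
      refine ⟨⟨_, _, h1 c c', (mul_comm _ _).trans (h1 c c')⟩, fun l => ?_⟩
      refine Eq.trans ?_ (mul_comm _ _)
      exact (frac_mul_frac_self (binMonomial k N l) (X c' ^ N) (X c ^ N) (hF l) (X_pow_mem c')
        (X_pow_mem c) (inf_le_right.trans (basicOpen_le_basicOpen_pow _ _))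
        (inf_le_left.trans (basicOpen_le_basicOpen_pow _ _))).symm)
  have hforms := IsGivenBy.forms hF hgiven
  refine ⟨i, hi, ?_, fun l => binMonomial k N l, hF, ?_, hforms⟩
  · refine IsZariskiLocalAtTarget.of_iSup_eq_top (fun l => stdOpen k N l) iSup_basicOpen_X fun l => ?_
    obtain ⟨h1, h2⟩ := hforms l
    have haff : IsAffine (stdOpen k N l) := Proj.isAffineOpen_basicOpen _ _ (X_mem_grading l) one_pos
    have haff' : IsAffine (i ⁻¹ᵁ stdOpen k N l) :=
      h1 ▸ Proj.isAffineOpen_basicOpen (grading k 1) _ (hF l) hN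
    refine IsClosedImmersion.of_surjective_of_isAffine _ ?_
    have hsurj : Function.Surjective (i.appLE (stdOpen k N l) _ h1.le).hom := by
      rw [← RingHom.range_eq_top]
      refine subring_eq_top hN (binMonomial k N l) (hF l) _ (fun c => ?_) fun s hs => ?_
      · exact ⟨scal (PSpace.toSpec k N) _ c, by rw [appLE_scal, hi]⟩
      · obtain ⟨m, hm, rfl⟩ := exists_eq_single_add_single (monomial_mem_grading_iff.mp hs)
        exact ⟨coord k N l ⟨m, by omega⟩, (h2 ⟨m, by omega⟩).trans
          (frac_congr (binMonomial_eq m) _ _ _ _)⟩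
    have hsurj' : ∀ V (h : V = Proj.basicOpen (grading k 1) (binMonomial k N l))
        (hV : V ≤ i ⁻¹ᵁ stdOpen k N l), Function.Surjective (i.appLE (stdOpen k N l) V hV).hom := by
      rintro _ rfl hV
      exact hsurj
    rw [← Scheme.Hom.resLE_eq_morphismRestrict, Scheme.Hom.appTop, Scheme.Hom.resLE_app_top]
    exact (ConcreteCategory.bijective_of_isIso (i ⁻¹ᵁ stdOpen k N l).topIso.inv).2.comp
      ((hsurj' _ h1.symm le_rfl).comp
        (ConcreteCategory.bijective_of_isIso (stdOpen k N l).topIso.hom).2)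
  · have hinj : Function.Injective fun l : Fin (N + 1) =>
        (Finsupp.single 0 (N - l.1) + Finsupp.single 1 l.1 : Fin (1 + 1) →₀ ℕ) := fun l l' h =>
      Fin.ext (by simpa using congrArg (fun f => f 1) h)
    have := (basisMonomials (Fin (1 + 1)) k).linearIndependent.comp _ hinj
    have hfun : (fun l : Fin (N + 1) => binMonomial k N l) = basisMonomials (Fin (1 + 1)) k ∘
        fun l => Finsupp.single 0 (N - l.1) + Finsupp.single 1 l.1 := funext fun l => by
      rw [Function.comp, coe_basisMonomials, binMonomial_eq]
    rw [hfun]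
    exact this

end RopeEmbedding

end

noncomputable section

namespace RopeEmbedding

section Algebra

theorem LaurentPolynomial.map_eval₂ {R S T : Type*} [CommSemiring R] [CommSemiring S]
    [CommSemiring T] (π : S →+* T) (f : R →+* S) (x : Sˣ) (p : LaurentPolynomial R) :
    π (LaurentPolynomial.eval₂ f x p) =
      LaurentPolynomial.eval₂ (π.comp f) (Units.map (π : S →* T) x) p := by
  induction p using LaurentPolynomial.induction_on' with
  | add p q hp hq => rw [map_add, map_add, map_add, hp, hq]
  | C_mul_T n a =>
    rw [map_mul, map_mul, map_mul, LaurentPolynomial.eval₂_C, LaurentPolynomial.eval₂_C,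
      LaurentPolynomial.eval₂_T, LaurentPolynomial.eval₂_T, ← map_zpow]
    rfl

theorem Units.zpow_eq_pow_mul_pow {R : Type*} [CommRing R] (t : Rˣ) (d : ℤ) :
    ((t ^ d : Rˣ) : R) = (t : R) ^ d.toNat * ((t⁻¹ : Rˣ) : R) ^ (-d).toNat := by
  have h : d = (d.toNat : ℤ) - ((-d).toNat : ℤ) := by omega
  conv_lhs => rw [h]
  rw [zpow_sub, zpow_natCast, zpow_natCast, ← inv_pow]
  simp

end Algebra

/-! ### A rope as transition data between two charts. -/

section Overlap

open MvPolynomial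

variable {k : Type u} [Field k]

theorem stdOpen_inf_stdOpen : stdOpen k 1 0 ⊓ stdOpen k 1 1 =
    Proj.basicOpen (grading k 1) (X 0 * X 1) := (Proj.basicOpen_mul _ _ _).symm

theorem X_mul_X_mem : (X 0 * X 1 : MvPolynomial (Fin (1 + 1)) k) ∈ grading k 1 2 :=
  (isHomogeneous_X k 0).mul (isHomogeneous_X k 1)

/-- The functions on the intersection of the two charts of the projective line are the Laurent
polynomials in the coordinate. -/
theorem eval₂_chartCoord_surjective {V : (PSpace k 1).Opens}
    (hV : V = stdOpen k 1 0 ⊓ stdOpen k 1 1) (v : Γ(PSpace k 1, V)ˣ)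
    (hv : (v : Γ(PSpace k 1, V)) = chartCoord k 0 V (hV.le.trans inf_le_left)) :
    Function.Surjective (LaurentPolynomial.eval₂ (scal (PSpace.toSpec k 1) V) v) := by
  obtain rfl : V = Proj.basicOpen (grading k 1) (X 0 * X 1) := hV.trans stdOpen_inf_stdOpen
  rw [← RingHom.range_eq_top]
  have h0 := hV.le.trans inf_le_left
  have h1 := hV.le.trans inf_le_right
  have hinv : ((v⁻¹ : _ˣ) : Γ(PSpace k 1, _)) = chartCoord k 1 _ h1 := by
    refine Units.inv_eq_of_mul_eq_one_right ?_
    rw [hv]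
    exact chartCoord_mul_chartCoord_rev (c := 0) h0 h1
  have hmk : ∀ (g s : MvPolynomial (Fin (1 + 1)) k) (hg : g ∈ grading k 1 1) (hs : s ∈ grading k 1 1)
      (hs' : Proj.basicOpen (grading k 1) (X 0 * X 1) ≤ Proj.basicOpen _ s) (m : ℕ) (hm : m ≤ 2)
      (_ : binMonomial k 2 m * s = g * (X 0 * X 1)),
      frac (binMonomial k 2 m) (X 0 * X 1) (binMonomial_mem hm) X_mul_X_mem le_rfl =
        frac g s hg hs hs' := fun g s hg hs hs' m hm h => sec_ext fun x hx => by
    rw [secVal_frac, secVal_frac, Localization.mk_eq_mk_iff, Localization.r_iff_exists]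
    refine ⟨1, ?_⟩
    simp only [OneMemClass.coe_one, one_mul]
    rw [mul_comm s, h, mul_comm]
  refine subring_eq_top two_pos _ X_mul_X_mem _ (fun c => ?_) fun s hs => ?_
  · exact ⟨LaurentPolynomial.C c, LaurentPolynomial.eval₂_C _ _ _⟩
  · obtain ⟨m, hm, rfl⟩ := exists_eq_single_add_single (monomial_mem_grading_iff.mp hs)
    rw [frac_congr (binMonomial_eq m).symm _ _ _ _]
    -- Over `X 0 * X 1`, the three quadratic monomials are `t⁻¹`, 1 and t.
    interval_cases m
    · refine ⟨LaurentPolynomial.T (-1), ?_⟩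
      rw [LaurentPolynomial.eval₂_T, zpow_neg_one, hinv]
      exact (hmk (X 0) (X 1) (X_mem_grading 0) (X_mem_grading 1) h1 0 hm
        (by rw [binMonomial]; ring)).symm
    · refine ⟨1, ?_⟩
      rw [map_one]
      exact (frac_eq_one _ _ _ (by rw [binMonomial]; ring)).symm
    · refine ⟨LaurentPolynomial.T 1, ?_⟩
      rw [LaurentPolynomial.eval₂_T, zpow_one, hv]
      exact (hmk (X 1) (X 0) (X_mem_grading 1) (X_mem_grading 0) h0 2 hm
        (by rw [binMonomial]; ring)).symm

end Overlap

section Charts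

variable {k : Type u} [Field k] {E : (PSpace k 1).Modules}

theorem resSec_scal {X : Scheme.{u}} (q : X ⟶ Spec (CommRingCat.of k)) {U V : X.Opens} (h : V ≤ U)
    (c : k) : resSec h (scal q U c) = scal q V c := map_scal q h c

theorem KernelFrame.gen_app {P X : Scheme.{u}} {f : P ⟶ X} {W : X.Opens} (F : KernelFrame f W)
    (i : Fin 2) {U : X.Opens} (hU : U ≤ W) (s : Γ(X, U)) :
    F.gen i U hU ((f.app U).hom s) = s * resSec hU (F.gen i W le_rfl 1) := by
  rw [F.res_gen, map_one, F.mul_gen, mul_one]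

theorem KernelFrame.app_gen {P X : Scheme.{u}} {f : P ⟶ X} {W : X.Opens} (F : KernelFrame f W)
    (i : Fin 2) {U : X.Opens} (hU : U ≤ W) (r : Γ(P, f ⁻¹ᵁ U)) :
    (f.app U).hom (F.gen i U hU r) = 0 := by
  classical
  refine (F.app_eq_zero_iff U hU _).mpr ⟨Pi.single i r, ?_⟩
  rw [Finset.sum_eq_single i (fun j _ hj => by rw [Pi.single_eq_of_ne hj, map_zero])
    (fun h => absurd (Finset.mem_univ i) h), Pi.single_eq_same]

/-- The data that describe a rope on the projective line whose conormal bundle is the sum of two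
twisting sheaves of degrees `d 0` and `d 1`: on each of the two charts a coordinate and generators
of the ideal sheaf, and the transition functions between them. -/
structure RopeCharts (Y : Rope (PSpace.toSpec k 1) E) (d : Fin 2 → ℤ) where
  W : Fin (1 + 1) → Y.total.Opens
  preimage_W (c) : Y.incl ⁻¹ᵁ W c = stdOpen k 1 c
  frame (c) : KernelFrame Y.incl (W c)
  coord (c) : Γ(Y.total, W c)
  app_coord (c) (V : (PSpace k 1).Opens) (hV : V ≤ Y.incl ⁻¹ᵁ W c) (hV' : V ≤ stdOpen k 1 c) :
    (Y.incl.appLE (W c) V hV).hom (coord c) = chartCoord k c V hV'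
  unit : Γ(Y.total, W 0 ⊓ W 1)ˣ
  coe_unit : (unit : Γ(Y.total, W 0 ⊓ W 1)) = resSec inf_le_left (coord 0)
  laurent : Fin 2 → LaurentPolynomial k
  coord_one_eq : resSec inf_le_right (coord 1) = ((unit⁻¹ : _ˣ) : Γ(Y.total, W 0 ⊓ W 1)) +
    ∑ i, LaurentPolynomial.eval₂ (scal Y.toSpec (W 0 ⊓ W 1)) unit (laurent i) *
      resSec inf_le_left ((frame 0).gen i (W 0) le_rfl 1)
  gen_one_eq (i) : resSec inf_le_right ((frame 1).gen i (W 1) le_rfl 1) =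
    ((unit ^ d i : _ˣ) : Γ(Y.total, W 0 ⊓ W 1)) *
      resSec inf_le_left ((frame 0).gen i (W 0) le_rfl 1)

theorem Rope.app_scal (Y : Rope (PSpace.toSpec k 1) E) (U : Y.total.Opens) (a : k) :
    (Y.incl.app U).hom (scal Y.toSpec U a) = scal (PSpace.toSpec k 1) (Y.incl ⁻¹ᵁ U) a := by
  rw [← Scheme.Hom.appLE_eq_app, appLE_scal, Y.incl_toSpec]

/-- Both coordinates lift by `KernelFrame.app_surjective`. On the overlap the lifts have product 1
modulo nilpotents, so the first is a unit `t`. The second differs from `t⁻¹` by an element of the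
ideal, with coefficients that are Laurent polynomials in the coordinate. -/
theorem Rope.nonempty_charts (Y : Rope (PSpace.toSpec k 1) E) {d : Fin 2 → ℤ}
    (inj : ∀ i, twist (grading k 1) (d i) ⟶ E)
    (hinj : ∀ (V : (PSpace k 1).Opens) (m : Γ(E, V)), ∃ t : ∀ i, Γ(twist (grading k 1) (d i), V),
      m = ∑ i, (inj i).app V (t i)) : Nonempty (RopeCharts Y d) := by
  have := Y.isClosedImmersion
  choose W hW using fun c => Y.exists_preimage_eq (stdOpen k 1 c)
  let F : ∀ c, KernelFrame Y.incl (W c) := fun c =>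
    Y.frame inj hinj (MvPolynomial.X c) (X_mem_grading c) (W c) (hW c).le
  have haff : ∀ c, IsAffineOpen (Y.incl ⁻¹ᵁ W c) := fun c => by
    rw [hW]
    exact Proj.isAffineOpen_basicOpen _ _ (X_mem_grading c) one_pos
  choose τ hτ using fun c => (F c).app_surjective Y.incl_surjective le_rfl (haff c)
    (chartCoord k c _ (hW c).le)
  have hτ' : ∀ (c) (V : (PSpace k 1).Opens) (hV : V ≤ Y.incl ⁻¹ᵁ W c) (hV' : V ≤ stdOpen k 1 c),
      (Y.incl.appLE (W c) V hV).hom (τ c) = chartCoord k c V hV' := fun c V hV hV' => by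
    have h := congrArg (resSec hV) (hτ c)
    rw [← Scheme.Hom.appLE_eq_app, resSec_appLE] at h
    exact h
  have hV : Y.incl ⁻¹ᵁ (W 0 ⊓ W 1) = stdOpen k 1 0 ⊓ stdOpen k 1 1 := by
    rw [Scheme.Hom.preimage_inf, hW, hW]
  have hres : ∀ (c) (h : W 0 ⊓ W 1 ≤ W c) (hV' : Y.incl ⁻¹ᵁ (W 0 ⊓ W 1) ≤ stdOpen k 1 c),
      (Y.incl.app (W 0 ⊓ W 1)).hom (resSec h (τ c)) = chartCoord k c _ hV' := fun c h hV' => by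
    rw [← Scheme.Hom.appLE_eq_app, appLE_resSec]
    exact hτ' c _ _ _
  have hmul := chartCoord_mul_chartCoord_rev (c := 0) (hV.le.trans inf_le_left)
    (hV.le.trans inf_le_right)
  have hker : (Y.incl.app (W 0 ⊓ W 1)).hom
      (resSec inf_le_left (τ 0) * resSec inf_le_right (τ 1) - 1) = 0 := by
    rw [map_sub, map_mul, map_one, hres 0 _ (hV.le.trans inf_le_left),
      hres 1 _ (hV.le.trans inf_le_right)]
    exact sub_eq_zero.mpr hmul
  have hunit : IsUnit (resSec inf_le_left (τ 0) : Γ(Y.total, W 0 ⊓ W 1)) := by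
    have h2 : IsNilpotent (resSec inf_le_left (τ 0) * resSec inf_le_right (τ 1) - 1 :
      Γ(Y.total, W 0 ⊓ W 1)) := ⟨2, by rw [pow_two]; exact Y.sq_zero _ _ _ hker hker⟩
    have h3 := h2.isUnit_add_one
    rw [sub_add_cancel] at h3
    exact isUnit_of_mul_isUnit_left h3
  obtain ⟨t, ht⟩ := hunit
  have hsurj := eval₂_chartCoord_surjective hV (Units.map (Y.incl.app (W 0 ⊓ W 1)).hom.toMonoidHom t)
    (by
      refine Eq.trans ?_ (hres 0 inf_le_left (hV.le.trans inf_le_left))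
      exact congrArg _ ht)
  have ht' : (Y.incl.app (W 0 ⊓ W 1)).hom t = chartCoord k 0 _ (hV.le.trans inf_le_left) := by
    rw [ht]
    exact hres 0 _ _
  have ht'' : (Y.incl.app (W 0 ⊓ W 1)).hom ((t⁻¹ : _ˣ) : Γ(Y.total, W 0 ⊓ W 1)) =
      chartCoord k 1 _ (hV.le.trans inf_le_right) := by
    have h1 : (Y.incl.app (W 0 ⊓ W 1)).hom t *
        (Y.incl.app (W 0 ⊓ W 1)).hom ((t⁻¹ : _ˣ) : Γ(Y.total, W 0 ⊓ W 1)) = 1 := by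
      rw [← map_mul, Units.mul_inv, map_one]
    rw [ht'] at h1
    exact (IsUnit.of_mul_eq_one _ h1).mul_left_cancel (h1.trans hmul.symm)
  obtain ⟨r, hr⟩ := ((F 0).app_eq_zero_iff (W 0 ⊓ W 1) inf_le_left
    (resSec inf_le_right (τ 1) - ((t⁻¹ : _ˣ) : Γ(Y.total, W 0 ⊓ W 1)))).mp (by
      rw [map_sub, ht'', hres 1 _ (hV.le.trans inf_le_right), sub_self])
  choose δ hδ using fun i => hsurj (r i)
  have hscal : (Y.incl.app (W 0 ⊓ W 1)).hom.comp (scal Y.toSpec (W 0 ⊓ W 1)) =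
      scal (PSpace.toSpec k 1) _ := RingHom.ext (Y.app_scal _)
  refine ⟨⟨W, hW, F, τ, hτ', t, ht, δ, ?_, fun i => ?_⟩⟩
  · rw [← sub_eq_iff_eq_add', hr]
    refine Finset.sum_congr rfl fun i _ => ?_
    rw [← hδ i, ← hscal]
    refine Eq.trans ?_ ((F 0).gen_app i inf_le_left _)
    exact congrArg _ (LaurentPolynomial.map_eval₂ _ _ _ _).symm
  · rw [← (F 0).gen_app i inf_le_left, (F 1).res_gen, map_one]
    refine (Y.frame_gen_eq inj hinj (X_mem_grading 0) (X_mem_grading 1) (W 0) (W 1) (hW 0).le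
      (hW 1).le i (W 0 ⊓ W 1) inf_le_left inf_le_right 1).trans ?_
    refine congrArg ((F 0).gen i (W 0 ⊓ W 1) inf_le_left) ?_
    rw [one_mul, Units.zpow_eq_pow_mul_pow, RingHom.map_mul, RingHom.map_pow, RingHom.map_pow,
      ht', ht'']
    rfl

end Charts

end RopeEmbedding

end

noncomputable section

namespace RopeEmbedding

open Polynomial

/-! ### The morphism from the rope to projective space. -/

namespace Rope

variable {k : Type u} [Field k] {P : Scheme.{u}} {p : P ⟶ Spec (CommRingCat.of k)} {E : P.Modules}
  (Y : Rope p E)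

theorem le_of_preimage_le {U U' : Y.total.Opens} (h : Y.incl ⁻¹ᵁ U ≤ Y.incl ⁻¹ᵁ U') : U ≤ U' :=
  fun y hy => by
    obtain ⟨x, rfl⟩ := Y.incl_surjective y
    exact h hy

/-- The rope and the line have the same points, so a function invertible on the line vanishes
nowhere on the rope. -/
theorem isUnit_of_isUnit_app {U : Y.total.Opens} {s : Γ(Y.total, U)}
    (h : IsUnit ((Y.incl.app U).hom s)) : IsUnit s := by
  have h1 : Y.total.basicOpen s = U := by
    refine le_antisymm (Y.total.basicOpen_le s) (Y.le_of_preimage_le ?_)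
    rw [Scheme.preimage_basicOpen]
    exact (Scheme.basicOpen_of_isUnit P h).ge
  have h2 : IsUnit (resSec (Y.total.basicOpen_le s) s) := RingedSpace.isUnit_res_basicOpen _ _
  have h3 := h2.map (resSec h1.ge)
  rwa [resSec_resSec, resSec_self] at h3

end Rope

namespace RopeCharts

variable {k : Type u} [Field k] {E : (PSpace k 1).Modules} {Y : Rope (PSpace.toSpec k 1) E}
  {d : Fin 2 → ℤ} (D : RopeCharts Y d) (p : Fin (1 + 1) → Fin 2 → ℕ → k[X]) (N : ℕ)

/-- The generators of the ideal sheaf on the charts. -/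
def gen (c : Fin (1 + 1)) (i : Fin 2) : Γ(Y.total, D.W c) := (D.frame c).gen i (D.W c) le_rfl 1

/-- The lifting to the `c`-th chart of the monomial `X₀ ^ (N - m) * X₁ ^ m` with nilpotent part
given by the polynomials `p c`. -/
def mon (c : Fin (1 + 1)) (m : ℕ) : Γ(Y.total, D.W c) :=
  D.coord c ^ chartExp N c m +
    ∑ i, (p c i m).eval₂ (scal Y.toSpec (D.W c)) (D.coord c) * D.gen c i

theorem app_gen (c : Fin (1 + 1)) (i : Fin 2) (V : (PSpace k 1).Opens)
    (hV : V ≤ Y.incl ⁻¹ᵁ D.W c) : (Y.incl.appLE _ V hV).hom (D.gen c i) = 0 := by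
  have h := congrArg (resSec hV) ((D.frame c).app_gen i le_rfl 1)
  rwa [← Scheme.Hom.appLE_eq_app, resSec_appLE, map_zero] at h

theorem app_mon (c : Fin (1 + 1)) (m : ℕ) (V : (PSpace k 1).Opens)
    (hV : V ≤ Y.incl ⁻¹ᵁ D.W c) (hV' : V ≤ stdOpen k 1 c) :
    (Y.incl.appLE _ V hV).hom (D.mon p N c m) = chartCoord k c V hV' ^ chartExp N c m := by
  rw [mon, map_add, map_pow, D.app_coord c V hV hV', map_sum, Finset.sum_eq_zero, add_zero]
  intro i _
  rw [map_mul, D.app_gen, mul_zero]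

theorem iSup_W : ⨆ c, D.W c = ⊤ := by
  refine top_unique fun y _ => ?_
  obtain ⟨x, rfl⟩ := Y.incl_surjective y
  obtain ⟨c, hc⟩ := Opens.mem_iSup.mp
    ((iSup_basicOpen_X (k := k) (n := 1)).symm ▸ Opens.mem_top x)
  exact Opens.mem_iSup.mpr ⟨c, (D.preimage_W c).ge hc⟩

theorem exists_unit_mul {e : Fin 2 → ℕ} (he : ∀ i, (e i - N - 1 : ℤ) = d i)
    {ε : Fin 2 → LaurentPolynomial k} (hp : ∀ i, IsLift N (e i) (D.laurent i) (ε i) (p 0 i) (p 1 i)) :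
    ∃ u : Γ(Y.total, D.W 0 ⊓ D.W 1)ˣ, ∀ m ≤ N,
      resSec (inf_le_left : D.W 0 ⊓ D.W 1 ≤ D.W 0) (D.mon p N 0 m) = u * resSec (inf_le_right : D.W 0 ⊓ D.W 1 ≤ D.W 1) (D.mon p N 1 m) := by
  have happ : ∀ i, (Y.incl.app (D.W 0 ⊓ D.W 1)).hom (resSec inf_le_left (D.gen 0 i)) = 0 := fun i => by
    rw [← Scheme.Hom.appLE_eq_app, appLE_resSec]
    exact D.app_gen 0 i _ _
  have hunit : IsUnit (1 + ∑ i, LaurentPolynomial.eval₂ (scal Y.toSpec (D.W 0 ⊓ D.W 1)) D.unit (ε i) *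
      resSec inf_le_left (D.gen 0 i)) := by
    refine Y.isUnit_of_isUnit_app ?_
    rw [map_add, map_sum, Finset.sum_eq_zero, add_zero, map_one]
    · exact isUnit_one
    · intro i _
      rw [map_mul, happ, mul_zero]
  obtain ⟨w, hw⟩ := hunit
  refine ⟨D.unit ^ N * w, fun m hm => ?_⟩
  have h := IsLift.chart_eq (scal Y.toSpec (D.W 0 ⊓ D.W 1)) hp D.unit (resSec inf_le_right (D.coord 1))
    (fun i => resSec inf_le_left (D.gen 0 i)) (fun i => resSec inf_le_right (D.gen 1 i))
    (fun i j => Y.sq_zero _ _ _ (happ i) (happ j))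
    (fun i => by rw [he i]; exact D.gen_one_eq i) D.coord_one_eq m hm
  have hev : ∀ (c) (hc : D.W 0 ⊓ D.W 1 ≤ D.W c), resSec hc (D.mon p N c m) =
      resSec hc (D.coord c) ^ chartExp N c m +
        ∑ i, (p c i m).eval₂ (scal Y.toSpec (D.W 0 ⊓ D.W 1)) (resSec hc (D.coord c)) *
          resSec hc (D.gen c i) := fun c hc => by
    rw [mon, map_add, map_pow, map_sum]
    refine congrArg _ (Finset.sum_congr rfl fun i _ => ?_)
    rw [map_mul, Polynomial.hom_eval₂]
    refine congrArg (fun φ => Polynomial.eval₂ φ _ _ * _) (RingHom.ext fun a => ?_)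
    exact resSec_scal _ _ a
  rw [hev, hev, Units.val_mul, Units.val_pow_eq_pow_val, hw, ← D.coe_unit]
  exact h

variable (F : Fin (N + 1) → MvPolynomial (Fin (1 + 1)) k)

/-- The lifting to the `c`-th chart of the binary form `F l`. -/
def form (c : Fin (1 + 1)) (l : Fin (N + 1)) : Γ(Y.total, D.W c) :=
  ∑ m ∈ Finset.range (N + 1), scal Y.toSpec (D.W c) (formCoeff N m (F l)) * D.mon p N c m

theorem app_form (hF : ∀ l, F l ∈ grading k 1 N) (c : Fin (1 + 1)) (l : Fin (N + 1))
    (V : (PSpace k 1).Opens) (hV : V ≤ Y.incl ⁻¹ᵁ D.W c) (hV' : V ≤ stdOpen k 1 c) :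
    (Y.incl.appLE _ V hV).hom (D.form p N F c l) =
      frac (F l) (MvPolynomial.X c ^ N) (hF l) (X_pow_mem c)
        (hV'.trans (basicOpen_le_basicOpen_pow _ _)) := by
  rw [frac_form_eq_sum c V hV', form, map_sum]
  refine Finset.sum_congr rfl fun m _ => ?_
  rw [map_mul, D.app_mon p N c m V hV hV', appLE_scal, Y.incl_toSpec]

variable {F} in
theorem sum_form {B : Matrix (Fin (N + 1)) (Fin (N + 1)) k}
    (hB : ∀ m m' : Fin (N + 1), ∑ l, B m l * formCoeff N m' (F l) = if m = m' then 1 else 0)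
    (c : Fin (1 + 1)) (m : Fin (N + 1)) :
    ∑ l, scal Y.toSpec (D.W c) (B m l) * D.form p N F c l = D.mon p N c m := by
  simp only [form, Finset.mul_sum]
  rw [Finset.sum_comm, Finset.sum_range]
  have h : ∀ m' : Fin (N + 1), ∑ l, scal Y.toSpec (D.W c) (B m l) *
      (scal Y.toSpec (D.W c) (formCoeff N m' (F l)) * D.mon p N c m') =
      if m = m' then D.mon p N c m' else 0 := fun m' => by
    simp only [← mul_assoc, ← map_mul]
    rw [← Finset.sum_mul, ← map_sum, hB]
    split <;> simp
  rw [Finset.sum_congr rfl fun m' _ => h m', Finset.sum_ite_eq, if_pos (Finset.mem_univ m)]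

variable {F} in
/-- The liftings of the forms of a rational normal curve define a morphism from the rope to
projective space. -/
theorem exists_isGivenBy_form {e : Fin 2 → ℕ} (he : ∀ i, (e i - N - 1 : ℤ) = d i)
    {ε : Fin 2 → LaurentPolynomial k} (hp : ∀ i, IsLift N (e i) (D.laurent i) (ε i) (p 0 i) (p 1 i))
    (hF : ∀ l, F l ∈ grading k 1 N) (hli : LinearIndependent k F) :
    ∃ j : Y.total ⟶ PSpace k N, j ≫ PSpace.toSpec k N = Y.toSpec ∧
      ∀ c, IsGivenBy j (D.W c) (D.form p N F c) := by
  obtain ⟨B, hB⟩ := exists_formCoeff_inverse hF hli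
  refine exists_isGivenBy Y.toSpec D.W D.iSup_W (fun c => D.form p N F c) (fun c => ?_) ?_
  · have hm : chartExp N c 0 < N + 1 := Nat.lt_succ_of_le (chartExp_le c (Nat.zero_le N))
    -- `chartExp N c` is its own inverse on indices up to `N`. The monomial of index `chartExp N c
    -- 0` is 1 on the chart, so its lift is a unit in the ideal spanned by the forms.
    have hexp : chartExp N c (chartExp N c 0) = 0 := by
      unfold chartExp
      split <;> simp
    have hu : IsUnit (D.mon p N c (chartExp N c 0)) := by
      refine Y.isUnit_of_isUnit_app ?_
      rw [← Scheme.Hom.appLE_eq_app, D.app_mon p N c _ _ _ (D.preimage_W c).le, hexp, pow_zero]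
      exact isUnit_one
    refine Ideal.eq_top_of_isUnit_mem _ ?_ hu
    rw [← D.sum_form p N hB c ⟨_, hm⟩]
    exact Ideal.sum_mem _ fun l _ => Ideal.mul_mem_left _ _ (Ideal.subset_span ⟨l, rfl⟩)
  · have key : ∀ (c c') (u : Γ(Y.total, D.W c ⊓ D.W c')ˣ) (_ : ∀ m ≤ N,
        resSec (inf_le_left : D.W c ⊓ D.W c' ≤ D.W c) (D.mon p N c m) = u * resSec (inf_le_right : D.W c ⊓ D.W c' ≤ D.W c') (D.mon p N c' m)) (l),
        resSec (inf_le_left : D.W c ⊓ D.W c' ≤ D.W c) (D.form p N F c l) = u * resSec (inf_le_right : D.W c ⊓ D.W c' ≤ D.W c') (D.form p N F c' l) := by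
      intro c c' u hu l
      rw [form, form, map_sum, map_sum, Finset.mul_sum]
      refine Finset.sum_congr rfl fun m hm => ?_
      rw [map_mul, map_mul, resSec_scal, resSec_scal, hu m (by have := Finset.mem_range.mp hm; omega)]
      ring
    obtain ⟨u, hu⟩ := D.exists_unit_mul p N he hp
    intro c c'
    fin_cases c <;> fin_cases c'
    · exact ⟨1, fun l => by rw [Units.val_one, one_mul]⟩
    · exact ⟨u, key 0 1 u hu⟩
    · refine ⟨Units.map (resSec (le_inf inf_le_right inf_le_left)).toMonoidHom u⁻¹, key 1 0 _ fun m hm => ?_⟩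
      have h := congrArg (resSec (le_inf inf_le_right inf_le_left : D.W 1 ⊓ D.W 0 ≤ D.W 0 ⊓ D.W 1)) (hu m hm)
      rw [map_mul, resSec_resSec, resSec_resSec] at h
      rw [h, ← mul_assoc]
      refine Eq.symm (Eq.trans (congrArg (· * _) ?_) (one_mul _))
      exact (map_mul (resSec _) _ _).symm.trans ((congrArg _ (Units.inv_mul u)).trans (map_one _))
    · exact ⟨1, fun l => by rw [Units.val_one, one_mul]⟩

theorem incl_comp_eq {F : Fin (N + 1) → MvPolynomial (Fin (1 + 1)) k} (hF : ∀ l, F l ∈ grading k 1 N)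
    {i : PSpace k 1 ⟶ PSpace k N} (hi : i ≫ PSpace.toSpec k N = PSpace.toSpec k 1)
    (hiF : ∀ (c : Fin (1 + 1)) (V : (PSpace k 1).Opens)
        (hV : V ≤ stdOpen k 1 c), IsGivenBy i V (fun l => frac (F l) (MvPolynomial.X c ^ N) (hF l) (X_pow_mem c)
          (hV.trans (basicOpen_le_basicOpen_pow _ _))))
    {j : Y.total ⟶ PSpace k N} (hj : j ≫ PSpace.toSpec k N = Y.toSpec)
    (hjF : ∀ c, IsGivenBy j (D.W c) (D.form p N F c)) : Y.incl ≫ j = i := by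
  refine Scheme.hom_ext_of_forall _ _ fun x => ?_
  obtain ⟨c, hc⟩ := Opens.mem_iSup.mp
    ((iSup_basicOpen_X (k := k) (n := 1)).symm ▸ Opens.mem_top x)
  refine ⟨stdOpen k 1 c, hc, IsGivenBy.unique ?_ (hiF c _ le_rfl) ?_⟩
  · have h := (hjF c).comp Y.incl (W := stdOpen k 1 c) (D.preimage_W c).ge
    have hfun : (fun l => (Y.incl.appLE (D.W c) (stdOpen k 1 c) (D.preimage_W c).ge).hom
        (D.form p N F c l)) = _ := funext fun l => D.app_form p N F hF c l _ _ le_rfl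
    rw [hfun] at h
    exact h
  · rw [Category.assoc, hj, Y.incl_toSpec, hi]

end RopeCharts

end RopeEmbedding

end

noncomputable section

namespace RopeEmbedding

open Polynomial

/-! ### Surjectivity on stalks and the closed immersion. -/

section Germs

variable {X Z : Scheme.{u}}

/-- The germ of a section at a point, as a ring homomorphism. -/
def germHom {U : X.Opens} {x : X} (hx : x ∈ U) : Γ(X, U) →+* X.presheaf.stalk x :=
  (X.presheaf.germ U x hx).hom

theorem germHom_resSec {U V : X.Opens} (h : V ≤ U) {x : X} (hx : x ∈ V) (s : Γ(X, U)) :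
    germHom hx (resSec h s) = germHom (h hx) s :=
  X.presheaf.germ_res_apply (homOfLE h) x hx s

theorem germHom_appLE (f : X ⟶ Z) {U : Z.Opens} {V : X.Opens} (h : V ≤ f ⁻¹ᵁ U) {x : X}
    (hx : x ∈ V) (s : Γ(Z, U)) :
    germHom hx ((f.appLE U V h).hom s) = (f.stalkMap x).hom (germHom (show f x ∈ U from h hx) s) := by
  have h1 : (f.appLE U V h).hom s = resSec h ((f.app U).hom s) := by
    rw [← Scheme.Hom.appLE_eq_app, resSec_appLE]
  rw [h1, germHom_resSec]
  exact (f.germ_stalkMap_apply U x (h hx) s).symm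

end Germs

namespace Rope

variable {k : Type u} [Field k] {P : Scheme.{u}} {p : P ⟶ Spec (CommRingCat.of k)} {E : P.Modules}
  (Y : Rope p E)

theorem exists_germHom_eq {x : P} {r : Y.total.presheaf.stalk (Y.incl x)}
    (hr : (Y.incl.stalkMap x).hom r = 0) {W : Y.total.Opens} (hW : Y.incl x ∈ W) :
    ∃ (U : Y.total.Opens) (_ : U ≤ W) (hU : Y.incl x ∈ U) (s : Γ(Y.total, U)),
      IsAffineOpen (Y.incl ⁻¹ᵁ U) ∧ (Y.incl.app U).hom s = 0 ∧ germHom hU s = r := by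
  obtain ⟨U₀, hxU₀, s₀, rfl⟩ := Y.total.presheaf.exists_germ_eq r
  have h0 : (P.presheaf.germ (Y.incl ⁻¹ᵁ U₀) x hxU₀) ((Y.incl.app U₀).hom s₀) =
      (P.presheaf.germ (Y.incl ⁻¹ᵁ U₀) x hxU₀) 0 :=
    (Y.incl.germ_stalkMap_apply U₀ x hxU₀ s₀).symm.trans (hr.trans (map_zero _).symm)
  obtain ⟨V, hxV, i₁, i₂, hV⟩ := P.presheaf.germ_eq x _ _ _ _ h0
  have hV' : resSec i₁.le ((Y.incl.app U₀).hom s₀) = 0 := hV.trans (map_zero _)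
  have hx : x ∈ V ⊓ Y.incl ⁻¹ᵁ W := ⟨hxV, hW⟩
  obtain ⟨V', haff, hxV', hle⟩ := exists_isAffineOpen_mem_and_subset hx
  obtain ⟨U, rfl⟩ := Y.exists_preimage_eq V'
  have hUV : Y.incl ⁻¹ᵁ U ≤ V := fun y hy => (hle hy).1
  have hUW : U ≤ W := Y.le_of_preimage_le fun y hy => (hle hy).2
  have hUU₀ : U ≤ U₀ := Y.le_of_preimage_le (hUV.trans i₁.le)
  refine ⟨U, hUW, hxV', resSec hUU₀ s₀, haff, ?_, germHom_resSec _ _ _⟩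
  have h1 := congrArg (resSec hUV) hV'
  rw [resSec_resSec, map_zero] at h1
  rw [resSec_app]
  exact h1

end Rope

namespace RopeCharts

variable {k : Type u} [Field k] {E : (PSpace k 1).Modules} {Y : Rope (PSpace.toSpec k 1) E}
  {d : Fin 2 → ℤ} (D : RopeCharts Y d) (p : Fin (1 + 1) → Fin 2 → ℕ → k[X]) {N : ℕ}

theorem mul_germHom_gen (c : Fin (1 + 1)) {x : PSpace k 1} (hx : Y.incl x ∈ D.W c) (i : Fin 2)
    {r : Y.total.presheaf.stalk (Y.incl x)} (hr : (Y.incl.stalkMap x).hom r = 0) :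
    r * germHom hx (D.gen c i) = 0 := by
  obtain ⟨U, hUW, hU, s, -, hs, rfl⟩ := Y.exists_germHom_eq hr hx
  rw [← germHom_resSec hUW hU, ← map_mul, Y.sq_zero U _ _ hs, map_zero]
  rw [← Scheme.Hom.appLE_eq_app, appLE_resSec]
  exact D.app_gen c i _ _

/-- The germ extends to a section of the ideal over an open set with affine trace on the line; there
the coefficients, functions on the line, lift to the rope. -/
theorem exists_eq_sum_germHom_gen (c : Fin (1 + 1)) {x : PSpace k 1} (hx : Y.incl x ∈ D.W c)
    {r : Y.total.presheaf.stalk (Y.incl x)} (hr : (Y.incl.stalkMap x).hom r = 0) :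
    ∃ a : Fin 2 → Y.total.presheaf.stalk (Y.incl x), r = ∑ i, a i * germHom hx (D.gen c i) := by
  have := Y.isClosedImmersion
  obtain ⟨U, hUW, hU, s, haff, hs, rfl⟩ := Y.exists_germHom_eq hr hx
  obtain ⟨z, rfl⟩ := ((D.frame c).app_eq_zero_iff U hUW s).mp hs
  choose b hb using fun i => (D.frame c).app_surjective Y.incl_surjective hUW haff (z i)
  refine ⟨fun i => germHom hU (b i), ?_⟩
  rw [map_sum]
  refine Finset.sum_congr rfl fun i _ => ?_
  rw [← hb i, (D.frame c).gen_app i hUW, map_mul, germHom_resSec]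
  rfl

variable {F : Fin (N + 1) → MvPolynomial (Fin (1 + 1)) k}

/-- The morphism given by the liftings of the forms of a rational normal curve is a closed
immersion if the minors of second differences of the polynomials generate the unit ideal. -/
theorem isClosedImmersion_of_isGivenBy (hF : ∀ l, F l ∈ grading k 1 N)
    (hli : LinearIndependent k F)
    (hp : ∀ c, minorIdeal N (fun i l => p c i (chartExp N c l)) = ⊤)
    {j : Y.total ⟶ PSpace k N} (hj : j ≫ PSpace.toSpec k N = Y.toSpec)
    (hjF : ∀ c, IsGivenBy j (D.W c) (D.form p N F c)) [IsClosedImmersion (Y.incl ≫ j)] :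
    IsClosedImmersion j := by
  have := Y.isClosedImmersion
  obtain ⟨B, hB⟩ := exists_formCoeff_inverse hF hli
  have hstalk : ∀ y, Function.Surjective (j.stalkMap y) := fun y => by
    obtain ⟨x, rfl⟩ := Y.incl_surjective y
    obtain ⟨c, hc⟩ := Opens.mem_iSup.mp
      ((iSup_basicOpen_X (k := k) (n := 1)).symm ▸ Opens.mem_top x)
    have hx : Y.incl x ∈ D.W c := (D.preimage_W c).ge hc
    obtain ⟨l₀, hl₀⟩ := Opens.mem_iSup.mp
      ((iSup_basicOpen_X (k := k) (n := N)).symm ▸ Opens.mem_top (j (Y.incl x)))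
    let V : Y.total.Opens := D.W c ⊓ j ⁻¹ᵁ stdOpen k N l₀
    have hxV : Y.incl x ∈ V := ⟨hx, hl₀⟩
    have hunit : IsUnit (germHom hx (D.form p N F c l₀)) :=
      (Scheme.mem_basicOpen _ _ _ hx).mp (((hjF c).basicOpen_eq l₀).ge hxV)
    -- The pullback of `X_m / X_{l₀}` is `Λ` times the germ of the `m`-th lifted form. So these
    -- products, and via `B` also `Λ` times the lifted monomials, lie in the image of the stalk map.
    obtain ⟨Λ, hΛ⟩ := hunit.exists_left_inv
    have hΛ' : IsUnit Λ := IsUnit.of_mul_eq_one _ hΛ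
    have hrange : ∀ s : Γ(PSpace k N, stdOpen k N l₀),
        germHom hxV ((j.appLE _ V inf_le_right).hom s) ∈ (j.stalkMap (Y.incl x)).hom.range :=
      fun s => ⟨_, (germHom_appLE j inf_le_right hxV s).symm⟩
    have hscal : ∀ a, germHom hx (scal Y.toSpec (D.W c) a) ∈ (j.stalkMap (Y.incl x)).hom.range :=
      fun a => by
        have h := hrange (scal (PSpace.toSpec k N) _ a)
        rwa [appLE_scal, hj, ← resSec_scal Y.toSpec inf_le_left, germHom_resSec] at h
    have hform : ∀ m, Λ * germHom hx (D.form p N F c m) ∈ (j.stalkMap (Y.incl x)).hom.range :=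
      fun m => by
        have h := congrArg (germHom hxV) ((hjF c).mul_eq l₀ m V inf_le_right inf_le_left)
        rw [map_mul, germHom_resSec, germHom_resSec] at h
        rw [← h, mul_left_comm, hΛ, mul_one]
        exact hrange _
    have hmon : ∀ m ≤ N, Λ * germHom hx (D.mon p N c m) ∈ (j.stalkMap (Y.incl x)).hom.range :=
      fun m hm => by
        rw [← D.sum_form p N hB c ⟨m, Nat.lt_succ_of_le hm⟩, map_sum, Finset.mul_sum]
        refine sum_mem fun l _ => ?_
        rw [map_mul, mul_left_comm]
        exact mul_mem (hscal _) (hform l)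
    have hexp : ∀ l ≤ N, chartExp N c (chartExp N c l) = l := fun l hl => by
      unfold chartExp
      split <;> omega
    refine surjective_of_minorIdeal_eq_top ((germHom hx).comp (scal Y.toSpec (D.W c)))
      (j.stalkMap (Y.incl x)).hom (Y.incl.stalkMap x).hom ?_ (germHom hx (D.coord c))
      (fun i => germHom hx (D.gen c i)) (fun r i hr => D.mul_germHom_gen c hx i hr) (fun i => ?_)
      (fun r hr => D.exists_eq_sum_germHom_gen c hx hr) N _ (hp c)
      (fun l => germHom hx (D.mon p N c (chartExp N c l))) (fun l hl => ?_) Λ hΛ'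
      (fun l hl => hmon _ (chartExp_le c hl))
    · have h := (Y.incl ≫ j).stalkMap_surjective x
      rw [Scheme.Hom.stalkMap_comp] at h
      exact h
    · rw [← germHom_appLE Y.incl le_rfl hx, D.app_gen, map_zero]
    · rw [mon, hexp l hl, map_add, map_pow, map_sum]
      refine congrArg _ (Finset.sum_congr rfl fun i _ => ?_)
      rw [map_mul, Polynomial.hom_eval₂]
  refine { stalkMap_surjective := hstalk, isClosedEmbedding := ?_ }
  -- Topologically the rope is the line, so `j` inherits being a closed embedding from the curve.
  let e : PSpace k 1 ≃ₜ Y.total := Y.incl.isClosedEmbedding.isEmbedding.toHomeomorphOfSurjective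
    Y.incl_surjective
  have h : ⇑j = ⇑(Y.incl ≫ j) ∘ e.symm := funext fun y => by
    obtain ⟨x, rfl⟩ := e.surjective y
    rw [Function.comp, e.symm_apply_apply]
    rfl
  rw [h]
  exact (Y.incl ≫ j).isClosedEmbedding.comp e.symm.isClosedEmbedding

end RopeCharts

/-- Every rational normal curve of degree `N` in projective space extends to an embedding of every
rope on the projective line whose conormal bundle is a sum of two twisting sheaves of degrees at
least `-N - 1`. -/
theorem Rope.exists_isClosedImmersion {k : Type u} [Field k] [IsAlgClosed k] [CharZero k]
    {E : (PSpace k 1).Modules} (Y : Rope (PSpace.toSpec k 1) E) {d : Fin 2 → ℤ}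
    (inj : ∀ i, twist (grading k 1) (d i) ⟶ E)
    (hinj : ∀ (V : (PSpace k 1).Opens) (m : Γ(E, V)), ∃ t : ∀ i, Γ(twist (grading k 1) (d i), V),
      m = ∑ i, (inj i).app V (t i)) {N : ℕ} (hN : 4 ≤ N) (hd : ∀ i, -(N + 1 : ℤ) ≤ d i)
    {i : PSpace k 1 ⟶ PSpace k N} (hi : IsRationalNormalCurve i) :
    ∃ j : Y.total ⟶ PSpace k N, IsClosedImmersion j ∧ j ≫ PSpace.toSpec k N = Y.toSpec ∧
      Y.incl ≫ j = i := by
  obtain ⟨D⟩ := Y.nonempty_charts inj hinj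
  -- The bound `hd` makes `toNat` exact.
  let e : Fin 2 → ℕ := fun i => (d i + N + 1).toNat
  have he : ∀ i, (e i - N - 1 : ℤ) = d i := fun i => by
    have := hd i
    simp only [e]
    omega
  obtain ⟨ε, u, v, hlift, hu, hv⟩ := exists_isLift_minorIdeal_eq_top N hN e D.laurent
  let p : Fin (1 + 1) → Fin 2 → ℕ → k[X] := ![u, v]
  have hp : ∀ c, minorIdeal N (fun i l => p c i (chartExp N c l)) = ⊤ := fun c => by
    fin_cases c
    · exact hu
    · exact hv
  obtain ⟨F, hF, hli, hiF⟩ := hi.exists_isGivenBy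
  obtain ⟨j, hj, hjF⟩ := D.exists_isGivenBy_form p N he hlift hF hli
  have hji := D.incl_comp_eq p N hF hi.over_base hiF hj hjF
  have : IsClosedImmersion (Y.incl ≫ j) := hji ▸ hi.isClosedImmersion
  exact ⟨j, D.isClosedImmersion_of_isGivenBy p hF hli hp hj hjF, hj, hji⟩

end RopeEmbedding

end

theorem theorem4p2 (k : Type u) [Field k] [IsAlgClosed k] [CharZero k]
    (a b : ℤ) (hab : b ≤ a) (N : ℕ) (hN : max 4 (a - 1) ≤ (N : ℤ))
    (Y : RopeEmbedding.Rope (RopeEmbedding.PSpace.toSpec k 1)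
      (RopeEmbedding.twist (RopeEmbedding.grading k 1) (-a) ⊞
        RopeEmbedding.twist (RopeEmbedding.grading k 1) (-b))) :
    (∀ i : RopeEmbedding.PSpace k 1 ⟶ RopeEmbedding.PSpace k N,
      RopeEmbedding.IsRationalNormalCurve i →
      ∃ j : Y.total ⟶ RopeEmbedding.PSpace k N,
        IsClosedImmersion j ∧ j ≫ RopeEmbedding.PSpace.toSpec k N = Y.toSpec ∧
          Y.incl ≫ j = i) ∧
    ∃ j : Y.total ⟶ RopeEmbedding.PSpace k N,
      IsClosedImmersion j ∧ j ≫ RopeEmbedding.PSpace.toSpec k N = Y.toSpec ∧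
        ∃ i : RopeEmbedding.PSpace k 1 ⟶ RopeEmbedding.PSpace k N,
          RopeEmbedding.IsRationalNormalCurve i ∧ Set.range j = Set.range i := by
  let T : Fin 2 → (RopeEmbedding.PSpace k 1).Modules := fun i =>
    RopeEmbedding.twist (RopeEmbedding.grading k 1) ((![-a, -b] : Fin 2 → ℤ) i)
  obtain ⟨inj, hinj⟩ := RopeEmbedding.exists_inj_biprod T
  have h4 : 4 ≤ N := by omega
  have hd : ∀ i, -(N + 1 : ℤ) ≤ (![-a, -b] : Fin 2 → ℤ) i := fun i => by
    fin_cases i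
    · change -(N + 1 : ℤ) ≤ -a
      omega
    · change -(N + 1 : ℤ) ≤ -b
      omega
  have key : ∀ i : RopeEmbedding.PSpace k 1 ⟶ RopeEmbedding.PSpace k N,
      RopeEmbedding.IsRationalNormalCurve i →
      ∃ j : Y.total ⟶ RopeEmbedding.PSpace k N,
        IsClosedImmersion j ∧ j ≫ RopeEmbedding.PSpace.toSpec k N = Y.toSpec ∧
          Y.incl ≫ j = i := fun i hi => Y.exists_isClosedImmersion inj hinj h4 hd hi
  refine ⟨key, ?_⟩
  -- The final claim needs one rational normal curve to exist. The supports then agree because the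
  -- inclusion of the line in the rope is surjective.
  obtain ⟨i, hi⟩ := RopeEmbedding.exists_isRationalNormalCurve (k := k) (N := N) (by omega)
  obtain ⟨j, hj, hjk, rfl⟩ := key i hi
  refine ⟨j, hj, hjk, Y.incl ≫ j, hi, ?_⟩
  exact (Y.incl_surjective.range_comp j).symm
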